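/- **Setting.** Let $d\in\{2,3\}$, let $\Omega\subset\mathbb R^d$ be a bounded open set with $0\in\Omega$ such that $\mathbb R^d\setminus\overline\Omega$ is connected, and let $\mathbb M\subset\mathbb R^d\setminus\overline\Omega$ be a nonempty bounded open set. Let $k>0$, let $\mathbf m\in\mathbb R^d$ with $|\mathbf m|<1$, and put $\beta=\sqrt{1-|\mathbf m|^2}$ and $|z|_{\mathbf m}=\sqrt{(z\cdot \mathbf m)^2+\beta^2|z|^2}$. Let $g$ be the free field Green's function of the convected Helmholtz equation, $$g(x,y)=\frac{\exp\left(\frac{ik}{\beta^2}\left(-(x-y)\cdot \mathbf m+|x-y|_{\mathbf m}\right)\right)}{4\pi|x-y|_{\mathbf m}}\quad(d=3),$$ $$g(x,y)=\frac{i}{4\beta}\exp\left(-\frac{ik}{\beta^2}(x-y)\cdot \mathbf m\right)H^{(1)}_0\left(\frac{k}{\beta^2}|x-y|_{\mathbf m}\right)\quad(d=2),$$ where $H_0^{(1)}$ is the Hankel function of the first kind of order $0$. All function spaces are complex. Let $\mathrm{HS}$ be the Hilbert space of Hilbert–Schmidt operators on $L^2(\mathbb M)$, with $\langle K_1,K_2\rangle_{\mathrm{HS}}=\operatorname{tr}(K_2^*K_1)$.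 For $q\in L^2(\Omega)$ let $\mathcal C(q)$ be the integral operator on $L^2(\mathbb M)$ with kernel $$c_q(x_1,x_2)=\int_\Omega g(x_1,y)\,q(y)\,\overline{g(x_2,y)}\,dy ,$$ and for $y\in\Omega$ let $\mathcal P_y$ be the integral operator on $L^2(\mathbb M)$ with kernel $g(x_1,y)\overline{g(x_2,y)}$. For $C^{\mathrm{obs}}\in\mathrm{HS}$ let $$\mathcal I(y)=\operatorname*{argmin}_{\mu\in\mathbb R}\|C^{\mathrm{obs}}-\mu\mathcal P_y\|_{\mathrm{HS}}^2=\frac{\operatorname{Re}\langle C^{\mathrm{obs}},\mathcal P_y\rangle_{\mathrm{HS}}}{\|\mathcal P_y\|_{\mathrm{HS}}^2},\qquad y\in\Omega,$$ and consider the DAMAS integral equation $$\mathcal I(y)=\int_\Omega\psi(y,y')\,q(y')\,dy'\qquad(\text{for almost every }y\in\Omega)\tag{D}$$ with one of the two point-spread functions $$\psi(y,y')=\frac{\langle\mathcal P_y,\mathcal P_{y'}\rangle_{\mathrm{HS}}}{\|\mathcal P_{y'}\|_{\mathrm{HS}}^2}\quad\text{(a)}\qquad\text{or}\qquad \psi(y,y')=\frac{\langle\mathcal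 P_y,\mathcal P_{y'}\rangle_{\mathrm{HS}}}{\|\mathcal P_{y}\|_{\mathrm{HS}}^2}\quad\text{(b)}.$$ **Corollary (DAMAS uniqueness).** The map $\mathcal C$ is a well-defined bounded linear operator $L^2(\Omega)\to\mathrm{HS}$, and $\mathcal P_y\in\mathrm{HS}\setminus\{0\}$ for every $y\in\Omega$. Moreover, $$\ker(\mathcal C^*\mathcal C)\cap L^\infty(\Omega)=\ker(\mathcal C)\cap L^\infty(\Omega)=\{0\}.$$ For exact data $C^{\mathrm{obs}}\in\operatorname{ran}(\mathcal C)$ the equation (D) has, for each of the normalisations (a) and (b), at most one solution $q\in L^\infty(\Omega)$. If $C^{\mathrm{obs}}=\mathcal C(q)$ with a real-valued $q\in L^\infty(\Omega)$, then this $q$ is a solution, hence the unique solution in $L^\infty(\Omega)$, of (D) with the normalisation (b). -/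

import Mathlib

open MeasureTheory Set
open scoped ENNReal InnerProductSpace

noncomputable section

/-! ### Hilbert–Schmidt operators on a complex Hilbert space -/

section HilbertSchmidtOperators

/-- The index set of a fixed Hilbert (orthonormal) basis of `H`. -/
def hsIndex (H : Type*) [NormedAddCommGroup H] [InnerProductSpace ℂ H] [CompleteSpace H] : Set H :=
  Classical.choose (exists_hilbertBasis ℂ H)

/-- A fixed Hilbert (orthonormal) basis of `H`. -/
def hsBasis (H : Type*) [NormedAddCommGroup H] [InnerProductSpace ℂ H] [CompleteSpace H] :
    HilbertBasis (hsIndex H) ℂ H :=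
  Classical.choose (Classical.choose_spec (exists_hilbertBasis ℂ H))

/-- The operators `K` with `∑ ‖K φ_j‖² < ∞` for an orthonormal basis `(φ_j)`. -/
def hsSubmodule (H : Type*) [NormedAddCommGroup H] [InnerProductSpace ℂ H] [CompleteSpace H] :
    Submodule ℂ (H →L[ℂ] H) where
  carrier := {K | Memℓp (fun j : hsIndex H => K (hsBasis H j)) 2}
  add_mem' := fun ha hb => Memℓp.add ha hb
  zero_mem' := zero_memℓp
  smul_mem' := fun c _ ha => Memℓp.const_smul ha c

/-- The space `HS(H)` of Hilbert–Schmidt operators on `H`. -/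
def HilbertSchmidt (H : Type*) [NormedAddCommGroup H] [InnerProductSpace ℂ H] [CompleteSpace H] :
    Type _ := ↥(hsSubmodule H)

namespace HilbertSchmidt

instance instAddCommGroup (H : Type*) [NormedAddCommGroup H] [InnerProductSpace ℂ H]
    [CompleteSpace H] : AddCommGroup (HilbertSchmidt H) :=
  inferInstanceAs (AddCommGroup ↥(hsSubmodule H))

instance instModule (H : Type*) [NormedAddCommGroup H] [InnerProductSpace ℂ H]
    [CompleteSpace H] : Module ℂ (HilbertSchmidt H) :=
  inferInstanceAs (Module ℂ ↥(hsSubmodule H))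

/-- The underlying bounded operator. -/
def toCLM {H : Type*} [NormedAddCommGroup H] [InnerProductSpace ℂ H] [CompleteSpace H] :
    HilbertSchmidt H →ₗ[ℂ] (H →L[ℂ] H) := (hsSubmodule H).subtype

theorem toCLM_injective {H : Type*} [NormedAddCommGroup H] [InnerProductSpace ℂ H]
    [CompleteSpace H] : Function.Injective (toCLM (H := H)) :=
  Subtype.val_injective

/-- The square-summable family `(K φ_j)_j`. -/
def toSeq {H : Type*} [NormedAddCommGroup H] [InnerProductSpace ℂ H] [CompleteSpace H] :
    HilbertSchmidt H →ₗ[ℂ] lp (fun _ : hsIndex H => H) 2 where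
  toFun K := ⟨fun j => toCLM K (hsBasis H j), K.2⟩
  map_add' _ _ := rfl
  map_smul' _ _ := rfl

theorem toSeq_injective {H : Type*} [NormedAddCommGroup H] [InnerProductSpace ℂ H]
    [CompleteSpace H] : Function.Injective (toSeq (H := H)) := by
  intro K L h
  apply toCLM_injective
  have h1 : ∀ j, toCLM K (hsBasis H j) = toCLM L (hsBasis H j) := fun j =>
    congrFun (congrArg Subtype.val h) j
  refine ContinuousLinearMap.ext_on (s := range (hsBasis H)) ?_ ?_
  · have := (hsBasis H).dense_span
    rw [Submodule.dense_iff_topologicalClosure_eq_top]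
    exact this
  · rintro _ ⟨j, rfl⟩
    exact h1 j

instance instNormedAddCommGroup (H : Type*) [NormedAddCommGroup H] [InnerProductSpace ℂ H]
    [CompleteSpace H] : NormedAddCommGroup (HilbertSchmidt H) :=
  NormedAddCommGroup.induced (HilbertSchmidt H) (lp (fun _ : hsIndex H => H) 2) toSeq
    toSeq_injective

/-- The Hilbert–Schmidt inner product `tr (K* L) = ∑ ⟪K φ_j, L φ_j⟫`, linear in `L`. -/
instance instInnerProductSpace (H : Type*) [NormedAddCommGroup H] [InnerProductSpace ℂ H]
    [CompleteSpace H] : InnerProductSpace ℂ (HilbertSchmidt H) where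
  norm_smul_le c K := by
    change ‖toSeq (c • K)‖ ≤ ‖c‖ * ‖toSeq K‖
    rw [map_smul]
    exact norm_smul_le _ _
  inner K L := ⟪toSeq K, toSeq L⟫_ℂ
  norm_sq_eq_re_inner K := by
    change ‖toSeq K‖ ^ 2 = RCLike.re ⟪toSeq K, toSeq K⟫_ℂ
    exact norm_sq_eq_re_inner _
  conj_inner_symm K L := inner_conj_symm (toSeq K) (toSeq L)
  add_left K L N := by
    change ⟪toSeq (K + L), toSeq N⟫_ℂ = _
    rw [map_add, inner_add_left]
  smul_left K L c := by
    change ⟪toSeq (c • K), toSeq L⟫_ℂ = _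
    rw [map_smul, inner_smul_left]

theorem inner_eq_trace {H : Type*} [NormedAddCommGroup H] [InnerProductSpace ℂ H]
    [CompleteSpace H] (K L : HilbertSchmidt H) :
    ⟪K, L⟫_ℂ = ∑' j, ⟪hsBasis H j,
      (ContinuousLinearMap.adjoint (toCLM K) ∘L toCLM L) (hsBasis H j)⟫_ℂ := by
  change ⟪toSeq K, toSeq L⟫_ℂ = _
  rw [lp.inner_eq_tsum]
  refine tsum_congr fun j => ?_
  rw [ContinuousLinearMap.comp_apply, ContinuousLinearMap.adjoint_inner_right]
  rfl

theorem norm_toCLM_apply_le {H : Type*} [NormedAddCommGroup H] [InnerProductSpace ℂ H]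
    [CompleteSpace H] (K : HilbertSchmidt H) (x : H) : ‖toCLM K x‖ ≤ ‖K‖ * ‖x‖ := by
  have h := ((hsBasis H).hasSum_repr x).mapL (toCLM K)
  refine le_of_tendsto h.norm (Filter.Eventually.of_forall fun s => ?_)
  have h1 : ∑ j ∈ s, ‖toCLM K (hsBasis H j)‖ ^ 2 ≤ ‖K‖ ^ 2 := by
    have := lp.sum_rpow_le_norm_rpow (p := 2) (by norm_num) (toSeq K) s
    simp only [ENNReal.toReal_ofNat, Real.rpow_ofNat] at this
    exact this
  have h2 : ∑ j ∈ s, ‖(hsBasis H).repr x j‖ ^ 2 ≤ ‖x‖ ^ 2 := by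
    have := lp.sum_rpow_le_norm_rpow (p := 2) (by norm_num) ((hsBasis H).repr x) s
    simpa using this
  calc ‖∑ j ∈ s, toCLM K ((hsBasis H).repr x j • hsBasis H j)‖
      ≤ ∑ j ∈ s, ‖toCLM K (hsBasis H j)‖ * ‖(hsBasis H).repr x j‖ := by
        refine (norm_sum_le _ _).trans (Finset.sum_le_sum fun j _ => ?_)
        rw [map_smul, norm_smul, mul_comm]
    _ ≤ Real.sqrt (∑ j ∈ s, ‖toCLM K (hsBasis H j)‖ ^ 2) *
          Real.sqrt (∑ j ∈ s, ‖(hsBasis H).repr x j‖ ^ 2) := Real.sum_mul_le_sqrt_mul_sqrt _ _ _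
    _ ≤ ‖K‖ * ‖x‖ := by
        gcongr
        · exact Real.sqrt_le_iff.2 ⟨norm_nonneg _, h1⟩
        · exact Real.sqrt_le_iff.2 ⟨norm_nonneg _, h2⟩

instance instCompleteSpace (H : Type*) [NormedAddCommGroup H] [InnerProductSpace ℂ H]
    [CompleteSpace H] : CompleteSpace (HilbertSchmidt H) := by
  refine Metric.complete_of_cauchySeq_tendsto fun u hu => ?_
  have hiso : Isometry (toSeq (H := H)) :=
    AddMonoidHomClass.isometry_of_norm (toSeq (H := H)) fun _ => rfl
  obtain ⟨v, hv⟩ := cauchySeq_tendsto_of_complete (hiso.uniformContinuous.comp_cauchySeq hu)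
  have hbd : ∀ K : HilbertSchmidt H, ‖toCLM K‖ ≤ ‖K‖ := fun K =>
    ContinuousLinearMap.opNorm_le_bound _ (norm_nonneg _) (norm_toCLM_apply_le K)
  have hlip : UniformContinuous (toCLM (H := H)) :=
    (LipschitzWith.of_dist_le_mul (K := 1) fun K L => by
      rw [dist_eq_norm, dist_eq_norm, ← map_sub, NNReal.coe_one, one_mul]
      exact hbd _).uniformContinuous
  obtain ⟨T, hT⟩ := cauchySeq_tendsto_of_complete (hlip.comp_cauchySeq hu)
  have hTv : ∀ j, T (hsBasis H j) = v j := by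
    intro j
    have h1 : Filter.Tendsto (fun n => toCLM (u n) (hsBasis H j)) Filter.atTop
        (nhds (T (hsBasis H j))) :=
      ((ContinuousLinearMap.apply ℂ H (hsBasis H j)).continuous.tendsto T).comp hT
    have h2 : Filter.Tendsto (fun n => toSeq (u n) j) Filter.atTop (nhds (v j)) :=
      ((lp.evalCLM ℂ (fun _ : hsIndex H => H) 2 j).continuous.tendsto v).comp hv
    exact tendsto_nhds_unique h1 h2
  have hmem : T ∈ hsSubmodule H := by
    change Memℓp (fun j : hsIndex H => T (hsBasis H j)) 2
    rw [show (fun j : hsIndex H => T (hsBasis H j)) = v from funext hTv]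
    exact lp.memℓp v
  refine ⟨(⟨T, hmem⟩ : ↥(hsSubmodule H)), ?_⟩
  refine hiso.isEmbedding.tendsto_nhds_iff.2 ?_
  convert hv using 2
  exact lp.ext (funext hTv)

end HilbertSchmidt

end HilbertSchmidtOperators

/-! ### The free field Green's function of the convected Helmholtz equation -/

/-- The Bessel function of the first kind of order `0`. -/
def besselJZero (t : ℝ) : ℝ :=
  ∑' j : ℕ, (-1) ^ j * (t ^ 2 / 4) ^ j / (j.factorial : ℝ) ^ 2

/-- The Bessel function of the second kind of order `0`, for `t > 0`. -/
def besselYZero (t : ℝ) : ℝ :=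
  2 / Real.pi * (Real.log (t / 2) + Real.eulerMascheroniConstant) * besselJZero t +
    2 / Real.pi *
      ∑' j : ℕ, (-1) ^ (j + 1) * (harmonic j : ℝ) * (t ^ 2 / 4) ^ j / (j.factorial : ℝ) ^ 2

/-- The Hankel function of the first kind of order `0`, for `t > 0`. -/
def hankelZero (t : ℝ) : ℂ := (besselJZero t : ℂ) + Complex.I * (besselYZero t : ℂ)

/-- `β² = 1 - |m|²`. -/
def betaSq {d : ℕ} (m : EuclideanSpace ℝ (Fin d)) : ℝ := 1 - ‖m‖ ^ 2

/-- The Mach scaled norm `|z|_m = √((z · m)² + β² |z|²)`. -/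
def machNorm {d : ℕ} (m z : EuclideanSpace ℝ (Fin d)) : ℝ :=
  Real.sqrt (⟪z, m⟫_ℝ ^ 2 + betaSq m * ‖z‖ ^ 2)

/-- The free field Green's function in two dimensions. -/
def greenTwo (k : ℝ) (m x y : EuclideanSpace ℝ (Fin 2)) : ℂ :=
  Complex.I / (4 * (Real.sqrt (betaSq m) : ℂ)) *
    Complex.exp (-(Complex.I * (k / betaSq m : ℝ) * (⟪x - y, m⟫_ℝ : ℂ))) *
    hankelZero (k / betaSq m * machNorm m (x - y))

/-- The free field Green's function in three dimensions. -/
def greenThree (k : ℝ) (m x y : EuclideanSpace ℝ (Fin 3)) : ℂ :=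
  Complex.exp (Complex.I * (k / betaSq m : ℝ) *
      ((-⟪x - y, m⟫_ℝ + machNorm m (x - y) : ℝ) : ℂ)) /
    (4 * (Real.pi : ℂ) * (machNorm m (x - y) : ℂ))

/-- The free field Green's function `g(x, y)` at wave number `k` and Mach vector `m`
in dimension `d ∈ {2, 3}` (no meaning is attached to the value `0` in other dimensions). -/
def green : (d : ℕ) → (k : ℝ) → (m x y : EuclideanSpace ℝ (Fin d)) → ℂ
  | 2 => greenTwo
  | 3 => greenThree
  | _ => fun _ _ _ _ => 0

/-! ### Forward operator, monopole operators, beamforming and the DAMAS equation -/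

/-- The complex Hilbert space `L²(U)`. -/
abbrev L2 {d : ℕ} (U : Set (EuclideanSpace ℝ (Fin d))) : Type :=
  Lp ℂ 2 (volume.restrict U)

/-- The complex Banach space `L^∞(U)`. -/
abbrev LInfty {d : ℕ} (U : Set (EuclideanSpace ℝ (Fin d))) : Type :=
  Lp ℂ ∞ (volume.restrict U)

/-- `K` is the integral operator `(K φ)(x₁) = ∫_M κ(x₁, x₂) φ(x₂) dx₂` on `L²(M)`. -/
def IsIntegralOperator {d : ℕ} (M : Set (EuclideanSpace ℝ (Fin d))) (K : L2 M →L[ℂ] L2 M)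
    (κ : EuclideanSpace ℝ (Fin d) → EuclideanSpace ℝ (Fin d) → ℂ) : Prop :=
  ∀ φ : L2 M, ∀ᵐ x₁ ∂(volume.restrict M),
    IntegrableOn (fun x₂ => κ x₁ x₂ * φ x₂) M ∧ K φ x₁ = ∫ x₂ in M, κ x₁ x₂ * φ x₂

/-- The covariance function `c_q(x₁, x₂) = ∫_Ω g(x₁, y) q(y) conj g(x₂, y) dy`. -/
def covFun {d : ℕ} (Ω : Set (EuclideanSpace ℝ (Fin d))) (k : ℝ) (m : EuclideanSpace ℝ (Fin d))
    (q : EuclideanSpace ℝ (Fin d) → ℂ) (x₁ x₂ : EuclideanSpace ℝ (Fin d)) : ℂ :=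
  ∫ y in Ω, green d k m x₁ y * q y * starRingEnd ℂ (green d k m x₂ y)

/-- `C` is the forward operator `L²(Ω) → HS(L²(M))`: the operator `C q` is the integral operator
whose kernel is the covariance function `c_q`. -/
def IsForwardOperator {d : ℕ} (Ω M : Set (EuclideanSpace ℝ (Fin d))) (k : ℝ)
    (m : EuclideanSpace ℝ (Fin d)) (C : L2 Ω →L[ℂ] HilbertSchmidt (L2 M)) : Prop :=
  ∀ q : L2 Ω,
    (∀ x₁ ∈ M, ∀ x₂ ∈ M, IntegrableOn
      (fun y => green d k m x₁ y * q y * starRingEnd ℂ (green d k m x₂ y)) Ω) ∧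
    IsIntegralOperator M (HilbertSchmidt.toCLM (C q)) (covFun Ω k m q)

/-- `P` is the family of monopole operators: for `y ∈ Ω`, the operator `P y` is the integral
operator with kernel `g(x₁, y) conj g(x₂, y)`. -/
def IsMonopoleFamily {d : ℕ} (Ω M : Set (EuclideanSpace ℝ (Fin d))) (k : ℝ)
    (m : EuclideanSpace ℝ (Fin d)) (P : EuclideanSpace ℝ (Fin d) → HilbertSchmidt (L2 M)) : Prop :=
  ∀ y ∈ Ω, IsIntegralOperator M (HilbertSchmidt.toCLM (P y))
    (fun x₁ x₂ => green d k m x₁ y * starRingEnd ℂ (green d k m x₂ y))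

/-- The beamforming value: for `P ≠ 0` it is the unique minimiser over `μ ∈ ℝ` of `‖K - μ P‖²`,
see `isMinOn_iff_eq_beamforming`. -/
def beamforming {V : Type*} [NormedAddCommGroup V] [InnerProductSpace ℂ V] (K P : V) : ℝ :=
  (⟪P, K⟫_ℂ).re / ‖P‖ ^ 2

theorem isMinOn_iff_eq_beamforming {V : Type*} [NormedAddCommGroup V] [InnerProductSpace ℂ V]
    (K P : V) (hP : P ≠ 0) (μ : ℝ) :
    IsMinOn (fun ν : ℝ => ‖K - (ν : ℂ) • P‖ ^ 2) univ μ ↔ μ = beamforming K P := by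
  have hP2 : 0 < ‖P‖ ^ 2 := by positivity
  have key : ∀ ν : ℝ, ‖K - (ν : ℂ) • P‖ ^ 2 =
      ‖K‖ ^ 2 - 2 * ν * (⟪P, K⟫_ℂ).re + ν ^ 2 * ‖P‖ ^ 2 := by
    intro ν
    rw [norm_sub_sq (𝕜 := ℂ), inner_smul_right, norm_smul, mul_pow, ← inner_conj_symm K P]
    have hre : (starRingEnd ℂ ⟪P, K⟫_ℂ).re = (⟪P, K⟫_ℂ).re := Complex.conj_re _
    simp only [RCLike.re_to_complex, Complex.re_ofReal_mul, hre, Complex.norm_real,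
      Real.norm_eq_abs, sq_abs]
    ring
  have hb : beamforming K P * ‖P‖ ^ 2 = (⟪P, K⟫_ℂ).re := div_mul_cancel₀ _ hP2.ne'
  rw [isMinOn_univ_iff]
  simp only [key, ← hb]
  constructor
  · intro h
    have h1 := h (beamforming K P)
    have h2 : (μ - beamforming K P) ^ 2 * ‖P‖ ^ 2 ≤ 0 := by nlinarith
    have h3 : (μ - beamforming K P) ^ 2 ≤ 0 := by
      by_contra hc
      push Not at hc
      linarith [mul_pos hc hP2]
    have h4 : μ - beamforming K P = 0 := pow_eq_zero_iff two_ne_zero |>.1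
      (le_antisymm h3 (sq_nonneg _))
    linarith
  · rintro rfl ν
    nlinarith [mul_nonneg (sq_nonneg (ν - beamforming K P)) hP2.le]

/-- The point-spread function normalised by its second argument:
`tr (P_{y'}* P_y) / ‖P_{y'}‖²`. -/
def psf {E V : Type*} [NormedAddCommGroup V] [InnerProductSpace ℂ V] (P : E → V) (y y' : E) : ℂ :=
  ⟪P y', P y⟫_ℂ / (‖P y'‖ ^ 2 : ℝ)

/-- The point-spread function normalised by its first argument: `tr (P_{y'}* P_y) / ‖P_y‖²`, the
beamforming image at `y` of the monopole `P_{y'}`. -/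
def psfFocus {E V : Type*} [NormedAddCommGroup V] [InnerProductSpace ℂ V] (P : E → V)
    (y y' : E) : ℂ :=
  ⟪P y', P y⟫_ℂ / (‖P y‖ ^ 2 : ℝ)

/-- `q ∈ L^∞(Ω)` solves the integral equation `I(y) = ∫_Ω ψ(y, y') q(y') dy'`, `y ∈ Ω`. -/
def IsDamasSolution {d : ℕ} (Ω : Set (EuclideanSpace ℝ (Fin d)))
    (I : EuclideanSpace ℝ (Fin d) → ℝ)
    (ψ : EuclideanSpace ℝ (Fin d) → EuclideanSpace ℝ (Fin d) → ℂ) (q : LInfty Ω) : Prop :=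
  ∀ᵐ y ∂(volume.restrict Ω), (I y : ℂ) = ∫ y' in Ω, ψ y y' * q y'

end

/-! Put κ = k/β². Off the diagonal g(x,y) = e^{-iκ(x-y)·m} Φ(|A(x-y)|²), where A is a symmetric
linear map with |Az| = |z|_m (`exists_machEquiv`) and Φ is holomorphic on the slit plane with t^p
Φ(t²) asymptotic to a e^{iκt} + b e^{-iκt}, (a,b) ≠ (0,0) (`IsRadialProfile`,
`exists_radialProfile_green`). For d = 3 this is explicit. For d = 2 it follows from Bessel's
equation by an energy estimate; the values of a and b never matter, so no radiation condition is
needed.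

The monopole P_y is the rank one operator φ ↦ ⟪u_y, φ⟫ u_y with u_y = g(·,y) in L²(M), and C q is
the Bochner integral of q(y) P_y in HS. The heart is the injectivity of C, obtained on all of L²(Ω).
If C q = 0, then ∫ q ⟪u_y, φ⟫ ⟪ψ, u_y⟫ dy = 0 for all φ, ψ. For fixed φ this says that the potential
with density q ⟪u_y, φ⟫ vanishes on M, hence off closure Ω by unique continuation
(`radialPotential_eq_zero`), hence has no far field (`exists_sign_farField`). Since φ is arbitrary,
conjugation and a second round give ∫ e^{iσκ(ω₁-ω₂)·Ay} q(y) dy = 0 for all unit vectors ω₁, ω₂, the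
convective phases e^{iκ y·m} cancelling (`ae_eq_zero_of_convected_superposition`). For d ≥ 2 the
differences ω₁ - ω₂ contain a ball, and the Fourier transform of a compactly supported density is
analytic along rays, so q = 0 (`ae_eq_zero_of_sphere_differences`).

For the DAMAS equation, ⟪P_y, P_{y'}⟫ = |⟪u_y, u_{y'}⟫|² is real and symmetric. The suitably
weighted difference w of two solutions satisfies ∫ w(y') ⟪P_y, P_{y'}⟫ dy' = 0 for almost every y;
hence ‖C w‖² = 0 and w = 0 (`damas_unique`). For real q the number ⟪P_y, C q⟫ is real, so the real
part in the beamforming value is harmless and q solves (b).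

The closures of M and Ω may touch, so g need not be bounded on M × Ω. Uniform bounds on u_y rest on
the square integrability of the singularity (`exists_sq_integral_convectedKernel_le`). -/

open Filter Topology

/-! ### Everywhere convergent power series and the Bessel functions of order zero -/

/-- The sum of the power series with coefficients `a`. -/
noncomputable def powerSum (a : ℕ → ℂ) (s : ℂ) : ℂ := ∑' n, a n * s ^ n

/-- The coefficients of an everywhere absolutely convergent power series. -/
def EntireCoeff (a : ℕ → ℂ) : Prop := ∀ r : ℝ, 0 ≤ r → Summable fun n => ‖a n‖ * r ^ n

/-- The left side is one of the terms of the binomial expansion of the right side. It trades a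
factor n in the coefficients for an enlargement of the radius from r to 1 + r. -/
theorem succ_mul_pow_le (r : ℝ) (hr : 0 ≤ r) (n : ℕ) :
    ((n : ℝ) + 1) * r ^ n ≤ (1 + r) ^ (n + 1) := by
  have h : (n + 1 : ℝ) * r ^ n + r ^ (n + 1) ≤ (1 + r) ^ (n + 1) := by
    induction n with
    | zero => simp
    | succ n ih =>
      have : (1 + r) ^ (n + 1 + 1) = (1 + r) ^ (n + 1) + r * (1 + r) ^ (n + 1) := by ring
      rw [this]
      have h1 := mul_le_mul_of_nonneg_left ih hr
      have h2 : (0 : ℝ) ≤ (n + 1) * r ^ n := by positivity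
      push_cast
      have e1 : r * ((n + 1 : ℝ) * r ^ n + r ^ (n + 1)) = (n + 1) * r ^ (n + 1) + r ^ (n + 1 + 1) := by
        ring
      have e2 : ((n : ℝ) + 1 + 1) * r ^ (n + 1) = (n + 1) * r ^ (n + 1) + r ^ (n + 1) := by ring
      linarith
  have : 0 ≤ r ^ (n + 1) := by positivity
  linarith

namespace EntireCoeff

variable {a : ℕ → ℂ}

theorem nat_mul (ha : EntireCoeff a) : EntireCoeff fun n => n * a n := by
  intro r hr
  refine (((ha (1 + r) (by linarith)).mul_left (1 + r))).of_nonneg_of_le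
    (fun n => by positivity) fun n => ?_
  have h := succ_mul_pow_le r hr n
  have h0 : 0 ≤ r ^ n := by positivity
  rw [norm_mul, Complex.norm_natCast]
  calc n * ‖a n‖ * r ^ n = ‖a n‖ * (n * r ^ n) := by ring
    _ ≤ ‖a n‖ * (1 + r) ^ (n + 1) := by gcongr; linarith
    _ = _ := by ring

theorem succ (ha : EntireCoeff a) : EntireCoeff fun n => a (n + 1) := by
  intro r hr
  have h := (summable_nat_add_iff 1).2 (ha (1 + r) (by linarith))
  refine h.of_nonneg_of_le (fun n => by positivity) fun n => ?_
  gcongr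
  calc r ^ n ≤ (1 + r) ^ n := by gcongr; linarith
    _ ≤ (1 + r) ^ (n + 1) := pow_le_pow_right₀ (by linarith) (by lia)

theorem summable (ha : EntireCoeff a) (s : ℂ) : Summable fun n => a n * s ^ n :=
  Summable.of_norm (by simpa using ha ‖s‖ (norm_nonneg _))

theorem hasDerivAt (ha : EntireCoeff a) (s : ℂ) :
    HasDerivAt (powerSum a) (powerSum (fun n => ((n + 1 : ℕ) : ℂ) * a (n + 1)) s) s := by
  set R : ℝ := ‖s‖ + 1 with hR
  -- A radius at least 1 lets R ^ n dominate ‖z‖ ^ (n - 1), including n = 0, where the subtraction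
  -- truncates.
  have hR1 : 1 ≤ R := by rw [hR]; linarith [norm_nonneg s]
  have hb : EntireCoeff fun n => ((n + 1 : ℕ) : ℂ) * a (n + 1) := ha.nat_mul.succ
  have hs : s ∈ Metric.ball (0 : ℂ) R := by simp [hR]
  have hu : Summable fun n : ℕ => ‖(n : ℂ) * a n‖ * R ^ n := ha.nat_mul R (by linarith)
  have key := hasDerivAt_tsum_of_isPreconnected (g := fun n z => a n * z ^ n)
    (g' := fun n z => a n * (n * z ^ (n - 1))) hu Metric.isOpen_ball
    (convex_ball (0 : ℂ) R).isPreconnected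
    (fun n z _ => (hasDerivAt_pow n z).const_mul (a n)) (fun n z hz => by
      have hz' : ‖z‖ ≤ R := by simpa using (mem_ball_zero_iff.1 hz).le
      rw [norm_mul, norm_mul, norm_mul, norm_pow]
      calc ‖a n‖ * (‖(n : ℂ)‖ * ‖z‖ ^ (n - 1)) ≤ ‖a n‖ * (‖(n : ℂ)‖ * R ^ n) := by
            gcongr
            exact (pow_le_pow_left₀ (norm_nonneg _) hz' _).trans
              (pow_le_pow_right₀ hR1 (Nat.sub_le _ _))
        _ = _ := by ring) hs (ha.summable s) hs
  refine key.congr_deriv ?_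
  have hsum : Summable fun n : ℕ => a n * (n * s ^ (n - 1)) := by
    rw [← summable_nat_add_iff 1]
    refine (hb.summable s).congr fun n => ?_
    push_cast
    ring
  rw [hsum.tsum_eq_zero_add]
  simp only [powerSum, Nat.cast_zero, zero_mul, mul_zero, zero_add]
  refine tsum_congr fun n => ?_
  simp only [Nat.add_sub_cancel]
  ring

/-- The Euler operator s d/ds is diagonal on coefficients, which turns Bessel's equation into a
recursion. -/
theorem mul_powerSum (ha : EntireCoeff a) (s : ℂ) :
    s * powerSum (fun n => ((n + 1 : ℕ) : ℂ) * a (n + 1)) s = powerSum (fun n => n * a n) s := by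
  simp only [powerSum]
  rw [(ha.nat_mul.summable s).tsum_eq_zero_add, ← tsum_mul_left]
  simp only [Nat.cast_zero, zero_mul, zero_add]
  exact tsum_congr fun n => by ring

theorem hasDerivAt_div (ha : EntireCoeff a) {s : ℂ} (hs : s ≠ 0) :
    HasDerivAt (powerSum a) (powerSum (fun n => n * a n) s / s) s := by
  rw [← ha.mul_powerSum, mul_div_cancel_left₀ _ hs]
  exact ha.hasDerivAt s

end EntireCoeff

/-! ### Bessel and Hankel functions in the variable s = t²/4 -/

/-- The coefficients of `J₀(t)` as a power series in `t² / 4`. -/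
noncomputable def besselJCoeff (n : ℕ) : ℂ := (-1) ^ n / (n.factorial : ℂ) ^ 2

/-- The coefficients of the regular part of `Y₀(t)` as a power series in `t² / 4`. -/
noncomputable def besselYCoeff (n : ℕ) : ℂ := (-1) ^ (n + 1) * (harmonic n : ℝ) / (n.factorial : ℂ) ^ 2

theorem entireCoeff_of_norm_le {a : ℕ → ℂ} (h : ∀ n, ‖a n‖ ≤ 1 / n.factorial) : EntireCoeff a := by
  intro r hr
  refine (Real.summable_pow_div_factorial r).of_nonneg_of_le (fun n => by positivity) fun n => ?_
  calc ‖a n‖ * r ^ n ≤ 1 / n.factorial * r ^ n := by gcongr; exact h n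
    _ = _ := by ring

theorem harmonic_le_factorial (n : ℕ) : (harmonic n : ℝ) ≤ n.factorial := by
  have h1 : ∀ n : ℕ, (harmonic n : ℝ) ≤ n := by
    intro n
    induction n with
    | zero => simp
    | succ n ih =>
      rw [harmonic_succ]
      push_cast
      have : ((n : ℝ) + 1)⁻¹ ≤ 1 := inv_le_one_of_one_le₀ (by linarith [(n.cast_nonneg : (0:ℝ) ≤ n)])
      linarith
  exact (h1 n).trans (by exact_mod_cast Nat.self_le_factorial n)

theorem harmonic_cast_nonneg (n : ℕ) : (0 : ℝ) ≤ harmonic n := by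
  have : (0 : ℚ) ≤ harmonic n := Finset.sum_nonneg fun i _ => by positivity
  exact_mod_cast this

theorem entireCoeff_besselJCoeff : EntireCoeff besselJCoeff := by
  refine entireCoeff_of_norm_le fun n => ?_
  have h1 : (1 : ℝ) ≤ n.factorial := by exact_mod_cast n.factorial_pos
  simp only [besselJCoeff, norm_div, norm_pow, norm_neg, norm_one, one_pow, Complex.norm_natCast]
  gcongr
  nlinarith

theorem entireCoeff_besselYCoeff : EntireCoeff besselYCoeff := by
  refine entireCoeff_of_norm_le fun n => ?_
  have h1 : (0 : ℝ) < n.factorial := by exact_mod_cast n.factorial_pos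
  have h2 := harmonic_le_factorial n
  have h3 := harmonic_cast_nonneg n
  simp only [besselYCoeff, norm_div, norm_mul, norm_pow, norm_neg, norm_one, one_pow, one_mul,
    Complex.norm_natCast, Complex.norm_real, Real.norm_eq_abs, abs_of_nonneg h3]
  rw [div_le_div_iff₀ (by positivity) h1]
  nlinarith

/-- `H₀⁽¹⁾(2 √s)` as a holomorphic function of `s`. -/
noncomputable def hankelSq (s : ℂ) : ℂ :=
  (1 + 2 * Complex.I * Real.eulerMascheroniConstant / Real.pi) * powerSum besselJCoeff s +
    Complex.I / Real.pi * (Complex.log s * powerSum besselJCoeff s + 2 * powerSum besselYCoeff s)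

/-- `s h'(s)` for `h = hankelSq`. -/
noncomputable def hankelSqDeriv (s : ℂ) : ℂ :=
  (1 + 2 * Complex.I * Real.eulerMascheroniConstant / Real.pi) *
      powerSum (fun n => n * besselJCoeff n) s +
    Complex.I / Real.pi * (powerSum besselJCoeff s +
      Complex.log s * powerSum (fun n => n * besselJCoeff n) s +
      2 * powerSum (fun n => n * besselYCoeff n) s)

theorem hasDerivAt_hankelSq {s : ℂ} (hs : s ∈ Complex.slitPlane) :
    HasDerivAt hankelSq (hankelSqDeriv s / s) s := by
  have h0 := Complex.slitPlane_ne_zero hs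
  have hJ := entireCoeff_besselJCoeff.hasDerivAt_div h0
  have hY := entireCoeff_besselYCoeff.hasDerivAt_div h0
  have := (hJ.const_mul (1 + 2 * Complex.I * Real.eulerMascheroniConstant / Real.pi)).add
    ((((Complex.hasDerivAt_log hs).mul hJ).add (hY.const_mul 2)).const_mul
      (Complex.I / Real.pi))
  refine this.congr_deriv ?_
  rw [hankelSqDeriv]
  field_simp

/-- Recursion equivalent to (s f')' = -f for a power series f. -/
theorem besselJCoeff_succ (n : ℕ) :
    ((n + 1 : ℕ) : ℂ) * (((n + 1 : ℕ) : ℂ) * besselJCoeff (n + 1)) = -besselJCoeff n := by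
  have h1 : (n.factorial : ℂ) ≠ 0 := by exact_mod_cast n.factorial_ne_zero
  have h2 : ((n : ℂ) + 1) ≠ 0 := by exact_mod_cast n.succ_ne_zero
  simp only [besselJCoeff, Nat.factorial_succ]
  push_cast
  field_simp
  ring

/-- Frobenius recursion for the second solution. The extra term cancels the 2 J' produced by
differentiating log s · J. -/
theorem besselYCoeff_succ (n : ℕ) :
    ((n + 1 : ℕ) : ℂ) * (((n + 1 : ℕ) : ℂ) * besselYCoeff (n + 1)) =
      -besselYCoeff n - ((n + 1 : ℕ) : ℂ) * besselJCoeff (n + 1) := by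
  have h1 : (n.factorial : ℂ) ≠ 0 := by exact_mod_cast n.factorial_ne_zero
  have h2 : ((n : ℂ) + 1) ≠ 0 := by exact_mod_cast n.succ_ne_zero
  simp only [besselJCoeff, besselYCoeff, Nat.factorial_succ, harmonic_succ]
  push_cast
  field_simp
  ring

/-- In the variable s = t²/4 Bessel's equation of order zero reads (s h')' = -h. -/
theorem hasDerivAt_hankelSqDeriv {s : ℂ} (hs : s ∈ Complex.slitPlane) :
    HasDerivAt hankelSqDeriv (-hankelSq s) s := by
  have h0 := Complex.slitPlane_ne_zero hs
  have hJ := entireCoeff_besselJCoeff.hasDerivAt s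
  have hJ' := entireCoeff_besselJCoeff.nat_mul.hasDerivAt s
  have hY' := entireCoeff_besselYCoeff.nat_mul.hasDerivAt s
  have hm := entireCoeff_besselJCoeff.mul_powerSum s
  have eJ : powerSum (fun n => ((n + 1 : ℕ) : ℂ) * (((n + 1 : ℕ) : ℂ) * besselJCoeff (n + 1))) s =
      -powerSum besselJCoeff s := by
    simp only [powerSum, besselJCoeff_succ, neg_mul, tsum_neg]
  have eY : powerSum (fun n => ((n + 1 : ℕ) : ℂ) * (((n + 1 : ℕ) : ℂ) * besselYCoeff (n + 1))) s =
      -powerSum besselYCoeff s - powerSum (fun n => ((n + 1 : ℕ) : ℂ) * besselJCoeff (n + 1)) s := by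
    simp only [powerSum, besselYCoeff_succ, sub_mul, neg_mul]
    rw [Summable.tsum_sub, tsum_neg]
    · exact (entireCoeff_besselYCoeff.summable s).neg
    · exact entireCoeff_besselJCoeff.nat_mul.succ.summable s
  rw [eJ] at hJ'
  rw [eY] at hY'
  have := (hJ'.const_mul (1 + 2 * Complex.I * Real.eulerMascheroniConstant / Real.pi)).add
    (((hJ.add ((Complex.hasDerivAt_log hs).mul hJ')).add (hY'.const_mul 2)).const_mul
      (Complex.I / Real.pi))
  refine this.congr_deriv ?_
  rw [← hm, hankelSq]
  have hpi : (Real.pi : ℂ) ≠ 0 := by exact_mod_cast Real.pi_ne_zero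
  field_simp
  ring

/-- The series are in t²/4 and 2 log (t/2) = log (t²/4), so the Hankel function extends
holomorphically in s. -/
theorem hankelZero_eq {t : ℝ} (ht : 0 < t) : hankelZero t = hankelSq ((t ^ 2 / 4 : ℝ) : ℂ) := by
  have hJ : powerSum besselJCoeff ((t ^ 2 / 4 : ℝ) : ℂ) = (besselJZero t : ℂ) := by
    rw [powerSum, besselJZero, Complex.ofReal_tsum]
    refine tsum_congr fun n => ?_
    simp only [besselJCoeff]
    push_cast
    ring
  have hY : powerSum besselYCoeff ((t ^ 2 / 4 : ℝ) : ℂ) =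
      ((∑' j : ℕ, (-1) ^ (j + 1) * (harmonic j : ℝ) * (t ^ 2 / 4) ^ j / (j.factorial : ℝ) ^ 2 :
        ℝ) : ℂ) := by
    rw [powerSum, Complex.ofReal_tsum]
    refine tsum_congr fun n => ?_
    simp only [besselYCoeff]
    push_cast
    ring
  have hlog : Complex.log ((t ^ 2 / 4 : ℝ) : ℂ) = ((2 * Real.log (t / 2) : ℝ) : ℂ) := by
    rw [← Complex.ofReal_log (by positivity)]
    congr 1
    rw [show t ^ 2 / 4 = (t / 2) ^ 2 by ring, Real.log_pow]
    norm_num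
  rw [hankelZero, besselYZero, hankelSq, hJ, hY, hlog]
  push_cast
  ring

/-- The logarithm sits in the imaginary part only and J₀(0) = 1. This certifies below that the
Hankel function is not identically zero. -/
theorem tendsto_re_hankelZero : Tendsto (fun t : ℝ => (hankelZero t).re) (𝓝 0) (𝓝 1) := by
  have hJ : ∀ t : ℝ, (hankelZero t).re = (powerSum besselJCoeff ((t ^ 2 / 4 : ℝ) : ℂ)).re := by
    intro t
    have : powerSum besselJCoeff ((t ^ 2 / 4 : ℝ) : ℂ) = (besselJZero t : ℂ) := by
      rw [powerSum, besselJZero, Complex.ofReal_tsum]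
      refine tsum_congr fun n => ?_
      simp only [besselJCoeff]
      push_cast
      ring
    rw [this, hankelZero]
    simp
  have hc : Continuous (powerSum besselJCoeff) :=
    continuous_iff_continuousAt.2 fun s => (entireCoeff_besselJCoeff.hasDerivAt s).continuousAt
  have h0 : powerSum besselJCoeff 0 = 1 := by
    rw [powerSum, tsum_eq_single 0 (fun n hn => by simp [hn])]
    simp [besselJCoeff]
  have : Continuous fun t : ℝ => (powerSum besselJCoeff ((t ^ 2 / 4 : ℝ) : ℂ)).re := by fun_prop
  simp only [hJ]
  convert this.tendsto 0 using 2
  simp [h0]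

/-! ### Asymptotics of solutions of `u'' + (1 + 1 / (4 t²)) u = 0` -/

section Asymptotics

variable {u v : ℝ → ℂ}

/-- The energy is conserved for u'' = -u, so only the perturbation 1/(4t²) contributes. -/
theorem hasDerivAt_energy (hu : ∀ t > 0, HasDerivAt u (v t) t)
    (hv : ∀ t > 0, HasDerivAt v (-((1 + 1 / (4 * t ^ 2) : ℝ) : ℂ) * u t) t) {t : ℝ} (ht : 0 < t) :
    HasDerivAt (fun t => ‖u t‖ ^ 2 + ‖v t‖ ^ 2) (-(1 / (2 * t ^ 2)) * ⟪u t, v t⟫_ℝ) t := by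
  refine ((hu t ht).norm_sq.add (hv t ht).norm_sq).congr_deriv ?_
  rw [← Complex.ofReal_neg, ← Complex.real_smul, inner_smul_right, real_inner_comm (u t)]
  field_simp
  ring

theorem abs_energy_deriv_le (a b : ℂ) {t : ℝ} (ht : 0 < t) :
    |-(1 / (2 * t ^ 2)) * ⟪a, b⟫_ℝ| ≤ (‖a‖ ^ 2 + ‖b‖ ^ 2) * (1 / (4 * t ^ 2)) := by
  have h := abs_real_inner_le_norm a b
  have h2 : 2 * |⟪a, b⟫_ℝ| ≤ ‖a‖ ^ 2 + ‖b‖ ^ 2 := by nlinarith [sq_nonneg (‖a‖ - ‖b‖)]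
  rw [abs_mul, abs_neg, abs_of_nonneg (by positivity)]
  calc 1 / (2 * t ^ 2) * |⟪a, b⟫_ℝ| = (2 * |⟪a, b⟫_ℝ|) * (1 / (4 * t ^ 2)) := by
        field_simp; ring
    _ ≤ _ := by gcongr

/-- Grönwall: the logarithmic derivative of the energy is at most 1/(4t²) in absolute value, and
that is integrable at infinity. Multiplying by exp(±1/(4t)) gives monotone quantities. The upper
bound yields convergence of the amplitudes, the lower one their nontriviality. -/
theorem energy_bounds (hu : ∀ t > 0, HasDerivAt u (v t) t)
    (hv : ∀ t > 0, HasDerivAt v (-((1 + 1 / (4 * t ^ 2) : ℝ) : ℂ) * u t) t)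
    {t₀ : ℝ} (ht₀ : 0 < t₀) :
    (∀ t ≥ t₀, ‖u t‖ ^ 2 + ‖v t‖ ^ 2 ≤ (‖u t₀‖ ^ 2 + ‖v t₀‖ ^ 2) * Real.exp (1 / (4 * t₀))) ∧
    ∀ t ≥ t₀, (‖u t₀‖ ^ 2 + ‖v t₀‖ ^ 2) * Real.exp (-(1 / (4 * t₀))) ≤ ‖u t‖ ^ 2 + ‖v t‖ ^ 2 := by
  set e : ℝ → ℝ := fun t => ‖u t‖ ^ 2 + ‖v t‖ ^ 2 with he
  have he0 : ∀ t, 0 ≤ e t := fun t => by positivity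
  have hinv : ∀ t > 0, HasDerivAt (fun t : ℝ => 1 / (4 * t)) (-(1 / (4 * t ^ 2))) t := by
    intro t ht
    have := ((hasDerivAt_id t).const_mul 4).inv (by simp; exact ht.ne')
    simp only [one_div]
    refine this.congr_deriv ?_
    simp only [id]
    field_simp
  have hd1 : ∀ t > 0, HasDerivAt (fun t => e t * Real.exp (1 / (4 * t)))
      ((-(1 / (2 * t ^ 2)) * ⟪u t, v t⟫_ℝ) * Real.exp (1 / (4 * t)) +
        e t * (Real.exp (1 / (4 * t)) * -(1 / (4 * t ^ 2)))) t := fun t ht =>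
    (hasDerivAt_energy hu hv ht).mul (hinv t ht).exp
  have hd2 : ∀ t > 0, HasDerivAt (fun t => e t * Real.exp (-(1 / (4 * t))))
      ((-(1 / (2 * t ^ 2)) * ⟪u t, v t⟫_ℝ) * Real.exp (-(1 / (4 * t))) +
        e t * (Real.exp (-(1 / (4 * t))) * -(-(1 / (4 * t ^ 2))))) t := fun t ht =>
    (hasDerivAt_energy hu hv ht).mul (hinv t ht).neg.exp
  have hpos : ∀ t ∈ Ici t₀, 0 < t := fun t ht => ht₀.trans_le ht
  have anti : AntitoneOn (fun t => e t * Real.exp (1 / (4 * t))) (Ici t₀) := by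
    refine antitoneOn_of_deriv_nonpos (convex_Ici _)
      (fun t ht => (hd1 t (hpos t ht)).continuousAt.continuousWithinAt)
      (fun t ht => (hd1 t (hpos t (interior_subset ht))).differentiableAt.differentiableWithinAt)
      fun t ht => ?_
    have ht' := hpos t (interior_subset ht)
    rw [(hd1 t ht').deriv]
    have h1 := (abs_le.1 (abs_energy_deriv_le (u t) (v t) ht')).2
    nlinarith [Real.exp_pos (1 / (4 * t))]
  have mono : MonotoneOn (fun t => e t * Real.exp (-(1 / (4 * t)))) (Ici t₀) := by
    refine monotoneOn_of_deriv_nonneg (convex_Ici _)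
      (fun t ht => (hd2 t (hpos t ht)).continuousAt.continuousWithinAt)
      (fun t ht => (hd2 t (hpos t (interior_subset ht))).differentiableAt.differentiableWithinAt)
      fun t ht => ?_
    have ht' := hpos t (interior_subset ht)
    rw [(hd2 t ht').deriv]
    have h1 := (abs_le.1 (abs_energy_deriv_le (u t) (v t) ht')).1
    nlinarith [Real.exp_pos (-(1 / (4 * t)))]
  refine ⟨fun t ht => ?_, fun t ht => ?_⟩
  · have h1 := anti self_mem_Ici ht ht
    have h2 : (1 : ℝ) ≤ Real.exp (1 / (4 * t)) := Real.one_le_exp (by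
      have := hpos t ht; positivity)
    exact (le_mul_of_one_le_right (he0 t) h2).trans h1
  · have h1 := mono self_mem_Ici ht ht
    have h2 : Real.exp (-(1 / (4 * t))) ≤ 1 := Real.exp_le_one_iff.2 (by
      have := hpos t ht
      rw [neg_nonpos]
      positivity)
    exact h1.trans (mul_le_of_le_one_right (he0 t) h2)

/-- Variation of constants: the amplitude has derivative e^{-σt} σ u/(8t²), integrable on (1, ∞)
because u is bounded. -/
theorem exists_tendsto_amplitude (hu : ∀ t > 0, HasDerivAt u (v t) t)
    (hv : ∀ t > 0, HasDerivAt v (-((1 + 1 / (4 * t ^ 2) : ℝ) : ℂ) * u t) t)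
    (σ : ℂ) (hσ : σ * σ = -1) (hσ' : ∀ t : ℝ, ‖Complex.exp (-σ * t)‖ = 1) :
    ∃ a : ℂ, Tendsto (fun t : ℝ => Complex.exp (-σ * t) * (u t - σ * v t) / 2) atTop (𝓝 a) := by
  have hb := (energy_bounds hu hv one_pos).1
  set C := (‖u 1‖ ^ 2 + ‖v 1‖ ^ 2) * Real.exp (1 / (4 * 1))
  have hn : ‖σ‖ = 1 := by
    have : ‖σ‖ * ‖σ‖ = 1 := by rw [← norm_mul, hσ]; simp
    nlinarith [norm_nonneg σ]
  have hd : ∀ t : ℝ, 0 < t → HasDerivAt (fun t : ℝ => Complex.exp (-σ * t) * (u t - σ * v t) / 2)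
      (Complex.exp (-σ * t) * (σ * (1 / (8 * t ^ 2) : ℝ) * u t)) t := by
    intro t ht
    have h1 : HasDerivAt (fun t : ℝ => Complex.exp (-σ * t)) (Complex.exp (-σ * t) * (-σ)) t := by
      have := ((hasDerivAt_id (t : ℂ)).const_mul (-σ)).cexp.comp_ofReal
      simpa using this
    refine ((h1.mul ((hu t ht).sub ((hv t ht).const_mul σ))).div_const 2).congr_deriv ?_
    have ht' : (t : ℂ) ≠ 0 := by exact_mod_cast ht.ne'
    have : Complex.exp (-σ * t) * (-σ) * (u t - σ * v t) =
        Complex.exp (-σ * t) * (-σ * u t + (σ * σ) * v t) := by ring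
    simp only [Pi.sub_apply]
    rw [this, hσ]
    push_cast
    field_simp
    ring
  refine ⟨_, tendsto_limUnder_of_hasDerivAt_of_integrableOn_Ioi (a := 1)
    (fun t ht => hd t (one_pos.trans ht)) ?_⟩
  have hint : IntegrableOn (fun t : ℝ => (C + 1) * t ^ (-2 : ℝ)) (Ioi 1) :=
    (integrableOn_Ioi_rpow_of_lt (by norm_num) one_pos).const_mul _
  refine hint.mono' ?_ ?_
  · refine ContinuousOn.aestronglyMeasurable (fun t ht => ?_) measurableSet_Ioi
    have ht' : (0 : ℝ) < t := one_pos.trans ht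
    have h1 := (hu t ht').continuousAt
    have h2 : ContinuousAt (fun t : ℝ => (1 / (8 * t ^ 2) : ℝ)) t := by
      fun_prop (disch := positivity)
    refine ContinuousAt.continuousWithinAt ?_
    fun_prop
  · refine (ae_restrict_iff' measurableSet_Ioi).2 (ae_of_all _ fun t ht => ?_)
    have ht1 : (1 : ℝ) < t := ht
    have ht' : (0 : ℝ) < t := one_pos.trans ht
    have h1 := hb t ht1.le
    have h2 : ‖u t‖ ≤ C + 1 := by nlinarith [sq_nonneg (‖u t‖ - 1), sq_nonneg ‖v t‖, norm_nonneg (u t)]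
    rw [norm_mul, hσ', norm_mul, norm_mul, hn, Complex.norm_real, Real.norm_eq_abs,
      abs_of_nonneg (by positivity), one_mul, one_mul, Real.rpow_neg ht'.le, Real.rpow_ofNat]
    have h4 : 1 / (8 * t ^ 2) ≤ (t ^ 2)⁻¹ := by
      rw [one_div]
      exact inv_anti₀ (by positivity) (by nlinarith)
    calc 1 / (8 * t ^ 2) * ‖u t‖ ≤ (t ^ 2)⁻¹ * (C + 1) := by gcongr
      _ = _ := mul_comm _ _

/-- Both u and v are combinations of e^{it} α and e^{-it} β for the amplitudes α, β of σ = ±i. If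
both limits vanished, the energy would tend to 0, against its lower bound. -/
theorem exists_asymptotics (hu : ∀ t > 0, HasDerivAt u (v t) t)
    (hv : ∀ t > 0, HasDerivAt v (-((1 + 1 / (4 * t ^ 2) : ℝ) : ℂ) * u t) t)
    (hne : ∃ t > 0, u t ≠ 0) :
    ∃ a b : ℂ, (a ≠ 0 ∨ b ≠ 0) ∧ Tendsto (fun t : ℝ => u t -
      (a * Complex.exp (Complex.I * t) + b * Complex.exp (-(Complex.I * t)))) atTop (𝓝 0) := by
  have hn1 : ∀ t : ℝ, ‖Complex.exp (-Complex.I * t)‖ = 1 := fun t => by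
    rw [Complex.norm_exp]; simp
  have hn2 : ∀ t : ℝ, ‖Complex.exp (-(-Complex.I) * t)‖ = 1 := fun t => by
    rw [Complex.norm_exp]; simp
  obtain ⟨a, ha⟩ := exists_tendsto_amplitude hu hv Complex.I Complex.I_mul_I hn1
  obtain ⟨b, hb⟩ := exists_tendsto_amplitude hu hv (-Complex.I) (by simp) hn2
  set α := fun t : ℝ => Complex.exp (-Complex.I * t) * (u t - Complex.I * v t) / 2
  set β := fun t : ℝ => Complex.exp (-(-Complex.I) * t) * (u t - (-Complex.I) * v t) / 2
  have hα : ∀ t : ℝ, Complex.exp (Complex.I * t) * α t = (u t - Complex.I * v t) / 2 := fun t => by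
    simp only [α]
    rw [mul_div_assoc, ← mul_assoc, ← Complex.exp_add]
    simp
  have hβ : ∀ t : ℝ, Complex.exp (-(Complex.I * t)) * β t = (u t + Complex.I * v t) / 2 := fun t => by
    simp only [β]
    rw [mul_div_assoc, ← mul_assoc, ← Complex.exp_add]
    simp
  have hm1 : ∀ t : ℝ, ‖Complex.exp (Complex.I * t)‖ = 1 := fun t => by
    rw [Complex.norm_exp]; simp
  have hm2 : ∀ t : ℝ, ‖Complex.exp (-(Complex.I * t))‖ = 1 := fun t => by
    rw [Complex.norm_exp]; simp
  refine ⟨a, b, ?_, ?_⟩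
  · by_contra hc
    push Not at hc
    obtain ⟨rfl, rfl⟩ := hc
    obtain ⟨t₀, ht₀, h0⟩ := hne
    have hlow := (energy_bounds hu hv ht₀).2
    have hpos : 0 < (‖u t₀‖ ^ 2 + ‖v t₀‖ ^ 2) * Real.exp (-(1 / (4 * t₀))) := by
      have : 0 < ‖u t₀‖ := norm_pos_iff.2 h0
      positivity
    have hsum : Tendsto (fun t => 2 * (‖α t‖ + ‖β t‖) ^ 2) atTop (𝓝 0) := by
      have := ((ha.norm.add hb.norm).pow 2).const_mul 2
      simpa using this
    refine absurd (ge_of_tendsto hsum ?_) (not_le.2 hpos)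
    filter_upwards [eventually_ge_atTop t₀] with t ht
    refine (hlow t ht).trans ?_
    have h1 : ‖u t‖ ≤ ‖α t‖ + ‖β t‖ := by
      calc ‖u t‖ = ‖Complex.exp (Complex.I * t) * α t + Complex.exp (-(Complex.I * t)) * β t‖ := by
            rw [hα, hβ]; congr 1; ring
        _ ≤ _ := (norm_add_le _ _).trans (by rw [norm_mul, norm_mul, hm1, hm2, one_mul, one_mul])
    have h2 : ‖v t‖ ≤ ‖α t‖ + ‖β t‖ := by
      calc ‖v t‖ = ‖Complex.I * v t‖ := by simp
        _ = ‖Complex.exp (-(Complex.I * t)) * β t - Complex.exp (Complex.I * t) * α t‖ := by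
            rw [hα, hβ]; congr 1; ring
        _ ≤ ‖Complex.exp (-(Complex.I * t)) * β t‖ + ‖Complex.exp (Complex.I * t) * α t‖ :=
            norm_sub_le _ _
        _ = _ := by rw [norm_mul, norm_mul, hm1, hm2, one_mul, one_mul, add_comm]
    have h3 := pow_le_pow_left₀ (norm_nonneg _) h1 2
    have h4 := pow_le_pow_left₀ (norm_nonneg _) h2 2
    linarith
  · have h1 : Tendsto (fun t => ‖α t - a‖ + ‖β t - b‖) atTop (𝓝 0) := by
      have := (ha.sub_const a).norm.add (hb.sub_const b).norm
      simpa using this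
    refine squeeze_zero_norm (fun t => ?_) h1
    calc _ = ‖Complex.exp (Complex.I * t) * (α t - a) +
          Complex.exp (-(Complex.I * t)) * (β t - b)‖ := by
          rw [mul_sub, mul_sub, hα, hβ]; congr 1; ring
      _ ≤ _ := (norm_add_le _ _).trans (by rw [norm_mul, norm_mul, hm1, hm2, one_mul, one_mul])

end Asymptotics

/-! ### Large argument asymptotics of the Hankel function -/

/-- Bessel's equation as a first order system for H and W = t H', using t d/dt = 2 s d/ds. -/
theorem hankel_system {t : ℝ} (ht : 0 < t) :
    HasDerivAt (fun t : ℝ => hankelSq ((t ^ 2 / 4 : ℝ) : ℂ))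
      (2 * hankelSqDeriv ((t ^ 2 / 4 : ℝ) : ℂ) / t) t ∧
    HasDerivAt (fun t : ℝ => 2 * hankelSqDeriv ((t ^ 2 / 4 : ℝ) : ℂ))
      (-(t * hankelSq ((t ^ 2 / 4 : ℝ) : ℂ))) t := by
  have hmem : ((t ^ 2 / 4 : ℝ) : ℂ) ∈ Complex.slitPlane :=
    Complex.ofReal_mem_slitPlane.2 (by positivity)
  have hc : HasDerivAt (fun t : ℝ => ((t ^ 2 / 4 : ℝ) : ℂ)) ((t / 2 : ℝ) : ℂ) t := by
    have : HasDerivAt (fun t : ℝ => t ^ 2 / 4) (t / 2) t :=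
      ((hasDerivAt_pow 2 t).div_const 4).congr_deriv (by norm_num; ring)
    exact this.ofReal_comp
  have ht' : (t : ℂ) ≠ 0 := by exact_mod_cast ht.ne'
  refine ⟨(HasDerivAt.comp t (h₂ := hankelSq) (hasDerivAt_hankelSq hmem) hc).congr_deriv ?_,
    ((HasDerivAt.comp t (h₂ := hankelSqDeriv) (hasDerivAt_hankelSqDeriv hmem) hc).const_mul 2).congr_deriv ?_⟩
  · push_cast
    field_simp
    ring
  · push_cast
    ring

/-- `√t H₀⁽¹⁾(t)` is asymptotically a nontrivial combination of `e^{it}` and `e^{-it}`. -/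
theorem hankelZero_asymptotics :
    ∃ a b : ℂ, (a ≠ 0 ∨ b ≠ 0) ∧ Tendsto (fun t : ℝ => (Real.sqrt t : ℂ) * hankelZero t -
      (a * Complex.exp (Complex.I * t) + b * Complex.exp (-(Complex.I * t)))) atTop (𝓝 0) := by
  set H : ℝ → ℂ := fun t => hankelSq ((t ^ 2 / 4 : ℝ) : ℂ) with hH
  set W : ℝ → ℂ := fun t => 2 * hankelSqDeriv ((t ^ 2 / 4 : ℝ) : ℂ) with hW
  have hsq : ∀ t > 0, HasDerivAt (fun t : ℝ => (Real.sqrt t : ℂ))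
      ((1 / (2 * Real.sqrt t) : ℝ) : ℂ) t := fun t ht =>
    (Real.hasDerivAt_sqrt ht.ne').ofReal_comp
  -- The Liouville substitution u = √t H removes the first order term and leaves u'' + (1 + 1/(4t²))
  -- u = 0.
  have hu : ∀ t > 0, HasDerivAt (fun t : ℝ => (Real.sqrt t : ℂ) * H t)
      ((H t / 2 + W t) / Real.sqrt t) t := by
    intro t ht
    have hs : (Real.sqrt t : ℂ) ≠ 0 := by exact_mod_cast (Real.sqrt_pos.2 ht).ne'
    have hst : (t : ℂ) = Real.sqrt t * Real.sqrt t := by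
      exact_mod_cast (Real.mul_self_sqrt ht.le).symm
    refine ((hsq t ht).mul (hankel_system ht).1).congr_deriv ?_
    simp only [hH, hW]
    rw [hst]
    push_cast
    field_simp
  have hv : ∀ t > 0, HasDerivAt (fun t : ℝ => (H t / 2 + W t) / Real.sqrt t)
      (-((1 + 1 / (4 * t ^ 2) : ℝ) : ℂ) * (Real.sqrt t * H t)) t := by
    intro t ht
    have hs : (Real.sqrt t : ℂ) ≠ 0 := by exact_mod_cast (Real.sqrt_pos.2 ht).ne'
    have hst : (t : ℂ) = Real.sqrt t * Real.sqrt t := by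
      exact_mod_cast (Real.mul_self_sqrt ht.le).symm
    refine ((((hankel_system ht).1.div_const 2).add (hankel_system ht).2).div (hsq t ht)
      hs).congr_deriv ?_
    simp only [hH, Pi.add_apply]
    generalize hankelSq ((t ^ 2 / 4 : ℝ) : ℂ) = h
    generalize hankelSqDeriv ((t ^ 2 / 4 : ℝ) : ℂ) = w
    push_cast
    rw [hst]
    field_simp
    ring
  have hne : ∃ t > 0, (Real.sqrt t : ℂ) * H t ≠ 0 := by
    have h1 : ∀ᶠ t : ℝ in 𝓝[>] 0, (hankelZero t).re ≠ 0 :=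
      (tendsto_re_hankelZero.mono_left nhdsWithin_le_nhds).eventually_ne one_ne_zero
    obtain ⟨t, ht, h0⟩ := (h1.and self_mem_nhdsWithin).exists
    refine ⟨t, h0, mul_ne_zero (by exact_mod_cast (Real.sqrt_pos.2 h0).ne') fun hc => ht ?_⟩
    rw [hankelZero_eq h0]
    exact (congrArg Complex.re hc).trans Complex.zero_re
  obtain ⟨a, b, hab, h⟩ := exists_asymptotics hu hv hne
  refine ⟨a, b, hab, h.congr' ?_⟩
  filter_upwards [eventually_gt_atTop 0] with t ht
  rw [hankelZero_eq ht]

/-! ### The radial profile of the Green's function -/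

/-- The properties of the profile `Φ` of a radial kernel `Φ(|z|²)` in dimension `d` at wave
number `κ`: it is holomorphic off the negative axis, radiates, and is locally square integrable. -/
structure IsRadialProfile (d : ℕ) (κ : ℝ) (Φ : ℂ → ℂ) : Prop where
  measurable : Measurable Φ
  differentiableOn : DifferentiableOn ℂ Φ Complex.slitPlane
  asymptotics : ∃ (p : ℝ) (a b : ℂ), 0 ≤ p ∧ (a ≠ 0 ∨ b ≠ 0) ∧
    Tendsto (fun t : ℝ => ((t ^ p : ℝ) : ℂ) * Φ ((t ^ 2 : ℝ) : ℂ) -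
      (a * Complex.exp (Complex.I * (κ * t : ℝ)) + b * Complex.exp (-(Complex.I * (κ * t : ℝ)))))
      atTop (𝓝 0)
  sq_bound : ∀ R : ℝ, ∃ C : ℝ, ∀ t : ℝ, 0 < t → t ≤ R →
    ‖Φ ((t ^ 2 : ℝ) : ℂ)‖ ^ 2 * t ^ (d - 1) ≤ C

/-- exp(log s / 2) is the holomorphic square root, equal to t at s = t². Here p = 1, a = 1/(4π) and
b = 0, with exact equality in the asymptotics. -/
theorem isRadialProfile_three {κ : ℝ} :
    IsRadialProfile 3 κ fun s => Complex.exp (Complex.I * κ * Complex.exp (Complex.log s / 2)) /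
      (4 * Real.pi * Complex.exp (Complex.log s / 2)) := by
  have hsqrt : ∀ t : ℝ, 0 < t → Complex.exp (Complex.log ((t ^ 2 : ℝ) : ℂ) / 2) = t := by
    intro t ht
    rw [← Complex.ofReal_log (by positivity), Real.log_pow]
    push_cast
    rw [mul_div_cancel_left₀ _ two_ne_zero, ← Complex.ofReal_exp, Real.exp_log ht]
  have hpi : (Real.pi : ℂ) ≠ 0 := by exact_mod_cast Real.pi_ne_zero
  refine ⟨by fun_prop, ?_, ⟨1, 1 / (4 * Real.pi), 0, zero_le_one, Or.inl (by simp [hpi]), ?_⟩,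
    fun R => ⟨1 / (4 * Real.pi) ^ 2, ?_⟩⟩
  · intro s hs
    have h1 : DifferentiableAt ℂ Complex.log s := (Complex.hasDerivAt_log hs).differentiableAt
    refine DifferentiableAt.differentiableWithinAt ?_
    refine DifferentiableAt.div (by fun_prop) (by fun_prop) ?_
    exact mul_ne_zero (mul_ne_zero (by norm_num) hpi) (Complex.exp_ne_zero _)
  · refine tendsto_const_nhds.congr' ?_
    filter_upwards [eventually_gt_atTop 0] with t ht
    have ht' : (t : ℂ) ≠ 0 := by exact_mod_cast ht.ne'
    rw [hsqrt t ht, Real.rpow_one]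
    push_cast
    field_simp
    ring_nf
  · intro t ht _
    rw [hsqrt t ht, norm_div, norm_mul, norm_mul, Complex.norm_exp]
    simp only [Complex.norm_real, Real.norm_eq_abs, abs_of_pos ht, abs_of_pos Real.pi_pos,
      Complex.norm_ofNat]
    simp
    field_simp
    rfl

/-- The logarithmic singularity at 0 is killed by √t: writing log t = 2 log √t reduces it to the
continuous function x log x at x = √t. -/
theorem exists_continuous_sqrt_mul_hankelSq {κ : ℝ} (hκ : 0 < κ) :
    ∃ f : ℝ → ℂ, Continuous f ∧ ∀ t : ℝ, 0 < t →
      f t = (Real.sqrt t : ℂ) * hankelSq (((κ * t) ^ 2 / 4 : ℝ) : ℂ) := by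
  have hJ : Continuous (powerSum besselJCoeff) :=
    continuous_iff_continuousAt.2 fun s => (entireCoeff_besselJCoeff.hasDerivAt s).continuousAt
  have hY : Continuous (powerSum besselYCoeff) :=
    continuous_iff_continuousAt.2 fun s => (entireCoeff_besselYCoeff.hasDerivAt s).continuousAt
  have hL : Continuous fun t : ℝ => Real.sqrt t * Real.log (Real.sqrt t) :=
    Real.continuous_mul_log.comp Real.continuous_sqrt
  refine ⟨fun t => (1 + 2 * Complex.I * Real.eulerMascheroniConstant / Real.pi) *
      ((Real.sqrt t : ℂ) * powerSum besselJCoeff (((κ * t) ^ 2 / 4 : ℝ) : ℂ)) +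
    Complex.I / Real.pi * (((2 * Real.log (κ / 2) * Real.sqrt t +
      4 * (Real.sqrt t * Real.log (Real.sqrt t)) : ℝ) : ℂ) *
        powerSum besselJCoeff (((κ * t) ^ 2 / 4 : ℝ) : ℂ) +
      2 * ((Real.sqrt t : ℂ) * powerSum besselYCoeff (((κ * t) ^ 2 / 4 : ℝ) : ℂ))),
    by fun_prop, fun t ht => ?_⟩
  have hlog : Complex.log (((κ * t) ^ 2 / 4 : ℝ) : ℂ) =
      ((2 * Real.log (κ / 2) + 4 * Real.log (Real.sqrt t) : ℝ) : ℂ) := by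
    rw [← Complex.ofReal_log (by positivity), Real.log_sqrt ht.le]
    congr 1
    rw [show (κ * t) ^ 2 / 4 = (κ / 2 * t) ^ 2 by ring, Real.log_pow,
      Real.log_mul (by positivity) ht.ne']
    push_cast
    ring
  rw [hankelSq, hlog]
  push_cast
  ring

theorem isRadialProfile_two {κ : ℝ} (hκ : 0 < κ) {c : ℂ} (hc : c ≠ 0) :
    IsRadialProfile 2 κ fun s => c * hankelSq ((κ ^ 2 / 4 : ℝ) * s) := by
  have hmem : ∀ s ∈ Complex.slitPlane, ((κ ^ 2 / 4 : ℝ) : ℂ) * s ∈ Complex.slitPlane := by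
    intro s hs
    have h0 : 0 < κ ^ 2 / 4 := by positivity
    rw [Complex.mem_slitPlane_iff] at hs ⊢
    rw [Complex.re_ofReal_mul, Complex.im_ofReal_mul]
    exact hs.imp (fun h => mul_pos h0 h) fun h => mul_ne_zero h0.ne' h
  have hcast : ∀ t : ℝ, ((κ ^ 2 / 4 : ℝ) : ℂ) * ((t ^ 2 : ℝ) : ℂ) = (((κ * t) ^ 2 / 4 : ℝ) : ℂ) := by
    intro t
    push_cast
    ring
  have hsκ : (Real.sqrt κ : ℂ) ≠ 0 := by exact_mod_cast (Real.sqrt_pos.2 hκ).ne'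
  have hJ : Measurable (powerSum besselJCoeff) := (continuous_iff_continuousAt.2 fun s =>
    (entireCoeff_besselJCoeff.hasDerivAt s).continuousAt).measurable
  have hY : Measurable (powerSum besselYCoeff) := (continuous_iff_continuousAt.2 fun s =>
    (entireCoeff_besselYCoeff.hasDerivAt s).continuousAt).measurable
  have hH : Measurable hankelSq := by
    unfold hankelSq
    fun_prop
  refine ⟨by fun_prop, ?_, ?_, ?_⟩
  · intro s hs
    have h1 := (hasDerivAt_hankelSq (hmem s hs)).differentiableAt
    refine DifferentiableAt.differentiableWithinAt ?_
    exact (h1.comp s (by fun_prop)).const_mul c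
  · obtain ⟨a, b, hab, h⟩ := hankelZero_asymptotics
    -- The asymptotics are used at the argument κt, and √(κt) = √κ √t accounts for the factor 1/√κ.
    refine ⟨1 / 2, c / Real.sqrt κ * a, c / Real.sqrt κ * b, by norm_num, ?_, ?_⟩
    · exact hab.imp (fun h => mul_ne_zero (div_ne_zero hc hsκ) h)
        fun h => mul_ne_zero (div_ne_zero hc hsκ) h
    · have h2 := (h.comp (tendsto_id.const_mul_atTop hκ)).const_mul (c / Real.sqrt κ)
      rw [mul_zero] at h2
      refine h2.congr' ?_
      filter_upwards [eventually_gt_atTop 0] with t ht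
      simp only [Function.comp_apply, id]
      rw [hankelZero_eq (by positivity), hcast, ← Real.sqrt_eq_rpow, Real.sqrt_mul hκ.le]
      push_cast
      field_simp
  · intro R
    obtain ⟨f, hf, hft⟩ := exists_continuous_sqrt_mul_hankelSq hκ
    obtain ⟨C, hC⟩ := (isCompact_Icc (a := (0 : ℝ)) (b := R)).exists_bound_of_continuousOn
      hf.continuousOn
    refine ⟨(‖c‖ * C) ^ 2, fun t ht htR => ?_⟩
    have h1 := hC t ⟨ht.le, htR⟩
    rw [hft t ht, norm_mul, Complex.norm_real, Real.norm_eq_abs, abs_of_nonneg (Real.sqrt_nonneg _)]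
      at h1
    rw [hcast, norm_mul]
    calc _ = (‖c‖ * (Real.sqrt t * ‖hankelSq (((κ * t) ^ 2 / 4 : ℝ) : ℂ)‖)) ^ 2 := by
          generalize ‖hankelSq (((κ * t) ^ 2 / 4 : ℝ) : ℂ)‖ = h
          rw [mul_pow, mul_pow, mul_pow, Real.sq_sqrt ht.le]
          ring
      _ ≤ _ := by gcongr

/-! ### From the Green's function to its radial profile -/

theorem betaSq_pos {d : ℕ} {m : EuclideanSpace ℝ (Fin d)} (hm : ‖m‖ < 1) : 0 < betaSq m := by
  have := norm_nonneg m
  rw [betaSq]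
  nlinarith

theorem machNorm_pos {d : ℕ} {m z : EuclideanSpace ℝ (Fin d)} (hm : ‖m‖ < 1) (hz : z ≠ 0) :
    0 < machNorm m z := by
  have := betaSq_pos hm
  have := norm_pos_iff.2 hz
  exact Real.sqrt_pos.2 (by positivity)

theorem exists_radialProfile_green {d : ℕ} (hd : d = 2 ∨ d = 3) {k : ℝ} (hk : 0 < k)
    {m : EuclideanSpace ℝ (Fin d)} (hm : ‖m‖ < 1) :
    ∃ Φ : ℂ → ℂ, IsRadialProfile d (k / betaSq m) Φ ∧ ∀ x y : EuclideanSpace ℝ (Fin d), x ≠ y →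
      green d k m x y = Complex.exp (-(Complex.I * (k / betaSq m : ℝ) * (⟪x - y, m⟫_ℝ : ℂ))) *
        Φ ((machNorm m (x - y) ^ 2 : ℝ) : ℂ) := by
  have hβ := betaSq_pos hm
  rcases hd with rfl | rfl
  · have hs : (Real.sqrt (betaSq m) : ℂ) ≠ 0 := by exact_mod_cast (Real.sqrt_pos.2 hβ).ne'
    refine ⟨_, isRadialProfile_two (div_pos hk hβ)
      (c := Complex.I / (4 * (Real.sqrt (betaSq m) : ℂ))) (by simp [hs]), fun x y hxy => ?_⟩
    have hpos := machNorm_pos hm (sub_ne_zero.2 hxy)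
    change greenTwo k m x y = _
    rw [greenTwo, hankelZero_eq (mul_pos (div_pos hk hβ) hpos),
      mul_comm (Complex.I / (4 * (Real.sqrt (betaSq m) : ℂ))), mul_assoc]
    congr 4
    push_cast
    ring
  · refine ⟨_, isRadialProfile_three, fun x y hxy => ?_⟩
    have hpos := machNorm_pos hm (sub_ne_zero.2 hxy)
    have hsqrt : Complex.exp (Complex.log ((machNorm m (x - y) ^ 2 : ℝ) : ℂ) / 2) =
        machNorm m (x - y) := by
      rw [← Complex.ofReal_log (by positivity), Real.log_pow]
      push_cast
      rw [mul_div_cancel_left₀ _ two_ne_zero, ← Complex.ofReal_exp, Real.exp_log hpos]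
    change greenThree k m x y = _
    rw [greenThree, hsqrt, ← mul_div_assoc, ← Complex.exp_add]
    congr 2
    push_cast
    ring

/-! ### Holomorphic parameter integrals -/

/-- A bound on the integrand alone suffices, because Cauchy's estimate on discs of radius ε, half
the distance from τ₀ to the circle, bounds its derivative. -/
theorem differentiableOn_integral_of_bound {α : Type*} [MeasurableSpace α] {ν : Measure α}
    {G : ℂ → α → ℂ} {r : ℝ} {bound : α → ℝ} (hb : Integrable bound ν)
    (hm : ∀ τ ∈ Metric.ball (0 : ℂ) r, AEStronglyMeasurable (G τ) ν)
    (hd : ∀ᵐ y ∂ν, DifferentiableOn ℂ (fun τ => G τ y) (Metric.ball 0 r))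
    (hle : ∀ᵐ y ∂ν, ∀ τ ∈ Metric.ball (0 : ℂ) r, ‖G τ y‖ ≤ bound y) :
    DifferentiableOn ℂ (fun τ => ∫ y, G τ y ∂ν) (Metric.ball 0 r) := by
  intro τ₀ hτ₀
  have hn : ‖τ₀‖ < r := by simpa using hτ₀
  set ε := (r - ‖τ₀‖) / 2 with hε
  have hε0 : 0 < ε := by rw [hε]; linarith
  have hsub : ∀ τ ∈ Metric.ball τ₀ ε, Metric.closedBall τ ε ⊆ Metric.ball 0 r := by
    intro τ hτ z hz
    have h1 : ‖τ - τ₀‖ < ε := by simpa [dist_eq_norm] using hτ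
    have h2 : ‖z - τ‖ ≤ ε := by simpa [dist_eq_norm] using hz
    rw [mem_ball_zero_iff]
    calc ‖z‖ = ‖(z - τ) + (τ - τ₀) + τ₀‖ := by congr 1; ring
      _ ≤ ‖z - τ‖ + ‖τ - τ₀‖ + ‖τ₀‖ := norm_add₃_le
      _ < r := by rw [hε] at h1 h2; linarith
  have hsub' : ∀ τ ∈ Metric.ball τ₀ ε, τ ∈ Metric.ball (0 : ℂ) r := fun τ hτ =>
    hsub τ hτ (Metric.mem_closedBall_self hε0.le)
  have hdiff : ∀ᵐ y ∂ν, ∀ τ ∈ Metric.ball τ₀ ε,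
      HasDerivAt (fun τ => G τ y) (deriv (fun τ => G τ y) τ) τ := by
    filter_upwards [hd] with y hy τ hτ
    exact (hy.differentiableAt (Metric.isOpen_ball.mem_nhds (hsub' τ hτ))).hasDerivAt
  have hbd : ∀ᵐ y ∂ν, ∀ τ ∈ Metric.ball τ₀ ε, ‖deriv (fun τ => G τ y) τ‖ ≤ bound y / ε := by
    filter_upwards [hd, hle] with y hy hly τ hτ
    refine Complex.norm_deriv_le_of_forall_mem_sphere_norm_le hε0 ?_ fun z hz =>
      hly z (hsub τ hτ (Metric.sphere_subset_closedBall hz))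
    refine (hy.mono ?_).diffContOnCl
    rw [closure_ball _ hε0.ne']
    exact hsub τ hτ
  -- The derivative is measurable in y as a limit of difference quotients along a sequence.
  have hmeas : AEStronglyMeasurable (fun y => deriv (fun τ => G τ y) τ₀) ν := by
    obtain ⟨u, -, hu1, hu2⟩ := exists_seq_strictAnti_tendsto' hε0
    have hmem : ∀ n, τ₀ + (u n : ℂ) ∈ Metric.ball (0 : ℂ) r := fun n => by
      refine hsub' _ ?_
      simp only [Metric.mem_ball, dist_eq_norm, add_sub_cancel_left, Complex.norm_real,
        Real.norm_eq_abs, abs_of_pos (hu1 n).1]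
      exact (hu1 n).2
    refine aestronglyMeasurable_of_tendsto_ae atTop
      (f := fun n y => ((u n : ℂ))⁻¹ * (G (τ₀ + (u n : ℂ)) y - G τ₀ y))
      (fun n => ((hm _ (hmem n)).sub (hm τ₀ hτ₀)).const_mul _) ?_
    filter_upwards [hdiff] with y hy
    have h1 := (hy τ₀ (Metric.mem_ball_self hε0)).tendsto_slope_zero
    have h2 : Tendsto (fun n => (u n : ℂ)) atTop (𝓝[≠] 0) := by
      refine tendsto_nhdsWithin_iff.2 ⟨?_, Eventually.of_forall fun n => ?_⟩
      · exact_mod_cast (Complex.continuous_ofReal.tendsto 0).comp hu2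
      · simpa using (hu1 n).1.ne'
    exact (h1.comp h2).congr fun n => by simp
  have hint : Integrable (G τ₀) ν := by
    refine hb.mono' (hm τ₀ hτ₀) ?_
    filter_upwards [hle] with y hy
    exact hy τ₀ hτ₀
  exact (hasDerivAt_integral_of_dominated_loc_of_deriv_le (Metric.ball_mem_nhds τ₀ hε0)
    (by filter_upwards [Metric.ball_mem_nhds τ₀ hε0] with τ hτ using hm τ (hsub' τ hτ))
    hint hmeas hbd (hb.div_const ε) hdiff).2.differentiableAt.differentiableWithinAt

theorem analyticAt_real_of_differentiableOn {f : ℂ → ℂ} {r : ℝ} (hr : 0 < r)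
    (hf : DifferentiableOn ℂ f (Metric.ball 0 r)) : AnalyticAt ℝ (fun t : ℝ => f t) 0 := by
  have h1 : AnalyticAt ℂ f ((0 : ℝ) : ℂ) := by
    simpa using hf.analyticAt (Metric.ball_mem_nhds 0 hr)
  exact (h1.restrictScalars (𝕜 := ℝ)).comp (Complex.ofRealCLM.analyticAt 0)

/-! ### Unique continuation and the far field of radial potentials -/

theorem exists_pos_le_norm_sub {F : Type*} [NormedAddCommGroup F] {K : Set F}
    (hK : IsCompact K) {x : F} (hx : x ∈ Kᶜ) :
    ∃ δ > 0, ∀ z ∈ K, δ ≤ ‖x - z‖ := by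
  obtain ⟨δ, hδ, hs⟩ := Metric.isOpen_iff.1 hK.isClosed.isOpen_compl x hx
  refine ⟨δ, hδ, fun z hz => ?_⟩
  by_contra hc
  refine hs (Metric.mem_ball.2 ?_) hz
  rw [dist_comm, dist_eq_norm]
  exact not_le.1 hc

section Potential

variable {F : Type*} [NormedAddCommGroup F] [InnerProductSpace ℝ F]
  {α : Type*} [MeasurableSpace α] {ν : Measure α} {p : α → F} {f : α → ℂ} {K : Set F}
  {Φ : ℂ → ℂ}

/-- The potential with radial kernel `Φ(|x - p|²)` and density `f`. -/
noncomputable def radialPotential (Φ : ℂ → ℂ) (ν : Measure α) (p : α → F) (f : α → ℂ) (x : F) : ℂ :=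
  ∫ y, Φ ((‖x - p y‖ ^ 2 : ℝ) : ℂ) * f y ∂ν

theorem exists_norm_le_sector (hΦ : DifferentiableOn ℂ Φ Complex.slitPlane) {δ : ℝ} (hδ : 0 < δ)
    (L : ℝ) : ∃ C, ∀ z : ℂ, δ ≤ z.re → ‖z‖ ≤ L → ‖Φ z‖ ≤ C := by
  have hcpt : IsCompact ({z : ℂ | δ ≤ z.re} ∩ Metric.closedBall 0 L) :=
    (isCompact_closedBall (0 : ℂ) L).inter_left (isClosed_le continuous_const Complex.continuous_re)
  obtain ⟨C, hC⟩ := hcpt.exists_bound_of_continuousOn (f := Φ) (hΦ.continuousOn.mono (by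
    rintro z ⟨hz, -⟩
    exact Or.inl (hδ.trans_le hz)))
  exact ⟨C, fun z h1 h2 => hC z ⟨h1, by simpa using h2⟩⟩

/-- The right side is polynomial in t, so the squared distance along a line continues to complex t.
-/
theorem norm_sub_add_smul_sq (w v : F) (t : ℝ) :
    ((‖w + t • v‖ ^ 2 : ℝ) : ℂ) =
      (‖w‖ ^ 2 : ℝ) + 2 * (t : ℂ) * (⟪w, v⟫_ℝ : ℝ) + (t : ℂ) ^ 2 * (‖v‖ ^ 2 : ℝ) := by
  rw [norm_add_sq_real, inner_smul_right, norm_smul, mul_pow, Real.norm_eq_abs, sq_abs]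
  push_cast
  ring

/-- The squared distance from x + τv to p(y) stays in a compact part of the right half plane for
small complex τ, so the potential continues holomorphically in τ. Analyticity along lines is all
that unique continuation needs. -/
theorem radialPotential_analyticAt (hK : IsCompact K) (hΦm : Measurable Φ)
    (hΦ : DifferentiableOn ℂ Φ Complex.slitPlane) (hp : AEStronglyMeasurable p ν)
    (hpK : ∀ᵐ y ∂ν, p y ∈ K) (hf : Integrable f ν) {x : F} (hx : x ∈ Kᶜ) (v : F) :
    AnalyticAt ℝ (fun t : ℝ => radialPotential Φ ν p f (x + t • v)) 0 := by
  obtain ⟨δ, hδ, hδK⟩ := exists_pos_le_norm_sub hK hx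
  obtain ⟨R, hR⟩ := hK.isBounded.exists_norm_le
  set q : ℂ → α → ℂ := fun τ y => (‖x - p y‖ ^ 2 : ℝ) + 2 * τ * (⟪x - p y, v⟫_ℝ : ℝ) +
    τ ^ 2 * (‖v‖ ^ 2 : ℝ) with hq
  set D := ‖x‖ + |R| with hD
  have hD0 : 0 ≤ D := by positivity
  set A := 2 * (D * ‖v‖) + ‖v‖ ^ 2 with hA
  have hA0 : 0 ≤ A := by positivity
  -- For ‖τ‖ < ε the continued squared distance differs from its value, at least δ², at τ = 0 by at
  -- most ‖τ‖ A ≤ δ²/2.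
  set ε := min 1 (δ ^ 2 / (2 * (A + 1))) with hε
  have hε0 : 0 < ε := lt_min one_pos (by positivity)
  have hpert : ∀ᵐ y ∂ν, ∀ τ ∈ Metric.ball (0 : ℂ) ε, δ ^ 2 / 2 ≤ (q τ y).re ∧
      ‖q τ y‖ ≤ D ^ 2 + A := by
    filter_upwards [hpK] with y hy τ hτ
    have hτ1 : ‖τ‖ < ε := by simpa using hτ
    have hτ2 : ‖τ‖ ≤ 1 := hτ1.le.trans (min_le_left _ _)
    have hτ3 : ‖τ‖ * (A + 1) ≤ δ ^ 2 / 2 := by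
      have h := hτ1.le.trans (min_le_right _ _)
      rw [le_div_iff₀ (by positivity)] at h
      linarith
    have hw : ‖x - p y‖ ≤ D :=
      (norm_sub_le _ _).trans (add_le_add le_rfl ((hR _ hy).trans (le_abs_self R)))
    have hin : |⟪x - p y, v⟫_ℝ| ≤ D * ‖v‖ :=
      (abs_real_inner_le_norm _ _).trans (by gcongr)
    have hpb : ‖2 * τ * (⟪x - p y, v⟫_ℝ : ℝ) + τ ^ 2 * (‖v‖ ^ 2 : ℝ)‖ ≤ ‖τ‖ * A := by
      refine (norm_add_le _ _).trans ?_
      simp only [norm_mul, norm_pow, Complex.norm_real, Real.norm_eq_abs, abs_norm,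
        Complex.norm_ofNat]
      have h1 : ‖τ‖ ^ 2 ≤ ‖τ‖ := by nlinarith [norm_nonneg τ]
      have h2 : ‖τ‖ ^ 2 * ‖v‖ ^ 2 ≤ ‖τ‖ * ‖v‖ ^ 2 := by gcongr
      have h3 : 2 * ‖τ‖ * |⟪x - p y, v⟫_ℝ| ≤ 2 * ‖τ‖ * (D * ‖v‖) := by gcongr
      rw [hA]
      linarith
    have hqe : q τ y = (‖x - p y‖ ^ 2 : ℝ) +
        (2 * τ * (⟪x - p y, v⟫_ℝ : ℝ) + τ ^ 2 * (‖v‖ ^ 2 : ℝ)) := by rw [hq]; ring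
    have hδw : δ ^ 2 ≤ ‖x - p y‖ ^ 2 := by
      have := hδK _ hy
      gcongr
    constructor
    · rw [hqe, Complex.add_re, Complex.ofReal_re]
      have h1 := (abs_le.1 ((Complex.abs_re_le_norm _).trans hpb)).1
      nlinarith [norm_nonneg τ]
    · rw [hqe]
      refine (norm_add_le _ _).trans ?_
      rw [Complex.norm_real, Real.norm_eq_abs, abs_of_nonneg (by positivity)]
      have h1 : ‖x - p y‖ ^ 2 ≤ D ^ 2 := by gcongr
      have h2 : ‖τ‖ * A ≤ A := mul_le_of_le_one_left hA0 hτ2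
      linarith
  obtain ⟨C, hC⟩ := exists_norm_le_sector hΦ (δ := δ ^ 2 / 2) (by positivity) (D ^ 2 + A)
  have hdiff : DifferentiableOn ℂ (fun τ => ∫ y, Φ (q τ y) * f y ∂ν) (Metric.ball 0 ε) := by
    refine differentiableOn_integral_of_bound (bound := fun y => C * ‖f y‖) (hf.norm.const_mul C)
      (fun τ _ => ?_) ?_ ?_
    · have hq1 : AEStronglyMeasurable (q τ) ν := by
        have h1 : AEStronglyMeasurable (fun y => x - p y) ν := aestronglyMeasurable_const.sub hp
        have hc : Continuous fun w : F => ((‖w‖ ^ 2 : ℝ) : ℂ) + 2 * τ * (⟪w, v⟫_ℝ : ℝ) +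
          τ ^ 2 * (‖v‖ ^ 2 : ℝ) := by fun_prop
        exact hc.comp_aestronglyMeasurable h1
      exact (hΦm.comp_aemeasurable hq1.aemeasurable).aestronglyMeasurable.mul hf.1
    · filter_upwards [hpert] with y hy τ hτ
      have hmem : q τ y ∈ Complex.slitPlane := Or.inl (lt_of_lt_of_le (by positivity) (hy τ hτ).1)
      have h1 : DifferentiableAt ℂ Φ (q τ y) :=
        hΦ.differentiableAt (Complex.isOpen_slitPlane.mem_nhds hmem)
      have h2 : DifferentiableAt ℂ (fun τ => q τ y) τ := by
        simp only [hq]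
        fun_prop
      exact ((h1.comp τ h2).mul_const _).differentiableWithinAt
    · filter_upwards [hpert] with y hy τ hτ
      rw [norm_mul]
      gcongr
      exact hC _ (hy τ hτ).1 (hy τ hτ).2
  refine (analyticAt_real_of_differentiableOn hε0 hdiff).congr (Eventually.of_forall fun t => ?_)
  simp only [radialPotential, hq]
  congr 1
  ext y
  rw [← norm_sub_add_smul_sq, add_sub_right_comm]

/-- The points near which the potential vanishes form an open set that is relatively closed in the
connected set Kᶜ. Closedness uses one variable analyticity along segments inside a ball. -/
theorem radialPotential_eq_zero (hK : IsCompact K) (hKc : IsPreconnected Kᶜ) (hΦm : Measurable Φ)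
    (hΦ : DifferentiableOn ℂ Φ Complex.slitPlane) (hp : AEStronglyMeasurable p ν)
    (hpK : ∀ᵐ y ∂ν, p y ∈ K) (hf : Integrable f ν) {V : Set F} (hV : IsOpen V)
    (hVne : V.Nonempty) (hVK : V ⊆ Kᶜ) (h0 : ∀ x ∈ V, radialPotential Φ ν p f x = 0) :
    ∀ x ∈ Kᶜ, radialPotential Φ ν p f x = 0 := by
  set U := radialPotential Φ ν p f
  have hKo : IsOpen Kᶜ := hK.isClosed.isOpen_compl
  have hline : ∀ (x v : F), (∀ t ∈ Icc (0 : ℝ) 1, x + t • v ∈ Kᶜ) → U =ᶠ[𝓝 x] 0 → U (x + v) = 0 := by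
    intro x v hmem hx
    have han : AnalyticOnNhd ℝ (fun t : ℝ => U (x + t • v)) (Icc 0 1) := by
      intro t ht
      have h1 := radialPotential_analyticAt hK hΦm hΦ hp hpK hf (hmem t ht) v
      have h2 : AnalyticAt ℝ (fun s : ℝ => s - t) t := by fun_prop
      have h3 := AnalyticAt.fun_comp (g := fun s : ℝ => radialPotential Φ ν p f (x + t • v + s • v))
        (f := fun s : ℝ => s - t) (x := t) (by rwa [sub_self]) h2
      refine h3.congr (Eventually.of_forall fun s => ?_)
      simp only [U]
      congr 1
      rw [add_assoc, ← add_smul]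
      congr 2
      ring
    have hev : (fun t : ℝ => U (x + t • v)) =ᶠ[𝓝 0] 0 := by
      have hc : Tendsto (fun t : ℝ => x + t • v) (𝓝 0) (𝓝 x) := by
        have : Continuous fun t : ℝ => x + t • v := by fun_prop
        simpa using this.tendsto 0
      exact hc.eventually hx
    have := han.eqOn_zero_of_preconnected_of_eventuallyEq_zero isPreconnected_Icc
      (left_mem_Icc.2 zero_le_one) hev (right_mem_Icc.2 zero_le_one)
    simpa using this
  set Z := {x : F | U =ᶠ[𝓝 x] 0} with hZ
  have hsub : Kᶜ ⊆ Z := by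
    refine hKc.subset_of_closure_inter_subset ?_ ?_ ?_
    · exact isOpen_iff_mem_nhds.2 fun x hx => Filter.Eventually.eventually_nhds hx
    · obtain ⟨x, hx⟩ := hVne
      exact ⟨x, hVK hx, by filter_upwards [hV.mem_nhds hx] with y hy using h0 y hy⟩
    -- A point z of the set in a ball about the limit point x sees every y of that ball along a
    -- segment inside it.
    · rintro x ⟨hxZ, hxK⟩
      obtain ⟨r, hr, hball⟩ := Metric.isOpen_iff.1 hKo x hxK
      obtain ⟨z, hzZ, hzx⟩ := Metric.mem_closure_iff.1 hxZ r hr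
      filter_upwards [Metric.ball_mem_nhds x hr] with y hy
      have := hline z (y - z) (fun t ht => hball ?_) hzZ
      · simpa using this
      · refine (convex_ball x r).add_smul_sub_mem ?_ hy ht
        rwa [Metric.mem_ball, dist_comm]
  intro x hx
  exact (hsub hx).eq_of_nhds

theorem tendsto_norm_smul_sub_div {ω : F} (hω : ‖ω‖ = 1) (z : F) :
    Tendsto (fun r : ℝ => ‖r • ω - z‖ / r) atTop (𝓝 1) := by
  have h1 : Tendsto (fun r : ℝ => ‖ω - r⁻¹ • z‖) atTop (𝓝 ‖ω - (0 : ℝ) • z‖) :=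
    (tendsto_const_nhds.sub (tendsto_inv_atTop_zero.smul_const z)).norm
  rw [zero_smul, sub_zero, hω] at h1
  refine h1.congr' ?_
  filter_upwards [eventually_gt_atTop 0] with r hr
  rw [eq_div_iff hr.ne', mul_comm]
  nth_rewrite 1 [← abs_of_pos hr]
  rw [← Real.norm_eq_abs, ← norm_smul, smul_sub, smul_inv_smul₀ hr.ne']

/-- With ρ = ‖rω - z‖, divide r² - ρ² = 2r⟪ω, z⟫ - ‖z‖² by r + ρ. -/
theorem tendsto_sub_norm_smul_sub {ω : F} (hω : ‖ω‖ = 1) (z : F) :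
    Tendsto (fun r : ℝ => r - ‖r • ω - z‖) atTop (𝓝 ⟪ω, z⟫_ℝ) := by
  have h1 : Tendsto (fun r : ℝ => (2 * ⟪ω, z⟫_ℝ - ‖z‖ ^ 2 * r⁻¹) / (1 + ‖r • ω - z‖ / r)) atTop
      (𝓝 ((2 * ⟪ω, z⟫_ℝ - ‖z‖ ^ 2 * 0) / (1 + 1))) :=
    (tendsto_const_nhds.sub (tendsto_inv_atTop_zero.const_mul _)).div
      (tendsto_const_nhds.add (tendsto_norm_smul_sub_div hω z)) (by norm_num)
  rw [show (2 * ⟪ω, z⟫_ℝ - ‖z‖ ^ 2 * 0) / (1 + 1) = ⟪ω, z⟫_ℝ by ring] at h1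
  refine h1.congr' ?_
  filter_upwards [eventually_gt_atTop 0] with r hr
  have h2 : ‖r • ω - z‖ ^ 2 = r ^ 2 - 2 * (r * ⟪ω, z⟫_ℝ) + ‖z‖ ^ 2 := by
    rw [norm_sub_sq_real, norm_smul, hω, real_inner_smul_left, mul_one, Real.norm_eq_abs, sq_abs]
  have h3 : 0 ≤ ‖r • ω - z‖ := norm_nonneg _
  rw [div_eq_iff (by positivity)]
  field_simp
  nlinarith

/-- Multiply the vanishing potential at r_n ω by r_n^P and let n → ∞. Since κ r_n is constant modulo
2π, the oscillating factors converge, and dominated convergence applies. -/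
theorem integral_farField_eq_zero {d : ℕ} {κ : ℝ} (hΦ : IsRadialProfile d κ Φ) {P : ℝ} {a b : ℂ}
    (hP : 0 ≤ P) (hasym : Tendsto (fun t : ℝ => ((t ^ P : ℝ) : ℂ) * Φ ((t ^ 2 : ℝ) : ℂ) -
      (a * Complex.exp (Complex.I * (κ * t : ℝ)) + b * Complex.exp (-(Complex.I * (κ * t : ℝ)))))
      atTop (𝓝 0))
    (hK : IsCompact K) (hp : AEStronglyMeasurable p ν) (hpK : ∀ᵐ y ∂ν, p y ∈ K)
    (hf : Integrable f ν) (h0 : ∀ x ∈ Kᶜ, radialPotential Φ ν p f x = 0) {ω : F} (hω : ‖ω‖ = 1)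
    {r : ℕ → ℝ} (hr : Tendsto r atTop atTop) {ζ : ℂ} (hζ : ∀ n, Complex.exp (Complex.I * (κ * r n : ℝ)) = ζ) :
    ∫ y, (a * (ζ * Complex.exp (-(Complex.I * (κ * ⟪ω, p y⟫_ℝ : ℝ)))) +
      b * (ζ⁻¹ * Complex.exp (Complex.I * (κ * ⟪ω, p y⟫_ℝ : ℝ)))) * f y ∂ν = 0 := by
  obtain ⟨R₀, hR₀⟩ := hK.isBounded.exists_norm_le
  set R := |R₀| + 1 with hRdef
  have hR1 : 0 < R := by positivity
  have hR : ∀ z ∈ K, ‖z‖ < R := fun z hz => by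
    have := (hR₀ z hz).trans (le_abs_self _)
    rw [hRdef]; linarith
  have hnorm : ∀ s : ℝ, ‖Complex.exp (Complex.I * (s : ℂ))‖ = 1 := fun s => by
    rw [Complex.norm_exp]; simp
  have hnorm' : ∀ s : ℝ, ‖Complex.exp (-(Complex.I * (s : ℂ)))‖ = 1 := fun s => by
    rw [Complex.norm_exp]; simp
  obtain ⟨T, hT⟩ : ∃ T : ℝ, ∀ t ≥ T, ‖((t ^ P : ℝ) : ℂ) * Φ ((t ^ 2 : ℝ) : ℂ)‖ ≤ ‖a‖ + ‖b‖ + 1 := by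
    obtain ⟨T, hT⟩ := eventually_atTop.1 (hasym.norm.eventually_le_const (u := 1) (by simp))
    refine ⟨T, fun t ht => ?_⟩
    have h1 := hT t ht
    have h2 : ‖a * Complex.exp (Complex.I * (κ * t : ℝ)) +
        b * Complex.exp (-(Complex.I * (κ * t : ℝ)))‖ ≤ ‖a‖ + ‖b‖ := by
      refine (norm_add_le _ _).trans ?_
      rw [norm_mul, norm_mul, hnorm, hnorm', mul_one, mul_one]
    have h3 := norm_le_norm_add_norm_sub' (((t ^ P : ℝ) : ℂ) * Φ ((t ^ 2 : ℝ) : ℂ))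
      (a * Complex.exp (Complex.I * (κ * t : ℝ)) + b * Complex.exp (-(Complex.I * (κ * t : ℝ))))
    linarith
  have hlow : ∀ {s : ℝ} {z : F}, 0 ≤ s → z ∈ K → s - R ≤ ‖s • ω - z‖ := by
    intro s z hs hz
    have h1 := norm_sub_norm_le (s • ω) z
    rw [norm_smul, hω, mul_one, Real.norm_eq_abs, abs_of_nonneg hs] at h1
    linarith [hR z hz]
  have hlim : Tendsto (fun n => ∫ y, (((r n) ^ P : ℝ) : ℂ) * (Φ ((‖r n • ω - p y‖ ^ 2 : ℝ) : ℂ) * f y) ∂ν)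
      atTop (𝓝 (∫ y, (a * (ζ * Complex.exp (-(Complex.I * (κ * ⟪ω, p y⟫_ℝ : ℝ)))) +
      b * (ζ⁻¹ * Complex.exp (Complex.I * (κ * ⟪ω, p y⟫_ℝ : ℝ)))) * f y ∂ν)) := by
    refine tendsto_integral_filter_of_dominated_convergence
      (fun y => (2 ^ P * (‖a‖ + ‖b‖ + 1)) * ‖f y‖) (Eventually.of_forall fun n => ?_) ?_
      (hf.norm.const_mul _) ?_
    · have h1 : AEStronglyMeasurable (fun y => r n • ω - p y) ν := aestronglyMeasurable_const.sub hp
      have hc : Continuous fun w : F => ((‖w‖ ^ 2 : ℝ) : ℂ) := by fun_prop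
      exact ((hΦ.measurable.comp_aemeasurable
        (hc.comp_aestronglyMeasurable h1).aemeasurable).aestronglyMeasurable.mul hf.1).const_mul _
    · filter_upwards [hr.eventually_ge_atTop (2 * R), hr.eventually_ge_atTop (T + R)] with n h1 h2
      filter_upwards [hpK] with y hy
      have hrn : 0 < r n := by linarith
      have h3 := hlow hrn.le hy
      set ρ := ‖r n • ω - p y‖
      have hρ : 0 < ρ := by linarith
      -- From r ≥ 2R and ρ ≥ r - R one gets r ≤ 2ρ, so the dominating constant is uniform in y.
      have h4 : (r n) ^ P ≤ 2 ^ P * ρ ^ P := by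
        rw [← Real.mul_rpow (by norm_num) hρ.le]
        exact Real.rpow_le_rpow hrn.le (by linarith) hP
      have h5 := hT ρ (by linarith)
      rw [norm_mul, Complex.norm_real, Real.norm_eq_abs, abs_of_nonneg (by positivity)] at h5
      rw [norm_mul, norm_mul, Complex.norm_real, Real.norm_eq_abs, abs_of_nonneg (by positivity)]
      calc (r n) ^ P * (‖Φ ((ρ ^ 2 : ℝ) : ℂ)‖ * ‖f y‖)
          ≤ (2 ^ P * ρ ^ P) * (‖Φ ((ρ ^ 2 : ℝ) : ℂ)‖ * ‖f y‖) := by gcongr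
        _ = 2 ^ P * (ρ ^ P * ‖Φ ((ρ ^ 2 : ℝ) : ℂ)‖) * ‖f y‖ := by ring
        _ ≤ _ := by gcongr
    · filter_upwards [hpK] with y hy
      set ρ : ℕ → ℝ := fun n => ‖r n • ω - p y‖ with hρ
      have hρtop : Tendsto ρ atTop atTop := by
        refine tendsto_atTop_mono' _ ?_ (tendsto_atTop_add_const_right _ (-R) hr)
        filter_upwards [hr.eventually_ge_atTop 0] with n hn
        exact hlow hn hy
      have h1 : Tendsto (fun n => r n - ρ n) atTop (𝓝 ⟪ω, p y⟫_ℝ) :=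
        (tendsto_sub_norm_smul_sub hω (p y)).comp hr
      have h2 : Tendsto (fun n => ((ρ n / r n) ^ P)⁻¹) atTop (𝓝 1) := by
        have := (((tendsto_norm_smul_sub_div hω (p y)).comp hr).rpow_const (p := P)
          (Or.inl one_ne_zero)).inv₀ (by simp)
        simpa using this
      have h3 := hasym.comp hρtop
      have hcE : Continuous fun s : ℝ => a * (ζ * Complex.exp (-(Complex.I * (κ * s : ℝ)))) +
          b * (ζ⁻¹ * Complex.exp (Complex.I * (κ * s : ℝ))) := by fun_prop
      have h4 := (hcE.tendsto _).comp h1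
      have h5 := (((Complex.continuous_ofReal.tendsto 1).comp h2).mul (h3.add h4)).mul_const (f y)
      simp only [Complex.ofReal_one, one_mul, zero_add] at h5
      refine h5.congr' ?_
      filter_upwards [hr.eventually_gt_atTop 0, hρtop.eventually_gt_atTop 0] with n hn hρn
      simp only [Function.comp_apply]
      have e1 : ζ * Complex.exp (-(Complex.I * (κ * (r n - ρ n) : ℝ))) =
          Complex.exp (Complex.I * (κ * ρ n : ℝ)) := by
        rw [← hζ n, ← Complex.exp_add]
        congr 1
        push_cast
        ring
      have e2 : ζ⁻¹ * Complex.exp (Complex.I * (κ * (r n - ρ n) : ℝ)) =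
          Complex.exp (-(Complex.I * (κ * ρ n : ℝ))) := by
        rw [← hζ n, ← Complex.exp_neg, ← Complex.exp_add]
        congr 1
        push_cast
        ring
      rw [e1, e2, sub_add_cancel, Real.div_rpow hρn.le hn.le, inv_div]
      have h6 : ((ρ n ^ P : ℝ) : ℂ) ≠ 0 := by exact_mod_cast (Real.rpow_pos_of_pos hρn P).ne'
      push_cast
      field_simp
      simp only [hρ]
      ring
  refine tendsto_nhds_unique hlim (tendsto_const_nhds.congr' ?_)
  filter_upwards [hr.eventually_ge_atTop R] with n hn
  rw [integral_const_mul]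
  have hx : r n • ω ∈ Kᶜ := by
    intro hc
    have := hR _ hc
    rw [norm_smul, hω, mul_one, Real.norm_eq_abs] at this
    linarith [le_abs_self (r n)]
  have := h0 _ hx
  rw [radialPotential] at this
  rw [this, mul_zero]

/-- If a radial potential vanishes on an open set outside its support, then its density has no far
field; the sign `σ` depends only on the profile. -/
theorem exists_sign_farField {d : ℕ} {κ : ℝ} (hκ : 0 < κ) (hΦ : IsRadialProfile d κ Φ) :
    ∃ σ : ℝ, (σ = 1 ∨ σ = -1) ∧ ∀ {F : Type} [NormedAddCommGroup F] [InnerProductSpace ℝ F]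
      {α : Type} [MeasurableSpace α] {ν : Measure α} {p : α → F} {f : α → ℂ} {K V : Set F},
      IsCompact K → IsPreconnected Kᶜ → AEStronglyMeasurable p ν → (∀ᵐ y ∂ν, p y ∈ K) →
      Integrable f ν → IsOpen V → V.Nonempty → V ⊆ Kᶜ →
      (∀ x ∈ V, radialPotential Φ ν p f x = 0) → ∀ ω : F, ‖ω‖ = 1 →
      ∫ y, Complex.exp (Complex.I * (σ * κ * ⟪ω, p y⟫_ℝ : ℝ)) * f y ∂ν = 0 := by
  obtain ⟨P, a, b, hP, hab, hasym⟩ := hΦ.asymptotics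
  have main : ∀ {F : Type} [NormedAddCommGroup F] [InnerProductSpace ℝ F]
      {α : Type} [MeasurableSpace α] {ν : Measure α} {p : α → F} {f : α → ℂ} {K V : Set F},
      IsCompact K → IsPreconnected Kᶜ → AEStronglyMeasurable p ν → (∀ᵐ y ∂ν, p y ∈ K) →
      Integrable f ν → IsOpen V → V.Nonempty → V ⊆ Kᶜ →
      (∀ x ∈ V, radialPotential Φ ν p f x = 0) → ∀ ω : F, ‖ω‖ = 1 →
      a * ∫ y, Complex.exp (-(Complex.I * (κ * ⟪ω, p y⟫_ℝ : ℝ))) * f y ∂ν = 0 ∧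
      b * ∫ y, Complex.exp (Complex.I * (κ * ⟪ω, p y⟫_ℝ : ℝ)) * f y ∂ν = 0 := by
    intro F _ _ α _ ν p f K V hK hKc hp hpK hf hV hVne hVK h0 ω hω
    have h0' := radialPotential_eq_zero hK hKc hΦ.measurable hΦ.differentiableOn hp hpK hf hV hVne
      hVK h0
    -- At r = 2πn/κ one has ζ = 1, and the shift by π/(2κ) gives ζ = i. With X and Y the two
    -- quantities claimed to vanish, the limits read X + Y = 0 and iX - iY = 0.
    have hbase : Tendsto (fun n : ℕ => (n : ℝ) * (2 * Real.pi / κ)) atTop atTop :=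
      tendsto_natCast_atTop_atTop.atTop_mul_const (by positivity)
    have hκ' : (κ : ℂ) ≠ 0 := by exact_mod_cast hκ.ne'
    have h1 := integral_farField_eq_zero hΦ hP hasym hK hp hpK hf h0' hω hbase (ζ := 1) (fun n => by
      rw [Complex.exp_eq_one_iff]
      refine ⟨n, ?_⟩
      push_cast
      field_simp)
    have h2 := integral_farField_eq_zero hΦ hP hasym hK hp hpK hf h0' hω
      (tendsto_atTop_add_const_right _ (Real.pi / 2 / κ) hbase) (ζ := Complex.I) (fun n => by
      refine (Complex.exp_eq_exp_iff_exists_int.2 ⟨n, ?_⟩).trans Complex.exp_pi_div_two_mul_I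
      push_cast
      field_simp
      ring)
    have hint : ∀ g : F → ℝ, Continuous g → (Integrable (fun y =>
        Complex.exp (Complex.I * (g (p y) : ℝ)) * f y) ν) := by
      intro g hg
      refine hf.bdd_mul (c := 1) ?_ (ae_of_all _ fun y => ?_)
      · have : Continuous fun z => Complex.exp (Complex.I * (g z : ℝ)) := by fun_prop
        exact this.comp_aestronglyMeasurable hp
      · rw [Complex.norm_exp]; simp
    have i1 : Integrable (fun y => Complex.exp (-(Complex.I * (κ * ⟪ω, p y⟫_ℝ : ℝ))) * f y) ν := by
      refine (hint (fun z => -(κ * ⟪ω, z⟫_ℝ)) (by fun_prop)).congr (ae_of_all _ fun y => ?_)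
      simp
    have i2 : Integrable (fun y => Complex.exp (Complex.I * (κ * ⟪ω, p y⟫_ℝ : ℝ)) * f y) ν :=
      hint (fun z => κ * ⟪ω, z⟫_ℝ) (by fun_prop)
    have split : ∀ ζ : ℂ, ∫ y, (a * (ζ * Complex.exp (-(Complex.I * (κ * ⟪ω, p y⟫_ℝ : ℝ)))) +
        b * (ζ⁻¹ * Complex.exp (Complex.I * (κ * ⟪ω, p y⟫_ℝ : ℝ)))) * f y ∂ν =
        ζ * (a * ∫ y, Complex.exp (-(Complex.I * (κ * ⟪ω, p y⟫_ℝ : ℝ))) * f y ∂ν) +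
        ζ⁻¹ * (b * ∫ y, Complex.exp (Complex.I * (κ * ⟪ω, p y⟫_ℝ : ℝ)) * f y ∂ν) := by
      intro ζ
      rw [← integral_const_mul, ← integral_const_mul, ← integral_const_mul, ← integral_const_mul,
        ← integral_add ((i1.const_mul a).const_mul ζ) ((i2.const_mul b).const_mul ζ⁻¹)]
      congr 1
      ext y
      ring
    rw [split] at h1 h2
    rw [inv_one, one_mul, one_mul] at h1
    rw [Complex.inv_I] at h2
    have h3 := mul_left_cancel₀ Complex.I_ne_zero ((by linear_combination h2 :
      Complex.I * (a * ∫ y, Complex.exp (-(Complex.I * (κ * ⟪ω, p y⟫_ℝ : ℝ))) * f y ∂ν) =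
      Complex.I * (b * ∫ y, Complex.exp (Complex.I * (κ * ⟪ω, p y⟫_ℝ : ℝ)) * f y ∂ν)))
    constructor
    · linear_combination (h1 + h3) / 2
    · linear_combination (h1 - h3) / 2
  -- Whichever amplitude is nonzero fixes the sign before any density is chosen, so one sign serves
  -- both later applications.
  rcases hab with ha | hb
  · refine ⟨-1, Or.inr rfl, fun hK hKc hp hpK hf hV hVne hVK h0 ω hω => ?_⟩
    have := (mul_eq_zero.1 (main hK hKc hp hpK hf hV hVne hVK h0 ω hω).1).resolve_left ha
    simpa using this
  · refine ⟨1, Or.inl rfl, fun hK hKc hp hpK hf hV hVne hVK h0 ω hω => ?_⟩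
    have := (mul_eq_zero.1 (main hK hKc hp hpK hf hV hVne hVK h0 ω hω).2).resolve_left hb
    simpa using this

end Potential

/-! ### Injectivity of the Fourier transform on small frequencies -/

/-- The positive and negative parts of g are densities of finite measures with equal characteristic
functions, so these measures coincide. -/
theorem ae_eq_zero_of_fourier_real {E : Type*} [NormedAddCommGroup E] [InnerProductSpace ℝ E]
    [CompleteSpace E] [MeasurableSpace E] [BorelSpace E] [SecondCountableTopology E]
    {ν : Measure E} {g : E → ℝ} (hg : Integrable g ν)
    (h : ∀ ξ : E, ∫ y, Complex.exp (Complex.I * (⟪y, ξ⟫_ℝ : ℝ)) * (g y : ℂ) ∂ν = 0) :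
    g =ᵐ[ν] 0 := by
  have hfin : ∀ {g : E → ℝ}, Integrable g ν →
      IsFiniteMeasure (ν.withDensity fun y => ENNReal.ofReal (g y)) := fun hg =>
    isFiniteMeasure_withDensity_ofReal hg.2
  have := hfin hg
  have := hfin hg.neg
  have hchar : ∀ {g : E → ℝ}, Integrable g ν → ∀ ξ : E,
      charFun (ν.withDensity fun y => ENNReal.ofReal (g y)) ξ =
        ∫ y, (max (g y) 0 : ℝ) * Complex.exp (Complex.I * (⟪y, ξ⟫_ℝ : ℝ)) ∂ν := by
    intro g hg ξ
    rw [charFun_apply, integral_withDensity_eq_integral_toReal_smul₀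
      hg.1.aemeasurable.ennreal_ofReal
      (ae_of_all _ fun y => ENNReal.ofReal_lt_top)]
    refine integral_congr_ae (ae_of_all _ fun y => ?_)
    simp only [ENNReal.toReal_ofReal', Complex.real_smul]
    rw [mul_comm Complex.I]
  have hint : ∀ {g : E → ℝ}, Integrable g ν → ∀ ξ : E,
      Integrable (fun y => ((max (g y) 0 : ℝ) : ℂ) * Complex.exp (Complex.I * (⟪y, ξ⟫_ℝ : ℝ))) ν := by
    intro g hg ξ
    refine (hg.pos_part.ofReal (𝕜 := ℂ)).mul_bdd (c := 1) ?_ (ae_of_all _ fun y => ?_)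
    · exact Continuous.aestronglyMeasurable (by fun_prop)
    · rw [Complex.norm_exp]; simp
  have heq : (ν.withDensity fun y => ENNReal.ofReal (g y)) =
      ν.withDensity fun y => ENNReal.ofReal ((-g) y) := by
    refine Measure.ext_of_charFun (funext fun ξ => ?_)
    rw [hchar hg, hchar hg.neg, ← sub_eq_zero, ← integral_sub (hint hg ξ) (hint hg.neg ξ), ← h ξ]
    refine integral_congr_ae (ae_of_all _ fun y => ?_)
    have h1 : max (g y) 0 - max (-g y) 0 = g y := max_zero_sub_eq_self (g y)
    simp only [Pi.neg_apply]
    rw [← sub_mul, ← Complex.ofReal_sub, h1, mul_comm]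
  have hae := (withDensity_eq_iff
    hg.1.aemeasurable.ennreal_ofReal
    hg.neg.1.aemeasurable.ennreal_ofReal
    ((lintegral_mono fun x => Real.ofReal_le_enorm _).trans_lt hg.2).ne).1 heq
  filter_upwards [hae] with y hy
  rw [Pi.neg_apply] at hy
  rcases le_total (g y) 0 with h1 | h1
  · rw [ENNReal.ofReal_of_nonpos h1] at hy
    have := ENNReal.ofReal_eq_zero.1 hy.symm
    simp only [Pi.zero_apply]
    linarith
  · rw [ENNReal.ofReal_of_nonpos (by linarith : -g y ≤ 0)] at hy
    have := ENNReal.ofReal_eq_zero.1 hy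
    simp only [Pi.zero_apply]
    linarith

/-- Conjugation reflects the frequency, so the transforms of the real and imaginary parts vanish
separately. -/
theorem ae_eq_zero_of_fourier {E : Type*} [NormedAddCommGroup E] [InnerProductSpace ℝ E]
    [CompleteSpace E] [MeasurableSpace E] [BorelSpace E] [SecondCountableTopology E]
    {ν : Measure E} {q : E → ℂ} (hq : Integrable q ν)
    (h : ∀ ξ : E, ∫ y, Complex.exp (Complex.I * (⟪y, ξ⟫_ℝ : ℝ)) * q y ∂ν = 0) :
    q =ᵐ[ν] 0 := by
  have hconj : ∀ ξ : E, ∫ y, Complex.exp (Complex.I * (⟪y, ξ⟫_ℝ : ℝ)) * starRingEnd ℂ (q y) ∂ν = 0 := by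
    intro ξ
    have h1 := congrArg (starRingEnd ℂ) (h (-ξ))
    rw [← integral_conj, map_zero] at h1
    rw [← h1]
    refine integral_congr_ae (ae_of_all _ fun y => ?_)
    simp only [map_mul, ← Complex.exp_conj, Complex.conj_I, Complex.conj_ofReal, inner_neg_right]
    push_cast
    ring_nf
  have hmul : ∀ (f : E → ℂ), Integrable f ν → ∀ ξ : E,
      Integrable (fun y => Complex.exp (Complex.I * (⟪y, ξ⟫_ℝ : ℝ)) * f y) ν := by
    intro f hf ξ
    refine hf.bdd_mul (c := 1) ?_ (ae_of_all _ fun y => ?_)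
    · exact Continuous.aestronglyMeasurable (by fun_prop)
    · rw [Complex.norm_exp]; simp
  have hqc : Integrable (fun y => starRingEnd ℂ (q y)) ν :=
    (LinearIsometryEquiv.integrable_comp_iff Complex.conjLIE).2 hq
  have hre := ae_eq_zero_of_fourier_real hq.re fun ξ => by
    have h1 : ∫ y, (Complex.exp (Complex.I * (⟪y, ξ⟫_ℝ : ℝ)) * q y +
        Complex.exp (Complex.I * (⟪y, ξ⟫_ℝ : ℝ)) * starRingEnd ℂ (q y)) ∂ν = 0 := by
      rw [integral_add (hmul _ hq ξ) (hmul _ hqc ξ), h, hconj, add_zero]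
    rw [← mul_right_inj' (two_ne_zero (α := ℂ)), mul_zero, ← h1, ← integral_const_mul]
    refine integral_congr_ae (ae_of_all _ fun y => ?_)
    have := Complex.add_conj (q y)
    push_cast at this
    simp only [RCLike.re_to_complex]
    linear_combination -Complex.exp (Complex.I * (⟪y, ξ⟫_ℝ : ℝ)) * this
  have him := ae_eq_zero_of_fourier_real hq.im fun ξ => by
    have h1 : ∫ y, (Complex.exp (Complex.I * (⟪y, ξ⟫_ℝ : ℝ)) * q y -
        Complex.exp (Complex.I * (⟪y, ξ⟫_ℝ : ℝ)) * starRingEnd ℂ (q y)) ∂ν = 0 := by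
      rw [integral_sub (hmul _ hq ξ) (hmul _ hqc ξ), h, hconj, sub_zero]
    rw [← mul_right_inj' (mul_ne_zero (two_ne_zero (α := ℂ)) Complex.I_ne_zero), mul_zero, ← h1,
      ← integral_const_mul]
    refine integral_congr_ae (ae_of_all _ fun y => ?_)
    have := Complex.sub_conj (q y)
    push_cast at this
    simp only [RCLike.im_to_complex]
    linear_combination -Complex.exp (Complex.I * (⟪y, ξ⟫_ℝ : ℝ)) * this
  filter_upwards [hre, him] with y h1 h2
  exact Complex.ext h1 h2

/-- For bounded b the integral is holomorphic in the frequency parameter on the disc of radius 2. It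
vanishes on a real interval about 0, hence at 1. -/
theorem integral_exp_eq_zero_of_small {α : Type*} [MeasurableSpace α] {ν : Measure α} {f : α → ℂ}
    (hf : Integrable f ν) {b : α → ℝ} (hb : AEMeasurable b ν) {B : ℝ} (hB : ∀ᵐ y ∂ν, |b y| ≤ B)
    {ε : ℝ} (hε : 0 < ε)
    (h : ∀ t : ℝ, |t| < ε → ∫ y, Complex.exp (Complex.I * (t * b y : ℝ)) * f y ∂ν = 0) :
    ∫ y, Complex.exp (Complex.I * (b y : ℝ)) * f y ∂ν = 0 := by
  have hdiff : DifferentiableOn ℂ (fun τ : ℂ => ∫ y, Complex.exp (Complex.I * (τ * (b y : ℝ))) * f y ∂ν)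
      (Metric.ball 0 2) := by
    refine differentiableOn_integral_of_bound (bound := fun y => Real.exp (2 * B) * ‖f y‖)
      (hf.norm.const_mul _) (fun τ _ => ?_) (ae_of_all _ fun y => ?_) ?_
    · exact AEStronglyMeasurable.mul (AEMeasurable.aestronglyMeasurable (by fun_prop)) hf.1
    · exact Differentiable.differentiableOn (by fun_prop)
    · filter_upwards [hB] with y hy τ hτ
      rw [norm_mul, Complex.norm_exp]
      gcongr
      have h1 : ‖τ‖ ≤ 2 := by simpa using (mem_ball_zero_iff.1 hτ).le
      refine (Complex.re_le_norm _).trans ?_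
      rw [norm_mul, norm_mul, Complex.norm_I, one_mul, Complex.norm_real, Real.norm_eq_abs]
      gcongr
  have han := hdiff.analyticOnNhd Metric.isOpen_ball
  have hfreq : ∃ᶠ τ in 𝓝[≠] (0 : ℂ),
      ∫ y, Complex.exp (Complex.I * (τ * (b y : ℝ))) * f y ∂ν = 0 := by
    have h1 : Tendsto (fun t : ℝ => (t : ℂ)) (𝓝[≠] 0) (𝓝[≠] 0) := by
      refine tendsto_nhdsWithin_iff.2 ⟨?_, ?_⟩
      · exact_mod_cast (Complex.continuous_ofReal.tendsto 0).mono_left nhdsWithin_le_nhds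
      · filter_upwards [self_mem_nhdsWithin] with t ht
        simpa using ht
    refine h1.frequently (Eventually.frequently ?_)
    filter_upwards [nhdsWithin_le_nhds (Metric.ball_mem_nhds (0 : ℝ) hε)] with t ht
    rw [← h t (by simpa using ht)]
    push_cast
    rfl
  have := han.eqOn_zero_of_preconnected_of_frequently_eq_zero (convex_ball 0 2).isPreconnected
    (Metric.mem_ball_self two_pos) hfreq (show (1 : ℂ) ∈ Metric.ball 0 2 by simp)
  simpa using this

/-- Take ±ξ/2 plus a common vector orthogonal to ξ, of length √(1 - ‖ξ‖²/4) by Pythagoras. Dimension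
at least 2 supplies the orthogonal direction. -/
theorem exists_unit_sub_eq {F : Type*} [NormedAddCommGroup F] [InnerProductSpace ℝ F]
    [FiniteDimensional ℝ F] (hF : 2 ≤ Module.finrank ℝ F) {ξ : F} (hξ : ‖ξ‖ < 2) :
    ∃ ω₁ ω₂ : F, ‖ω₁‖ = 1 ∧ ‖ω₂‖ = 1 ∧ ω₁ - ω₂ = ξ := by
  obtain ⟨e, he, he0⟩ : ∃ e ∈ (ℝ ∙ ξ)ᗮ, e ≠ 0 := by
    refine Submodule.exists_mem_ne_zero_of_ne_bot fun hc => ?_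
    rw [Submodule.orthogonal_eq_bot_iff] at hc
    have h1 := finrank_span_le_card (R := ℝ) ({ξ} : Set F)
    rw [hc, finrank_top] at h1
    simp at h1
    lia
  have hin : ⟪ξ, e⟫_ℝ = 0 := Submodule.mem_orthogonal_singleton_iff_inner_right.1 he
  have he1 : ‖e‖ ≠ 0 := norm_ne_zero_iff.2 he0
  set c := Real.sqrt (1 - ‖ξ‖ ^ 2 / 4) with hc
  have hc2 : c ^ 2 = 1 - ‖ξ‖ ^ 2 / 4 := Real.sq_sqrt (by nlinarith [norm_nonneg ξ])
  have key : ∀ s : ℝ, s ^ 2 = 1 / 4 → ‖s • ξ + (c / ‖e‖) • e‖ = 1 := by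
    intro s hs
    rw [← sq_eq_sq₀ (norm_nonneg _) zero_le_one, norm_add_sq_real, real_inner_smul_left,
      inner_smul_right, hin, norm_smul, norm_smul, mul_pow, mul_pow, Real.norm_eq_abs, sq_abs,
      Real.norm_eq_abs, sq_abs, hs, div_pow, hc2]
    field_simp
    ring
  refine ⟨(1 / 2 : ℝ) • ξ + (c / ‖e‖) • e, (-(1 / 2) : ℝ) • ξ + (c / ‖e‖) • e, key _ (by norm_num),
    key _ (by norm_num), ?_⟩
  rw [add_sub_add_right_eq_sub, ← sub_smul]
  norm_num

/-- For small t the frequency tξ has the form s Aᵀ(ω₁ - ω₂); analyticity in t then reaches ξ itself.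
-/
theorem ae_eq_zero_of_sphere_differences {E F : Type*} [NormedAddCommGroup E]
    [InnerProductSpace ℝ E] [FiniteDimensional ℝ E] [MeasurableSpace E] [BorelSpace E]
    [NormedAddCommGroup F] [InnerProductSpace ℝ F] [FiniteDimensional ℝ F]
    (hF : 2 ≤ Module.finrank ℝ F) {ν : Measure E} {q : E → ℂ} (hq : Integrable q ν) {K : Set E}
    (hK : IsCompact K) (hνK : ∀ᵐ y ∂ν, y ∈ K) (A : E →L[ℝ] F)
    (hA : ∀ ξ : E, ∃ η : F, ∀ y, ⟪η, A y⟫_ℝ = ⟪y, ξ⟫_ℝ) {s : ℝ} (hs : s ≠ 0)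
    (h : ∀ ω₁ ω₂ : F, ‖ω₁‖ = 1 → ‖ω₂‖ = 1 →
      ∫ y, Complex.exp (Complex.I * (s * ⟪ω₁ - ω₂, A y⟫_ℝ : ℝ)) * q y ∂ν = 0) :
    q =ᵐ[ν] 0 := by
  have : ProperSpace E := FiniteDimensional.proper ℝ E
  have : CompleteSpace E := FiniteDimensional.complete ℝ E
  refine ae_eq_zero_of_fourier hq fun ξ => ?_
  obtain ⟨η, hη⟩ := hA ξ
  obtain ⟨R, hR⟩ := hK.isBounded.exists_norm_le
  refine integral_exp_eq_zero_of_small hq (b := fun y => ⟪y, ξ⟫_ℝ) (B := R * ‖ξ‖) (by fun_prop) ?_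
    (ε := |s| / (‖η‖ + 1)) (by positivity) fun t ht => ?_
  · filter_upwards [hνK] with y hy
    refine (abs_real_inner_le_norm _ _).trans ?_
    gcongr
    exact hR y hy
  · obtain ⟨ω₁, ω₂, h1, h2, h12⟩ := exists_unit_sub_eq hF (ξ := (t / s) • η) (by
      rw [norm_smul, Real.norm_eq_abs, abs_div]
      rw [lt_div_iff₀ (by positivity)] at ht
      have hs' : 0 < |s| := abs_pos.2 hs
      rw [div_mul_eq_mul_div, div_lt_iff₀ hs']
      nlinarith [abs_nonneg t, norm_nonneg η])
    rw [← h ω₁ ω₂ h1 h2, h12]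
    refine integral_congr_ae (ae_of_all _ fun y => ?_)
    simp only [real_inner_smul_left, hη]
    rw [← mul_assoc, mul_div_cancel₀ _ hs]

/-! ### Rank one operators as Hilbert–Schmidt operators -/

section RankOne

variable {H : Type*} [NormedAddCommGroup H] [InnerProductSpace ℂ H] [CompleteSpace H]

theorem rankOne_mem_hsSubmodule (f : H) : InnerProductSpace.rankOne ℂ f f ∈ hsSubmodule H := by
  refine memℓp_gen ?_
  have h := ((hsBasis H).orthonormal.inner_products_summable f).mul_right (‖f‖ ^ 2)
  refine h.congr fun j => ?_
  rw [InnerProductSpace.rankOne_apply, norm_smul, norm_inner_symm]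
  simp only [ENNReal.toReal_ofNat, Real.rpow_ofNat]
  ring

/-- The operator `φ ↦ ⟪f, φ⟫ f`. -/
noncomputable def hsRankOne (f : H) : HilbertSchmidt H :=
  (⟨InnerProductSpace.rankOne ℂ f f, rankOne_mem_hsSubmodule f⟩ : ↥(hsSubmodule H))

theorem toCLM_hsRankOne (f φ : H) : HilbertSchmidt.toCLM (hsRankOne f) φ = ⟪f, φ⟫_ℂ • f :=
  InnerProductSpace.rankOne_apply ..

/-- Parseval's identity in the fixed Hilbert basis. -/
theorem inner_hsRankOne (f g : H) : ⟪hsRankOne f, hsRankOne g⟫_ℂ = ⟪g, f⟫_ℂ * ⟪f, g⟫_ℂ := by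
  change ⟪HilbertSchmidt.toSeq (hsRankOne f), HilbertSchmidt.toSeq (hsRankOne g)⟫_ℂ = _
  rw [lp.inner_eq_tsum, ← (hsBasis H).tsum_inner_mul_inner g f, ← tsum_mul_right]
  refine tsum_congr fun j => ?_
  change ⟪HilbertSchmidt.toCLM (hsRankOne f) _, HilbertSchmidt.toCLM (hsRankOne g) _⟫_ℂ = _
  rw [toCLM_hsRankOne, toCLM_hsRankOne, inner_smul_left, inner_smul_right, inner_conj_symm]
  ring

theorem inner_hsRankOne_comm (f g : H) :
    ⟪hsRankOne f, hsRankOne g⟫_ℂ = ⟪hsRankOne g, hsRankOne f⟫_ℂ := by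
  rw [inner_hsRankOne, inner_hsRankOne, mul_comm]

theorem norm_hsRankOne (f : H) : ‖hsRankOne f‖ = ‖f‖ ^ 2 := by
  have h : ((‖hsRankOne f‖ ^ 2 : ℝ) : ℂ) = (((‖f‖ ^ 2) ^ 2 : ℝ) : ℂ) := by
    have h1 := inner_self_eq_norm_sq_to_K (𝕜 := ℂ) (hsRankOne f)
    rw [inner_hsRankOne, inner_self_eq_norm_sq_to_K (𝕜 := ℂ) f] at h1
    push_cast
    simp only [Complex.coe_algebraMap] at h1
    rw [← h1]
    ring
  exact (sq_eq_sq₀ (norm_nonneg _) (by positivity)).1 (Complex.ofReal_injective h)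

/-- The squared distance of the operators of f and g is ‖g‖⁴ - 2|⟪f, g⟫|² + ‖f‖⁴, continuous in g
and zero at g = f. -/
theorem continuous_hsRankOne : Continuous (hsRankOne : H → HilbertSchmidt H) := by
  refine continuous_iff_continuousAt.2 fun f => ?_
  rw [ContinuousAt, tendsto_iff_norm_sub_tendsto_zero]
  have hsq : ∀ g : H, ‖hsRankOne g - hsRankOne f‖ =
      Real.sqrt ((‖g‖ ^ 2) ^ 2 - 2 * (⟪f, g⟫_ℂ * ⟪g, f⟫_ℂ).re + (‖f‖ ^ 2) ^ 2) := by
    intro g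
    rw [← norm_hsRankOne g, ← norm_hsRankOne f, ← inner_hsRankOne, ← RCLike.re_to_complex,
      ← norm_sub_sq (𝕜 := ℂ), Real.sqrt_sq (norm_nonneg _)]
  simp only [hsq]
  have hc : Continuous fun g : H =>
      Real.sqrt ((‖g‖ ^ 2) ^ 2 - 2 * (⟪f, g⟫_ℂ * ⟪g, f⟫_ℂ).re + (‖f‖ ^ 2) ^ 2) := by fun_prop
  have h0 := hc.tendsto f
  rwa [← hsq, sub_self, norm_zero] at h0

/-- The inclusion of the Hilbert–Schmidt operators into the bounded operators, as a bounded map. -/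
noncomputable def hsInclusion : HilbertSchmidt H →L[ℂ] H →L[ℂ] H :=
  (HilbertSchmidt.toCLM (H := H)).mkContinuous 1 fun K => by
    rw [one_mul]
    exact ContinuousLinearMap.opNorm_le_bound _ (norm_nonneg _) (HilbertSchmidt.norm_toCLM_apply_le K)

end RankOne

/-! ### Superpositions of a bounded family of vectors -/

section Superposition

variable {X : Type*} [MeasurableSpace X] {ν : Measure X} [IsFiniteMeasure ν]
  {V : Type*} [NormedAddCommGroup V] [InnerProductSpace ℂ V] {P : X → V} {S : ℝ}

theorem integrable_of_L2 (q : Lp ℂ 2 ν) : Integrable q ν :=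
  (Lp.memLp q).integrable one_le_two

/-- On a finite measure space L² embeds in L¹, and a bounded measurable family may be integrated
against L¹ densities. -/
theorem exists_superposition (hP : AEStronglyMeasurable P ν) (hS : ∀ᵐ y ∂ν, ‖P y‖ ≤ S) :
    ∃ C : Lp ℂ 2 ν →L[ℂ] V, ∀ q : Lp ℂ 2 ν, C q = ∫ y, q y • P y ∂ν := by
  have hint : ∀ q : Lp ℂ 2 ν, Integrable (fun y => q y • P y) ν := fun q =>
    (integrable_of_L2 q).smul_bdd S hP hS
  let L : Lp ℂ 2 ν →ₗ[ℂ] V :=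
    { toFun := fun q => ∫ y, q y • P y ∂ν
      map_add' := fun q r => by
        rw [← integral_add (hint q) (hint r)]
        refine integral_congr_ae ?_
        filter_upwards [Lp.coeFn_add q r] with y hy
        rw [hy, Pi.add_apply, add_smul]
      map_smul' := fun c q => by
        rw [RingHom.id_apply, ← integral_smul]
        refine integral_congr_ae ?_
        filter_upwards [Lp.coeFn_smul c q] with y hy
        rw [hy, Pi.smul_apply, smul_assoc] }
  refine ⟨L.mkContinuous (|S| * (ν univ ^ (1 / (1 : ℝ≥0∞).toReal - 1 / (2 : ℝ≥0∞).toReal)).toReal)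
    fun q => ?_, fun q => rfl⟩
  have h1 : ‖L q‖ ≤ ∫ y, |S| * ‖q y‖ ∂ν := by
    refine norm_integral_le_of_norm_le ((integrable_of_L2 q).norm.const_mul _) ?_
    filter_upwards [hS] with y hy
    rw [norm_smul, mul_comm]
    gcongr
    exact hy.trans (le_abs_self S)
  have h2 : ∫ y, ‖q y‖ ∂ν ≤
      ‖q‖ * (ν univ ^ (1 / (1 : ℝ≥0∞).toReal - 1 / (2 : ℝ≥0∞).toReal)).toReal := by
    rw [integral_norm_eq_lintegral_enorm (Lp.aestronglyMeasurable q), Lp.norm_def,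
      ← ENNReal.toReal_mul, ← eLpNorm_one_eq_lintegral_enorm]
    refine ENNReal.toReal_mono ?_
      (eLpNorm_le_eLpNorm_mul_rpow_measure_univ one_le_two (Lp.aestronglyMeasurable q))
    refine ENNReal.mul_ne_top (Lp.eLpNorm_ne_top q) (ENNReal.rpow_ne_top_of_nonneg ?_
      (measure_ne_top ν univ))
    norm_num
  rw [integral_const_mul] at h1
  refine h1.trans ?_
  rw [mul_assoc, mul_comm _ ‖q‖]
  gcongr

variable {C : Lp ℂ 2 ν →L[ℂ] V}

theorem inner_superposition [CompleteSpace V] (hP : AEStronglyMeasurable P ν) (hS : ∀ᵐ y ∂ν, ‖P y‖ ≤ S)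
    (hC : ∀ q : Lp ℂ 2 ν, C q = ∫ y, q y • P y ∂ν) (v : V) (q : Lp ℂ 2 ν) :
    ⟪v, C q⟫_ℂ = ∫ y, q y * ⟪v, P y⟫_ℂ ∂ν := by
  rw [hC, ← integral_inner (f := fun y => q y • P y) ((integrable_of_L2 q).smul_bdd S hP hS)]
  simp only [inner_smul_right]

/-- A density whose superposition is orthogonal to the whole family has zero superposition. -/
theorem superposition_eq_zero [CompleteSpace V] (hP : AEStronglyMeasurable P ν) (hS : ∀ᵐ y ∂ν, ‖P y‖ ≤ S)
    (hC : ∀ q : Lp ℂ 2 ν, C q = ∫ y, q y • P y ∂ν) {w : Lp ℂ 2 ν}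
    (hw : ∀ᵐ y ∂ν, ∫ y', w y' * ⟪P y, P y'⟫_ℂ ∂ν = 0) : C w = 0 := by
  -- ‖C w‖² is the integral of w(y) ⟪C w, P y⟫, whose second factor is the conjugate of the
  -- vanishing integral.
  rw [← inner_self_eq_zero (𝕜 := ℂ), inner_superposition hP hS hC]
  refine integral_eq_zero_of_ae ?_
  filter_upwards [hw] with y hy
  rw [← inner_conj_symm, inner_superposition hP hS hC, hy, map_zero, mul_zero, Pi.zero_apply]

end Superposition

/-! ### Integral operators with separable superposition kernels -/

/-- Fubini on Y × X₁ × X₂, with absolute integrability from uniform L¹ bounds on the two factors. -/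
theorem integral_superposition_kernel {X₁ X₂ Y : Type*} [MeasurableSpace X₁] [MeasurableSpace X₂]
    [MeasurableSpace Y] {μ₁ : Measure X₁} {μ₂ : Measure X₂} {ν : Measure Y} [SFinite μ₁]
    [SFinite μ₂] [SFinite ν] {G₁ : X₁ → Y → ℂ} {G₂ : X₂ → Y → ℂ} {q : Y → ℂ} {S₁ S₂ : ℝ}
    (hm₁ : StronglyMeasurable (Function.uncurry G₁)) (hm₂ : StronglyMeasurable (Function.uncurry G₂))
    (hi₁ : ∀ᵐ y ∂ν, Integrable (fun x => G₁ x y) μ₁) (hi₂ : ∀ᵐ y ∂ν, Integrable (fun x => G₂ x y) μ₂)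
    (hS₁ : ∀ᵐ y ∂ν, ∫ x, ‖G₁ x y‖ ∂μ₁ ≤ S₁) (hS₂ : ∀ᵐ y ∂ν, ∫ x, ‖G₂ x y‖ ∂μ₂ ≤ S₂)
    (hq : Integrable q ν) :
    Integrable (fun x : X₁ × X₂ => ∫ y, G₁ x.1 y * q y * G₂ x.2 y ∂ν) (μ₁.prod μ₂) ∧
    ∫ x₁, ∫ x₂, (∫ y, G₁ x₁ y * q y * G₂ x₂ y ∂ν) ∂μ₂ ∂μ₁ =
      ∫ y, q y * (∫ x, G₂ x y ∂μ₂) * (∫ x, G₁ x y ∂μ₁) ∂ν := by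
  have hmeas : AEStronglyMeasurable (fun z : Y × X₁ × X₂ => G₁ z.2.1 z.1 * q z.1 * G₂ z.2.2 z.1)
      (ν.prod (μ₁.prod μ₂)) := by
    have h1 : Measurable fun z : Y × X₁ × X₂ => (z.2.1, z.1) := by fun_prop
    have h2 : Measurable fun z : Y × X₁ × X₂ => (z.2.2, z.1) := by fun_prop
    exact ((hm₁.comp_measurable h1).aestronglyMeasurable.mul hq.1.comp_fst).mul
      (hm₂.comp_measurable h2).aestronglyMeasurable
  have hnorm : ∀ y, ∫ x : X₁ × X₂, ‖G₁ x.1 y * q y * G₂ x.2 y‖ ∂(μ₁.prod μ₂) =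
      ‖q y‖ * ((∫ x, ‖G₁ x y‖ ∂μ₁) * ∫ x, ‖G₂ x y‖ ∂μ₂) := by
    intro y
    rw [← integral_prod_mul, ← integral_const_mul]
    refine integral_congr_ae (ae_of_all _ fun x => ?_)
    simp only [norm_mul]
    ring
  have hint : Integrable (fun z : Y × X₁ × X₂ => G₁ z.2.1 z.1 * q z.1 * G₂ z.2.2 z.1)
      (ν.prod (μ₁.prod μ₂)) := by
    rw [integrable_prod_iff hmeas]
    refine ⟨?_, ?_⟩
    · filter_upwards [hi₁, hi₂] with y h1 h2
      refine ((h1.mul_prod h2).const_mul (q y)).congr (ae_of_all _ fun x => ?_)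
      simp only
      ring
    · refine (hq.norm.mul_const (S₁ * S₂)).mono'
        hmeas.norm.integral_prod_right' ?_
      filter_upwards [hS₁, hS₂] with y h1 h2
      have n1 : 0 ≤ ∫ x, ‖G₁ x y‖ ∂μ₁ := integral_nonneg fun _ => norm_nonneg _
      have n2 : 0 ≤ ∫ x, ‖G₂ x y‖ ∂μ₂ := integral_nonneg fun _ => norm_nonneg _
      rw [hnorm, Real.norm_of_nonneg (by positivity)]
      have n3 : 0 ≤ S₁ := n1.trans h1
      gcongr
  have hint' := hint.integral_prod_right
  refine ⟨hint', ?_⟩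
  rw [integral_integral hint', integral_integral_swap (f := fun (x : X₁ × X₂) y => G₁ x.1 y * q y * G₂ x.2 y) hint.swap]
  refine integral_congr_ae (ae_of_all _ fun y => ?_)
  simp only
  rw [mul_assoc, mul_comm (∫ x, G₂ x y ∂μ₂), ← integral_prod_mul, ← integral_const_mul]
  refine integral_congr_ae (ae_of_all _ fun x => ?_)
  simp only
  ring

/-! ### The Prandtl–Glauert transformation -/

theorem exists_machEquiv {d : ℕ} {m : EuclideanSpace ℝ (Fin d)} (hm : ‖m‖ < 1) :
    ∃ A : EuclideanSpace ℝ (Fin d) ≃L[ℝ] EuclideanSpace ℝ (Fin d),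
      (∀ z, ‖A z‖ = machNorm m z) ∧ ∀ x y, ⟪A x, y⟫_ℝ = ⟪x, A y⟫_ℝ := by
  set β := Real.sqrt (betaSq m) with hβdef
  have hβ : 0 < β := Real.sqrt_pos.2 (betaSq_pos hm)
  have hβ2 : β ^ 2 = 1 - ‖m‖ ^ 2 := Real.sq_sqrt (betaSq_pos hm).le
  -- The positive square root of β² I + m mᵀ: since ‖m‖² = (1 - β)(1 + β), the coefficient 1/(1 + β)
  -- makes the m mᵀ term of L² equal to 1.
  let L : EuclideanSpace ℝ (Fin d) →ₗ[ℝ] EuclideanSpace ℝ (Fin d) :=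
    β • LinearMap.id + (1 / (1 + β)) • ((innerₛₗ ℝ m).smulRight m)
  have hL : ∀ x, L x = β • x + (1 / (1 + β)) • (⟪m, x⟫_ℝ • m) := fun x => rfl
  have hnorm : ∀ z, ‖L z‖ = machNorm m z := by
    intro z
    rw [machNorm, ← Real.sqrt_sq (norm_nonneg (L z))]
    congr 1
    rw [hL, norm_add_sq_real, real_inner_smul_left, inner_smul_right, inner_smul_right, norm_smul,
      norm_smul, norm_smul, mul_pow, mul_pow, mul_pow, Real.norm_eq_abs, Real.norm_eq_abs,
      Real.norm_eq_abs, sq_abs, sq_abs, sq_abs, real_inner_comm z m, betaSq, ← hβ2,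
      show ‖m‖ ^ 2 = 1 - β ^ 2 by linarith]
    field_simp
    ring
  have hinj : Function.Injective L := by
    refine (injective_iff_map_eq_zero L).2 fun z hz => ?_
    by_contra hne
    have := machNorm_pos hm hne
    rw [← hnorm, hz, norm_zero] at this
    exact lt_irrefl _ this
  refine ⟨(LinearEquiv.ofInjectiveEndo L hinj).toContinuousLinearEquiv, hnorm, fun x y => ?_⟩
  change ⟪L x, y⟫_ℝ = ⟪x, L y⟫_ℝ
  rw [hL, hL]
  simp only [inner_add_left, inner_add_right, real_inner_smul_left, inner_smul_right]
  rw [real_inner_comm x m]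
  ring

/-! ### The convected kernel -/

section ConvectedKernel

variable {d : ℕ} {κ : ℝ} {m : EuclideanSpace ℝ (Fin d)} {Φ : ℂ → ℂ}
  {A : EuclideanSpace ℝ (Fin d) ≃L[ℝ] EuclideanSpace ℝ (Fin d)}
  {M K : Set (EuclideanSpace ℝ (Fin d))}

/-- The kernel `e^{-iκ (x - y)·m} Φ(|A (x - y)|²)`. -/
noncomputable def convectedKernel (κ : ℝ) (m : EuclideanSpace ℝ (Fin d)) (Φ : ℂ → ℂ)
    (A : EuclideanSpace ℝ (Fin d) ≃L[ℝ] EuclideanSpace ℝ (Fin d))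
    (x y : EuclideanSpace ℝ (Fin d)) : ℂ :=
  Complex.exp (-(Complex.I * κ * (⟪x - y, m⟫_ℝ : ℂ))) * Φ ((‖A (x - y)‖ ^ 2 : ℝ) : ℂ)

theorem measurable_convectedKernel (hΦ : Measurable Φ) :
    Measurable (Function.uncurry (convectedKernel κ m Φ A)) := by
  have h1 : Measurable fun z : EuclideanSpace ℝ (Fin d) × EuclideanSpace ℝ (Fin d) =>
      ((‖A (z.1 - z.2)‖ ^ 2 : ℝ) : ℂ) := Continuous.measurable (by fun_prop)
  have h2 : Measurable fun z : EuclideanSpace ℝ (Fin d) × EuclideanSpace ℝ (Fin d) =>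
      Complex.exp (-(Complex.I * κ * (⟪z.1 - z.2, m⟫_ℝ : ℂ))) := Continuous.measurable (by fun_prop)
  exact h2.mul (hΦ.comp h1)

theorem norm_convectedKernel (x y : EuclideanSpace ℝ (Fin d)) :
    ‖convectedKernel κ m Φ A x y‖ = ‖Φ ((‖A (x - y)‖ ^ 2 : ℝ) : ℂ)‖ := by
  rw [convectedKernel, norm_mul, Complex.norm_exp]
  simp [mul_assoc]

theorem continuousAt_convectedKernel (hΦ : DifferentiableOn ℂ Φ Complex.slitPlane)
    {x y : EuclideanSpace ℝ (Fin d)} (hxy : x ≠ y) :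
    ContinuousAt (Function.uncurry (convectedKernel κ m Φ A)) (x, y) := by
  have hpos : 0 < ‖A (x - y)‖ := by
    rw [norm_pos_iff, ne_eq, map_eq_zero_iff _ A.injective, sub_eq_zero]
    exact hxy
  have h1 : ContinuousAt Φ ((‖A (x - y)‖ ^ 2 : ℝ) : ℂ) :=
    (hΦ.differentiableAt (Complex.isOpen_slitPlane.mem_nhds
      (Complex.ofReal_mem_slitPlane.2 (by positivity)))).continuousAt
  have h2 : ContinuousAt (fun z : EuclideanSpace ℝ (Fin d) × EuclideanSpace ℝ (Fin d) =>
      ((‖A (z.1 - z.2)‖ ^ 2 : ℝ) : ℂ)) (x, y) := by fun_prop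
  have h3 : ContinuousAt (fun z : EuclideanSpace ℝ (Fin d) × EuclideanSpace ℝ (Fin d) =>
      Complex.exp (-(Complex.I * κ * (⟪z.1 - z.2, m⟫_ℝ : ℂ)))) (x, y) := by fun_prop
  exact h3.mul (ContinuousAt.comp (g := Φ) (x := (x, y)) h1 h2)

theorem continuousAt_convectedKernel_left (hΦ : DifferentiableOn ℂ Φ Complex.slitPlane)
    {x y : EuclideanSpace ℝ (Fin d)} (hxy : x ≠ y) :
    ContinuousAt (fun x => convectedKernel κ m Φ A x y) x := by
  have h := ContinuousAt.comp (g := Function.uncurry (convectedKernel κ m Φ A))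
    (f := fun x : EuclideanSpace ℝ (Fin d) => (x, y)) (x := x)
    (continuousAt_convectedKernel hΦ hxy) (by fun_prop)
  simpa only [Function.comp_def, Function.uncurry_apply_pair] using h

theorem continuousAt_convectedKernel_right (hΦ : DifferentiableOn ℂ Φ Complex.slitPlane)
    {x y : EuclideanSpace ℝ (Fin d)} (hxy : x ≠ y) :
    ContinuousAt (fun y => convectedKernel κ m Φ A x y) y := by
  have h := ContinuousAt.comp (g := Function.uncurry (convectedKernel κ m Φ A))
    (f := fun y : EuclideanSpace ℝ (Fin d) => (x, y)) (x := y)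
    (continuousAt_convectedKernel hΦ hxy) (by fun_prop)
  simpa only [Function.comp_def, Function.uncurry_apply_pair] using h

theorem exists_norm_convectedKernel_le (hΦ : DifferentiableOn ℂ Φ Complex.slitPlane)
    {B : Set (EuclideanSpace ℝ (Fin d))} (hB : IsCompact B) (hK : IsCompact K)
    (hBK : Disjoint B K) : ∃ C, ∀ x ∈ B, ∀ y ∈ K, ‖convectedKernel κ m Φ A x y‖ ≤ C := by
  obtain ⟨C, hC⟩ := (hB.prod hK).exists_bound_of_continuousOn
    (f := Function.uncurry (convectedKernel κ m Φ A)) (fun z hz =>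
      (continuousAt_convectedKernel hΦ (hBK.ne_of_mem hz.1 hz.2)).continuousWithinAt)
  exact ⟨C, fun x hx y hy => hC (x, y) ⟨hx, hy⟩⟩

/-- In polar coordinates the volume factor t^{d-1} cancels the singularity. -/
theorem integrable_indicator_norm_inv_pow (hd : 1 ≤ d) (C R : ℝ) :
    Integrable fun z : EuclideanSpace ℝ (Fin d) =>
      (Iio R).indicator (fun t : ℝ => C * (t ^ (d - 1))⁻¹) ‖z‖ := by
  have : Nonempty (Fin d) := ⟨⟨0, hd⟩⟩
  rw [integrable_fun_norm_addHaar volume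
    (f := (Iio R).indicator (fun t : ℝ => C * (t ^ (d - 1))⁻¹)),
    finrank_euclideanSpace_fin]
  have h1 : IntegrableOn (fun _ : ℝ => C) (Ioo 0 R) := by simp
  have h2 : IntegrableOn ((Iio R).indicator fun _ : ℝ => C) (Ioi 0) := by
    rw [integrableOn_indicator_iff measurableSet_Iio, Set.inter_comm, Ioi_inter_Iio]
    exact h1
  refine h2.congr_fun (fun t ht => ?_) measurableSet_Ioi
  have ht' : (t : ℝ) ≠ 0 := (mem_Ioi.1 ht).ne'
  by_cases h : t ∈ Iio R
  · simp only [indicator_of_mem h, smul_eq_mul]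
    field_simp
  · simp [indicator_of_notMem h]

theorem exists_sq_norm_convectedKernel_le (hΦ : IsRadialProfile d κ Φ) (R : ℝ) :
    ∃ C : ℝ, 0 ≤ C ∧ ∀ x y, x ≠ y → ‖x - y‖ < R →
      ‖convectedKernel κ m Φ A x y‖ ^ 2 ≤ C * (‖x - y‖ ^ (d - 1))⁻¹ := by
  obtain ⟨C, hC⟩ := hΦ.sq_bound (‖(A : EuclideanSpace ℝ (Fin d) →L[ℝ] EuclideanSpace ℝ (Fin d))‖ * R)
  set c := ‖(A.symm : EuclideanSpace ℝ (Fin d) →L[ℝ] EuclideanSpace ℝ (Fin d))‖ with hc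
  refine ⟨|C| * c ^ (d - 1), by positivity, fun x y hx hxy => ?_⟩
  have hpos : 0 < ‖x - y‖ := norm_pos_iff.2 (sub_ne_zero.2 hx)
  have hApos : 0 < ‖A (x - y)‖ := by
    rw [norm_pos_iff, ne_eq, map_eq_zero_iff _ A.injective]
    exact sub_ne_zero.2 hx
  have h1 := hC ‖A (x - y)‖ hApos
    (((A : EuclideanSpace ℝ (Fin d) →L[ℝ] EuclideanSpace ℝ (Fin d)).le_opNorm (x - y)).trans
      (by gcongr))
  have h2 : ‖x - y‖ ≤ c * ‖A (x - y)‖ := by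
    have := (A.symm : EuclideanSpace ℝ (Fin d) →L[ℝ] EuclideanSpace ℝ (Fin d)).le_opNorm (A (x - y))
    simpa using this
  rw [norm_convectedKernel, ← div_eq_mul_inv, le_div_iff₀ (by positivity)]
  calc ‖Φ ((‖A (x - y)‖ ^ 2 : ℝ) : ℂ)‖ ^ 2 * ‖x - y‖ ^ (d - 1)
      ≤ ‖Φ ((‖A (x - y)‖ ^ 2 : ℝ) : ℂ)‖ ^ 2 * (c * ‖A (x - y)‖) ^ (d - 1) := by gcongr
    _ = (‖Φ ((‖A (x - y)‖ ^ 2 : ℝ) : ℂ)‖ ^ 2 * ‖A (x - y)‖ ^ (d - 1)) * c ^ (d - 1) := by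
        rw [mul_pow]; ring
    _ ≤ |C| * c ^ (d - 1) := by
        gcongr
        exact h1.trans (le_abs_self C)

/-- The bound is uniform in y even if M and K have common boundary points: |g|² is dominated by a
translate of one integrable function h, and ∫ h serves as S. -/
theorem exists_sq_integral_convectedKernel_le (hd : 1 ≤ d) (hΦ : IsRadialProfile d κ Φ)
    (hMm : MeasurableSet M) (hM : Bornology.IsBounded M) (hK : Bornology.IsBounded K) :
    ∃ S : ℝ, 0 ≤ S ∧ ∀ y ∈ K, MemLp (fun x => convectedKernel κ m Φ A x y) 2 (volume.restrict M) ∧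
      ∫ x in M, ‖convectedKernel κ m Φ A x y‖ ^ 2 ≤ S := by
  have : Nonempty (Fin d) := ⟨⟨0, hd⟩⟩
  obtain ⟨R₁, hR₁⟩ := hM.exists_norm_le
  obtain ⟨R₂, hR₂⟩ := hK.exists_norm_le
  set R := R₁ + R₂ + 1 with hR
  obtain ⟨C, hC0, hC⟩ := exists_sq_norm_convectedKernel_le (m := m) (A := A) hΦ R
  set h : EuclideanSpace ℝ (Fin d) → ℝ := fun z =>
    (Iio R).indicator (fun t : ℝ => C * (t ^ (d - 1))⁻¹) ‖z‖ with hh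
  have hint : Integrable h := integrable_indicator_norm_inv_pow hd _ _
  have hh0 : ∀ z, 0 ≤ h z := fun z => by
    simp only [hh, indicator_apply]
    split_ifs
    · positivity
    · exact le_rfl
  have hle : ∀ y ∈ K, ∀ᵐ x ∂(volume.restrict M), ‖convectedKernel κ m Φ A x y‖ ^ 2 ≤ h (x - y) := by
    intro y hy
    have hne : ∀ᵐ x : EuclideanSpace ℝ (Fin d) ∂(volume.restrict M), x ≠ y :=
      ae_restrict_of_ae (Measure.ae_ne volume y)
    filter_upwards [hne, ae_restrict_mem hMm] with x hx hxM
    have hxy : ‖x - y‖ < R := by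
      have := norm_sub_le x y
      have := hR₁ x hxM
      have := hR₂ y hy
      rw [hR]
      linarith
    have h1 := hC x y hx hxy
    have h2 : h (x - y) = C * (‖x - y‖ ^ (d - 1))⁻¹ := indicator_of_mem (mem_Iio.2 hxy) _
    rwa [h2]
  have hmeas : ∀ y, Measurable fun x => convectedKernel κ m Φ A x y := fun y =>
    (measurable_convectedKernel hΦ.measurable).of_uncurry_right
  clear_value h
  refine ⟨∫ z, h z, integral_nonneg hh0, fun y hy => ?_⟩
  have hsh : Integrable fun x => h (x - y) := hint.comp_sub_right y
  have hi : Integrable (fun x => ‖convectedKernel κ m Φ A x y‖ ^ 2) (volume.restrict M) := by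
    refine hsh.restrict.mono' ((hmeas y).norm.pow_const 2).aestronglyMeasurable ?_
    filter_upwards [hle y hy] with x hx
    rwa [Real.norm_of_nonneg (by positivity)]
  refine ⟨(memLp_two_iff_integrable_sq_norm (hmeas y).aestronglyMeasurable).2 hi, ?_⟩
  calc ∫ x in M, ‖convectedKernel κ m Φ A x y‖ ^ 2 ≤ ∫ x in M, h (x - y) :=
        integral_mono_ae hi hsh.restrict (hle y hy)
    _ ≤ ∫ x, h (x - y) := setIntegral_le_integral hsh (ae_of_all _ fun x => hh0 _)
    _ = _ := integral_sub_right_eq_self h y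

end ConvectedKernel

/-! ### Kernels as families in `L²(M)` -/

section KernelL2

variable {d : ℕ} {M : Set (EuclideanSpace ℝ (Fin d))}
  {g : EuclideanSpace ℝ (Fin d) → EuclideanSpace ℝ (Fin d) → ℂ}

open Classical in
/-- The function `g(·, y)` as an element of `L²(M)`, and `0` if it is not square integrable. -/
noncomputable def kernelL2 (M : Set (EuclideanSpace ℝ (Fin d)))
    (g : EuclideanSpace ℝ (Fin d) → EuclideanSpace ℝ (Fin d) → ℂ) (y : EuclideanSpace ℝ (Fin d)) :
    L2 M :=
  if h : MemLp (fun x => g x y) 2 (volume.restrict M) then h.toLp else 0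

theorem coeFn_kernelL2 {y : EuclideanSpace ℝ (Fin d)}
    (hy : MemLp (fun x => g x y) 2 (volume.restrict M)) :
    kernelL2 M g y =ᵐ[volume.restrict M] fun x => g x y := by
  rw [kernelL2, dif_pos hy]
  exact hy.coeFn_toLp

theorem inner_kernelL2 {y : EuclideanSpace ℝ (Fin d)}
    (hy : MemLp (fun x => g x y) 2 (volume.restrict M)) (φ : L2 M) :
    ⟪kernelL2 M g y, φ⟫_ℂ = ∫ x in M, starRingEnd ℂ (g x y) * φ x := by
  rw [L2.inner_def]
  refine integral_congr_ae ?_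
  filter_upwards [coeFn_kernelL2 hy] with x hx
  rw [hx, RCLike.inner_apply, mul_comm]

theorem norm_L2_sq {μ : Measure (EuclideanSpace ℝ (Fin d))} (f : Lp ℂ 2 μ) :
    ‖f‖ ^ 2 = ∫ x, ‖f x‖ ^ 2 ∂μ := by
  have h := inner_self_eq_norm_sq_to_K (𝕜 := ℂ) f
  rw [L2.inner_def] at h
  have h2 : ((∫ x, ‖f x‖ ^ 2 ∂μ : ℝ) : ℂ) = ∫ x, ⟪f x, f x⟫_ℂ ∂μ := by
    rw [← integral_complex_ofReal]
    refine integral_congr_ae (ae_of_all _ fun x => ?_)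
    simp [inner_self_eq_norm_sq_to_K]
  rw [← h2] at h
  have h3 : ((∫ x, ‖f x‖ ^ 2 ∂μ : ℝ) : ℂ) = ((‖f‖ ^ 2 : ℝ) : ℂ) := by
    rw [h]; simp
  exact (Complex.ofReal_injective h3).symm

theorem norm_kernelL2_sq {y : EuclideanSpace ℝ (Fin d)}
    (hy : MemLp (fun x => g x y) 2 (volume.restrict M)) :
    ‖kernelL2 M g y‖ ^ 2 = ∫ x in M, ‖g x y‖ ^ 2 := by
  rw [norm_L2_sq]
  refine integral_congr_ae ?_
  filter_upwards [coeFn_kernelL2 hy] with x hx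
  rw [hx]

theorem continuousAt_kernelL2 (hM : volume M ≠ ∞) (hMo : MeasurableSet M)
    (hg : ∀ y, Measurable fun x => g x y)
    {y₀ : EuclideanSpace ℝ (Fin d)} {W : Set (EuclideanSpace ℝ (Fin d))} (hW : W ∈ 𝓝 y₀) {C : ℝ}
    (hC : ∀ x ∈ M, ∀ y ∈ W, ‖g x y‖ ≤ C) (hcont : ∀ x ∈ M, ContinuousAt (fun y => g x y) y₀) :
    ContinuousAt (kernelL2 M g) y₀ := by
  have : IsFiniteMeasure (volume.restrict M) := ⟨by simpa using hM.lt_top⟩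
  have hmem : ∀ y ∈ W, MemLp (fun x => g x y) 2 (volume.restrict M) := fun y hy =>
    MemLp.of_bound (hg y).aestronglyMeasurable C
      ((ae_restrict_iff' hMo).2 (ae_of_all _ fun x hx => hC x hx y hy))
  have hsq : ∀ y ∈ W, ‖kernelL2 M g y - kernelL2 M g y₀‖ ^ 2 =
      ∫ x in M, ‖g x y - g x y₀‖ ^ 2 := by
    intro y hy
    rw [norm_L2_sq]
    refine integral_congr_ae ?_
    filter_upwards [Lp.coeFn_sub (kernelL2 M g y) (kernelL2 M g y₀), coeFn_kernelL2 (hmem y hy),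
      coeFn_kernelL2 (hmem y₀ (mem_of_mem_nhds hW))] with x h1 h2 h3
    rw [h1, Pi.sub_apply, h2, h3]
  have hlim : Tendsto (fun y => ∫ x in M, ‖g x y - g x y₀‖ ^ 2) (𝓝 y₀) (𝓝 0) := by
    have : Tendsto (fun y => ∫ x in M, ‖g x y - g x y₀‖ ^ 2) (𝓝 y₀) (𝓝 (∫ x in M, (0 : ℝ))) := by
      refine tendsto_integral_filter_of_dominated_convergence (fun _ => (C + C) ^ 2) ?_ ?_
        (integrable_const _) ?_
      · exact Eventually.of_forall fun y =>
          (((hg y).sub (hg y₀)).norm.pow_const 2).aestronglyMeasurable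
      · filter_upwards [hW] with y hy
        refine (ae_restrict_iff' hMo).2 (ae_of_all _ fun x hx => ?_)
        rw [Real.norm_of_nonneg (by positivity)]
        have h1 := hC x hx y hy
        have h2 := hC x hx y₀ (mem_of_mem_nhds hW)
        have := (norm_sub_le (g x y) (g x y₀)).trans (add_le_add h1 h2)
        gcongr
      · refine (ae_restrict_iff' hMo).2 (ae_of_all _ fun x hx => ?_)
        have := ((hcont x hx).tendsto.sub_const (g x y₀)).norm.pow 2
        simpa using this
    simpa using this
  rw [ContinuousAt, tendsto_iff_norm_sub_tendsto_zero]
  have h2 := (Real.continuous_sqrt.tendsto 0).comp hlim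
  rw [Real.sqrt_zero] at h2
  refine h2.congr' ?_
  filter_upwards [hW] with y hy
  rw [Function.comp_apply, ← hsq y hy, Real.sqrt_sq (norm_nonneg _)]

end KernelL2

/-! ### Uniqueness for the convected kernel -/

theorem continuousOn_radialPotential {F : Type*} [NormedAddCommGroup F] [InnerProductSpace ℝ F]
    {α : Type*} [MeasurableSpace α] {ν : Measure α} {p : α → F} {f : α → ℂ} {K : Set F} {Φ : ℂ → ℂ}
    (hK : IsCompact K) (hΦm : Measurable Φ) (hΦ : DifferentiableOn ℂ Φ Complex.slitPlane)
    (hp : AEStronglyMeasurable p ν) (hpK : ∀ᵐ y ∂ν, p y ∈ K) (hf : Integrable f ν) :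
    ContinuousOn (radialPotential Φ ν p f) Kᶜ := by
  intro x hx
  refine ContinuousAt.continuousWithinAt ?_
  obtain ⟨δ, hδ, hδK⟩ := exists_pos_le_norm_sub hK hx
  obtain ⟨R, hR⟩ := hK.isBounded.exists_norm_le
  obtain ⟨C, hC⟩ := exists_norm_le_sector hΦ (δ := (δ / 2) ^ 2) (by positivity)
    ((‖x‖ + δ / 2 + |R|) ^ 2)
  have hnear : ∀ x' ∈ Metric.ball x (δ / 2), ∀ z ∈ K, δ / 2 ≤ ‖x' - z‖ ∧ ‖x' - z‖ ≤ ‖x‖ + δ / 2 + |R| := by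
    intro x' hx' z hz
    have h1 : ‖x' - x‖ < δ / 2 := by simpa [dist_eq_norm] using hx'
    have h2 := hδK z hz
    have h3 : ‖x - z‖ ≤ ‖x' - x‖ + ‖x' - z‖ := by
      rw [norm_sub_rev x' x]
      exact norm_sub_le_norm_sub_add_norm_sub x x' z
    have h4 : ‖x'‖ ≤ ‖x‖ + ‖x' - x‖ := norm_le_norm_add_norm_sub' x' x
    have h5 := norm_sub_le x' z
    have h6 := (hR z hz).trans (le_abs_self R)
    constructor <;> linarith
  have hmeas : ∀ x' : F, AEStronglyMeasurable (fun y => Φ ((‖x' - p y‖ ^ 2 : ℝ) : ℂ) * f y) ν := by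
    intro x'
    have h1 : AEStronglyMeasurable (fun y => x' - p y) ν := aestronglyMeasurable_const.sub hp
    have hc : Continuous fun w : F => ((‖w‖ ^ 2 : ℝ) : ℂ) := by fun_prop
    exact (hΦm.comp_aemeasurable
      (hc.comp_aestronglyMeasurable h1).aemeasurable).aestronglyMeasurable.mul hf.1
  refine continuousAt_of_dominated (bound := fun y => C * ‖f y‖) (Eventually.of_forall hmeas) ?_
    (hf.norm.const_mul C) ?_
  · filter_upwards [Metric.ball_mem_nhds x (half_pos hδ)] with x' hx'
    filter_upwards [hpK] with y hy
    obtain ⟨h1, h2⟩ := hnear x' hx' _ hy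
    rw [norm_mul]
    gcongr
    refine hC _ ?_ ?_
    · rw [Complex.ofReal_re]
      gcongr
    · rw [Complex.norm_real, Real.norm_of_nonneg (by positivity)]
      gcongr
  · filter_upwards [hpK] with y hy
    have hpos := lt_of_lt_of_le (half_pos hδ) (hnear x (Metric.mem_ball_self (half_pos hδ)) _ hy).1
    have h1 : ContinuousAt Φ ((‖x - p y‖ ^ 2 : ℝ) : ℂ) :=
      (hΦ.differentiableAt (Complex.isOpen_slitPlane.mem_nhds
        (Complex.ofReal_mem_slitPlane.2 (by positivity)))).continuousAt
    have h2 : ContinuousAt (fun x' : F => ((‖x' - p y‖ ^ 2 : ℝ) : ℂ)) x := by fun_prop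
    exact (ContinuousAt.comp (g := Φ) (x := x) h1 h2).mul continuousAt_const

section Uniqueness

variable {d : ℕ} {κ : ℝ} {m : EuclideanSpace ℝ (Fin d)} {Φ : ℂ → ℂ}
  {A : EuclideanSpace ℝ (Fin d) ≃L[ℝ] EuclideanSpace ℝ (Fin d)}
  {M Ω K : Set (EuclideanSpace ℝ (Fin d))}

/-- The convective phase depends on x - y only, so it splits into a prefactor in x and a modulation
of the density. -/
theorem integral_convectedKernel_mul {ν : Measure (EuclideanSpace ℝ (Fin d))}
    (f : EuclideanSpace ℝ (Fin d) → ℂ) (x : EuclideanSpace ℝ (Fin d)) :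
    ∫ y, convectedKernel κ m Φ A x y * f y ∂ν =
      Complex.exp (-(Complex.I * κ * (⟪x, m⟫_ℝ : ℂ))) *
        radialPotential Φ ν A (fun y => Complex.exp (Complex.I * κ * (⟪y, m⟫_ℝ : ℂ)) * f y) (A x) := by
  rw [radialPotential, ← integral_const_mul]
  refine integral_congr_ae (ae_of_all _ fun y => ?_)
  simp only [convectedKernel]
  rw [map_sub, inner_sub_left, Complex.ofReal_sub,
    show -(Complex.I * κ * ((⟪x, m⟫_ℝ : ℂ) - (⟪y, m⟫_ℝ : ℂ))) =
      -(Complex.I * κ * (⟪x, m⟫_ℝ : ℂ)) + Complex.I * κ * (⟪y, m⟫_ℝ : ℂ) by ring, Complex.exp_add]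
  ring

theorem integrable_exp_mul {ν : Measure (EuclideanSpace ℝ (Fin d))}
    {f : EuclideanSpace ℝ (Fin d) → ℂ} (hf : Integrable f ν)
    (L : EuclideanSpace ℝ (Fin d) → ℝ) (hL : Continuous L) :
    Integrable (fun y => Complex.exp (Complex.I * κ * (L y : ℂ)) * f y) ν := by
  refine hf.bdd_mul (c := 1) (Continuous.aestronglyMeasurable (by fun_prop)) (ae_of_all _ fun y => ?_)
  rw [Complex.norm_exp]
  simp [mul_assoc]

theorem exists_sign_farField_convected (hκ : 0 < κ) (hΦ : IsRadialProfile d κ Φ)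
    (A : EuclideanSpace ℝ (Fin d) ≃L[ℝ] EuclideanSpace ℝ (Fin d)) (m : EuclideanSpace ℝ (Fin d)) :
    ∃ σ : ℝ, (σ = 1 ∨ σ = -1) ∧ ∀ {ν : Measure (EuclideanSpace ℝ (Fin d))}
      {f : EuclideanSpace ℝ (Fin d) → ℂ} {K V : Set (EuclideanSpace ℝ (Fin d))},
      IsCompact K → IsPreconnected Kᶜ → (∀ᵐ y ∂ν, y ∈ K) → Integrable f ν → IsOpen V →
      V.Nonempty → V ⊆ Kᶜ → (∀ x ∈ V, ∫ y, convectedKernel κ m Φ A x y * f y ∂ν = 0) →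
      ∀ ω : EuclideanSpace ℝ (Fin d), ‖ω‖ = 1 →
        ∫ y, Complex.exp (Complex.I * (σ * κ * ⟪ω, A y⟫_ℝ : ℝ)) *
          (Complex.exp (Complex.I * κ * (⟪y, m⟫_ℝ : ℂ)) * f y) ∂ν = 0 := by
  obtain ⟨σ, hσ, h⟩ := exists_sign_farField hκ hΦ
  refine ⟨σ, hσ, fun {ν f K V} hK hKc hνK hf hV hVne hVK h0 ω hω => ?_⟩
  refine h (K := A '' K) (V := A '' V) (hK.image A.continuous) ?_
    A.continuous.aestronglyMeasurable (hνK.mono fun y hy => mem_image_of_mem A hy)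
    (integrable_exp_mul hf _ (by fun_prop)) (A.toHomeomorph.isOpenMap V hV) (hVne.image A) ?_ ?_ ω hω
  · rw [← image_compl_eq A.bijective]
    exact hKc.image A A.continuous.continuousOn
  · rw [← image_compl_eq A.bijective]
    exact image_mono hVK
  · rintro _ ⟨x, hx, rfl⟩
    have := h0 x hx
    rw [integral_convectedKernel_mul] at this
    exact (mul_eq_zero.1 this).resolve_left (Complex.exp_ne_zero _)

/-- Apply the far field statement to the unit mass at y. Its far field is a product of exponentials
and cannot vanish. -/
theorem exists_mem_convectedKernel_ne_zero (hd : 1 ≤ d) (hκ : 0 < κ) (hΦ : IsRadialProfile d κ Φ)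
    (hK : IsCompact K) (hKc : IsPreconnected Kᶜ) {V : Set (EuclideanSpace ℝ (Fin d))}
    (hV : IsOpen V) (hVne : V.Nonempty) (hVK : V ⊆ Kᶜ) {y : EuclideanSpace ℝ (Fin d)} (hy : y ∈ K) :
    ∃ x ∈ V, convectedKernel κ m Φ A x y ≠ 0 := by
  by_contra hc
  push Not at hc
  have : Nonempty (Fin d) := ⟨⟨0, hd⟩⟩
  obtain ⟨σ, -, h⟩ := exists_sign_farField_convected hκ hΦ A m
  obtain ⟨ω, hω⟩ := exists_norm_eq (EuclideanSpace ℝ (Fin d)) zero_le_one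
  have h1 := h (ν := Measure.dirac y) (f := fun _ => 1) hK hKc
    ((ae_dirac_iff hK.measurableSet).2 hy) (integrable_const 1) hV hVne hVK (fun x hx => by
      rw [integral_dirac, hc x hx, zero_mul]) ω hω
  rw [integral_dirac, mul_one] at h1
  exact mul_ne_zero (Complex.exp_ne_zero _) (Complex.exp_ne_zero _) h1

/-- Compactness of K, applied to the integral over a closed ball B in M: since B is disjoint from K,
this integral is continuous and positive in y up to the boundary of K. The bound makes the weight ‖P
y‖⁻² of normalisation (a) bounded. -/
theorem exists_pos_le_sq_integral_convectedKernel (hd : 1 ≤ d) (hκ : 0 < κ)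
    (hΦ : IsRadialProfile d κ Φ) (hK : IsCompact K) (hKc : IsPreconnected Kᶜ) (hM : IsOpen M)
    (hMne : M.Nonempty) (hMK : M ⊆ Kᶜ)
    (hint : ∀ y ∈ K, IntegrableOn (fun x => ‖convectedKernel κ m Φ A x y‖ ^ 2) M) :
    ∃ c > 0, ∀ y ∈ K, c ≤ ∫ x in M, ‖convectedKernel κ m Φ A x y‖ ^ 2 := by
  obtain ⟨x₀, hx₀⟩ := hMne
  obtain ⟨r, hr, hrM⟩ := Metric.nhds_basis_closedBall.mem_iff.1 (hM.mem_nhds hx₀)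
  set B := Metric.closedBall x₀ r with hB
  have hBc : IsCompact B := isCompact_closedBall x₀ r
  have hBK : Disjoint B K := disjoint_left.2 fun x hx => hMK (hrM hx)
  obtain ⟨C, hC⟩ := exists_norm_convectedKernel_le (κ := κ) (m := m) (A := A) hΦ.differentiableOn hBc hK hBK
  have hmeas : ∀ y, Measurable fun x => convectedKernel κ m Φ A x y := fun y =>
    (measurable_convectedKernel hΦ.measurable).of_uncurry_right
  have hcont : ContinuousOn (fun y => ∫ x in B, ‖convectedKernel κ m Φ A x y‖ ^ 2) K := by
    refine continuousOn_of_dominated (bound := fun _ => C ^ 2) ?_ ?_ ?_ ?_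
    · exact fun y _ => ((hmeas y).norm.pow_const 2).aestronglyMeasurable
    · intro y hy
      refine (ae_restrict_iff' hBc.measurableSet).2 (ae_of_all _ fun x hx => ?_)
      rw [Real.norm_of_nonneg (by positivity)]
      have := hC x hx y hy
      gcongr
    · exact integrableOn_const hBc.measure_lt_top.ne
    · refine (ae_restrict_iff' hBc.measurableSet).2 (ae_of_all _ fun x hx y hy => ?_)
      exact ((continuousAt_convectedKernel_right hΦ.differentiableOn
        (hBK.ne_of_mem hx hy)).norm.pow 2).continuousWithinAt
  have hpos : ∀ y ∈ K, 0 < ∫ x in B, ‖convectedKernel κ m Φ A x y‖ ^ 2 := by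
    intro y hy
    refine lt_of_le_of_ne (integral_nonneg fun x => by positivity) fun h0 => ?_
    have h1 := (integral_eq_zero_iff_of_nonneg_ae (ae_of_all _ fun x => by positivity)
      ((hint y hy).mono_set hrM)).1 h0.symm
    have h2 : (fun x => convectedKernel κ m Φ A x y) =ᵐ[volume.restrict (Metric.ball x₀ r)] 0 := by
      have h3 := ae_restrict_of_ae_restrict_of_subset (Metric.ball_subset_closedBall (x := x₀)) h1
      filter_upwards [h3] with x hx
      simpa using hx
    have h4 := Measure.eqOn_open_of_ae_eq h2 Metric.isOpen_ball (fun x hx =>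
      (continuousAt_convectedKernel_left hΦ.differentiableOn (hBK.ne_of_mem
        (Metric.ball_subset_closedBall hx) hy)).continuousWithinAt) continuousOn_const
    obtain ⟨x, hx, hne⟩ := exists_mem_convectedKernel_ne_zero (m := m) (A := A) hd hκ hΦ hK hKc
      Metric.isOpen_ball ⟨x₀, Metric.mem_ball_self hr⟩
      (fun x hx => hMK (hrM (Metric.ball_subset_closedBall hx))) hy
    exact hne (h4 hx)
  rcases K.eq_empty_or_nonempty with rfl | hKne
  · exact ⟨1, one_pos, fun y hy => absurd hy (notMem_empty y)⟩
  obtain ⟨y₀, hy₀, hmin⟩ := hK.exists_isMinOn hKne hcont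
  refine ⟨_, hpos y₀ hy₀, fun y hy => (hmin hy).trans ?_⟩
  exact setIntegral_mono_set (hint y hy) (ae_of_all _ fun x => by positivity)
    (Eventually.of_forall hrM)

/-- Testing with indicator functions shows that the potential vanishes almost everywhere on M. It is
continuous there, hence vanishes everywhere. -/
theorem integral_convectedKernel_eq_zero_of_inner (hΦ : IsRadialProfile d κ Φ)
    {ν : Measure (EuclideanSpace ℝ (Fin d))} [IsFiniteMeasure ν]
    (hK : IsCompact K) (hνK : ∀ᵐ y ∂ν, y ∈ K) (hM : IsOpen M) (hMb : Bornology.IsBounded M)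
    (hMK : M ⊆ Kᶜ) {S : ℝ}
    (hS : ∀ᵐ y ∂ν, MemLp (fun x => convectedKernel κ m Φ A x y) 2 (volume.restrict M) ∧
      ∫ x in M, ‖convectedKernel κ m Φ A x y‖ ≤ S)
    {f : EuclideanSpace ℝ (Fin d) → ℂ} (hf : Integrable f ν)
    (h : ∀ φ : L2 M, ∫ y, f y * ⟪φ, kernelL2 M (convectedKernel κ m Φ A) y⟫_ℂ ∂ν = 0) :
    ∀ x ∈ M, ∫ y, convectedKernel κ m Φ A x y * f y ∂ν = 0 := by
  have : IsFiniteMeasure (volume.restrict M) := ⟨by simpa using hMb.measure_lt_top⟩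
  set g := convectedKernel κ m Φ A
  have hgm : StronglyMeasurable (Function.uncurry g) :=
    (measurable_convectedKernel hΦ.measurable).stronglyMeasurable
  -- A constant factor on a one point space specialises the Fubini lemma for two kernels to a single
  -- potential.
  have hone : StronglyMeasurable (Function.uncurry fun (_ : Unit) (_ : EuclideanSpace ℝ (Fin d)) =>
    (1 : ℂ)) := stronglyMeasurable_const
  have key : ∀ s : Set (EuclideanSpace ℝ (Fin d)), MeasurableSet s →
      Integrable (fun x => ∫ y, g x y * f y ∂ν) ((volume.restrict M).restrict s) ∧
      ∫ x in s, (∫ y, g x y * f y ∂ν) ∂(volume.restrict M) = 0 := by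
    intro s hs
    have hle : ∀ y, Integrable (fun x => g x y) (volume.restrict M) →
        ∫ x in s, ‖g x y‖ ∂(volume.restrict M) ≤ ∫ x in M, ‖g x y‖ := fun y hy =>
      setIntegral_le_integral hy.norm (ae_of_all _ fun _ => norm_nonneg _)
    have h2 := integral_superposition_kernel (μ₁ := (volume.restrict M).restrict s)
      (μ₂ := Measure.dirac ()) (ν := ν) (G₁ := g) (G₂ := fun _ _ => 1) (q := f) (S₁ := S) (S₂ := 1)
      hgm hone (hS.mono fun y hy => (hy.1.integrable one_le_two).restrict)
      (ae_of_all _ fun y => integrable_const 1)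
      (hS.mono fun y hy => (hle y (hy.1.integrable one_le_two)).trans hy.2)
      (ae_of_all _ fun y => by simp) hf
    simp only [mul_one, integral_dirac] at h2
    refine ⟨?_, ?_⟩
    · have := h2.1.integral_prod_left
      simpa using this
    · rw [h2.2, ← h (indicatorConstLp 2 hs (measure_ne_top _ s) 1)]
      refine integral_congr_ae ?_
      filter_upwards [hS] with y hy
      rw [L2.inner_indicatorConstLp_one]
      congr 1
      exact integral_congr_ae (ae_restrict_of_ae (coeFn_kernelL2 hy.1).symm)
  have hae : (fun x => ∫ y, g x y * f y ∂ν) =ᵐ[volume.restrict M] 0 := by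
    refine Integrable.ae_eq_of_forall_setIntegral_eq _ _ ?_ (integrable_zero _ _ _) fun s hs _ => ?_
    · have := (key univ MeasurableSet.univ).1
      rwa [Measure.restrict_univ] at this
    · rw [(key s hs).2]
      simp
  refine Measure.eqOn_open_of_ae_eq hae hM ?_ continuousOn_const
  simp only [g, integral_convectedKernel_mul]
  refine ContinuousOn.mul (Continuous.continuousOn (by fun_prop)) ?_
  refine (continuousOn_radialPotential (hK.image A.continuous) hΦ.measurable hΦ.differentiableOn
    A.continuous.aestronglyMeasurable (hνK.mono fun y hy => mem_image_of_mem A hy)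
    (integrable_exp_mul hf _ (by fun_prop))).comp A.continuous.continuousOn fun x hx => ?_
  rw [← image_compl_eq A.bijective]
  exact mem_image_of_mem A (hMK hx)

end Uniqueness

/-! ### Superpositions of rank one operators as integral operators -/

theorem inner_toCLM_superposition {H : Type*} [NormedAddCommGroup H] [InnerProductSpace ℂ H]
    [CompleteSpace H] {X : Type*} [MeasurableSpace X] {ν : Measure X} [IsFiniteMeasure ν]
    {u : X → H} {S : ℝ} {C : Lp ℂ 2 ν →L[ℂ] HilbertSchmidt H}
    (hu : AEStronglyMeasurable (fun y => hsRankOne (u y)) ν) (hS : ∀ᵐ y ∂ν, ‖hsRankOne (u y)‖ ≤ S)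
    (hC : ∀ q : Lp ℂ 2 ν, C q = ∫ y, q y • hsRankOne (u y) ∂ν) (q : Lp ℂ 2 ν) (φ ψ : H) :
    ⟪ψ, HilbertSchmidt.toCLM (C q) φ⟫_ℂ = ∫ y, q y * (⟪u y, φ⟫_ℂ * ⟪ψ, u y⟫_ℂ) ∂ν := by
  let l : HilbertSchmidt H →L[ℂ] ℂ :=
    (innerSL ℂ ψ) ∘L (ContinuousLinearMap.apply ℂ H φ) ∘L hsInclusion
  have hl : ∀ K, l K = ⟪ψ, HilbertSchmidt.toCLM K φ⟫_ℂ := fun K => rfl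
  rw [← hl, hC, ← l.integral_comp_comm (φ := fun y => q y • hsRankOne (u y)) ((integrable_of_L2 q).smul_bdd S hu hS)]
  refine integral_congr_ae (ae_of_all _ fun y => ?_)
  simp only [map_smul, hl, smul_apply, toCLM_hsRankOne, inner_smul_right]

theorem IsIntegralOperator.unique {d : ℕ} {M : Set (EuclideanSpace ℝ (Fin d))}
    {K L : L2 M →L[ℂ] L2 M} {κ : EuclideanSpace ℝ (Fin d) → EuclideanSpace ℝ (Fin d) → ℂ}
    (hK : IsIntegralOperator M K κ) (hL : IsIntegralOperator M L κ) : K = L := by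
  ext1 φ
  refine Lp.ext ?_
  filter_upwards [hK φ, hL φ] with x h1 h2
  rw [h1.2, h2.2]

theorem IsIntegralOperator.congr {d : ℕ} {M : Set (EuclideanSpace ℝ (Fin d))}
    {K : L2 M →L[ℂ] L2 M} {κ κ' : EuclideanSpace ℝ (Fin d) → EuclideanSpace ℝ (Fin d) → ℂ}
    (hK : IsIntegralOperator M K κ) (hM : MeasurableSet M)
    (h : ∀ x₁ ∈ M, ∀ x₂ ∈ M, κ x₁ x₂ = κ' x₁ x₂) : IsIntegralOperator M K κ' := by
  intro φ
  filter_upwards [hK φ, ae_restrict_mem hM] with x hx hxM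
  have hEq : EqOn (fun x₂ => κ x x₂ * φ x₂) (fun x₂ => κ' x x₂ * φ x₂) M := fun x₂ h2 => by
    simp only
    rw [h x hxM x₂ h2]
  exact ⟨hx.1.congr_fun hEq hM, hx.2.trans (setIntegral_congr_fun hM hEq)⟩

section Operators

variable {d : ℕ} {M Ω K : Set (EuclideanSpace ℝ (Fin d))}
  {g : EuclideanSpace ℝ (Fin d) → EuclideanSpace ℝ (Fin d) → ℂ}

theorem isIntegralOperator_hsRankOne {y : EuclideanSpace ℝ (Fin d)}
    (hy : MemLp (fun x => g x y) 2 (volume.restrict M)) :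
    IsIntegralOperator M (HilbertSchmidt.toCLM (hsRankOne (kernelL2 M g y)))
      fun x₁ x₂ => g x₁ y * starRingEnd ℂ (g x₂ y) := by
  intro φ
  rw [toCLM_hsRankOne]
  filter_upwards [coeFn_kernelL2 hy, Lp.coeFn_smul ⟪kernelL2 M g y, φ⟫_ℂ (kernelL2 M g y)] with x h1 h2
  have hint : Integrable (fun x₂ => starRingEnd ℂ (g x₂ y) * φ x₂) (volume.restrict M) :=
    hy.star.integrable_mul (Lp.memLp φ)
  simp only [mul_assoc]
  refine ⟨hint.const_mul _, ?_⟩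
  rw [h2, Pi.smul_apply, h1, inner_kernelL2 hy, integral_const_mul, smul_eq_mul, mul_comm]

/-- Both candidate functions of x₁ have the same integral over every measurable s: one by pairing C
q φ with the indicator of s, the other by Fubini. -/
theorem isIntegralOperator_superposition {ν : Measure (EuclideanSpace ℝ (Fin d))}
    [IsFiniteMeasure ν] (hMb : Bornology.IsBounded M) (hg : Measurable (Function.uncurry g)) {S T : ℝ}
    (hS : ∀ᵐ y ∂ν, MemLp (fun x => g x y) 2 (volume.restrict M) ∧ ∫ x in M, ‖g x y‖ ^ 2 ≤ S)
    (hu : AEStronglyMeasurable (fun y => hsRankOne (kernelL2 M g y)) ν)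
    (hT : ∀ᵐ y ∂ν, ‖hsRankOne (kernelL2 M g y)‖ ≤ T)
    {C : Lp ℂ 2 ν →L[ℂ] HilbertSchmidt (L2 M)}
    (hC : ∀ q : Lp ℂ 2 ν, C q = ∫ y, q y • hsRankOne (kernelL2 M g y) ∂ν) (q : Lp ℂ 2 ν) :
    IsIntegralOperator M (HilbertSchmidt.toCLM (C q))
      fun x₁ x₂ => ∫ y, g x₁ y * q y * starRingEnd ℂ (g x₂ y) ∂ν := by
  intro φ
  have : IsFiniteMeasure (volume.restrict M) := ⟨by simpa using hMb.measure_lt_top⟩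
  have hφ2 : Integrable (fun x => ‖φ x‖ ^ 2) (volume.restrict M) :=
    (memLp_two_iff_integrable_sq_norm (Lp.aestronglyMeasurable φ)).1 (Lp.memLp φ)
  have hg2 : ∀ y, MemLp (fun x => g x y) 2 (volume.restrict M) →
      Integrable (fun x => ‖g x y‖ ^ 2) (volume.restrict M) := fun y hy =>
    (memLp_two_iff_integrable_sq_norm hy.1).1 hy
  have hm₂ : StronglyMeasurable
      (Function.uncurry fun (x y : EuclideanSpace ℝ (Fin d)) => starRingEnd ℂ (g x y) * φ x) := by
    have h1 : StronglyMeasurable fun z : EuclideanSpace ℝ (Fin d) × EuclideanSpace ℝ (Fin d) =>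
      starRingEnd ℂ (Function.uncurry g z) :=
      Complex.continuous_conj.comp_stronglyMeasurable hg.stronglyMeasurable
    exact h1.mul ((Lp.stronglyMeasurable φ).comp_measurable measurable_fst)
  have hi₂ : ∀ y, MemLp (fun x => g x y) 2 (volume.restrict M) →
      Integrable (fun x => starRingEnd ℂ (g x y) * φ x) (volume.restrict M) := fun y hy =>
    hy.star.integrable_mul (Lp.memLp φ)
  have key : ∀ s : Set (EuclideanSpace ℝ (Fin d)), MeasurableSet s →
      Integrable (fun x : EuclideanSpace ℝ (Fin d) × EuclideanSpace ℝ (Fin d) =>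
        (∫ y, g x.1 y * q y * starRingEnd ℂ (g x.2 y) ∂ν) * φ x.2)
        (((volume.restrict M).restrict s).prod (volume.restrict M)) ∧
      ∫ x₁ in s, (∫ x₂ in M, (∫ y, g x₁ y * q y * starRingEnd ℂ (g x₂ y) ∂ν) * φ x₂)
        ∂(volume.restrict M) = ∫ x₁ in s, HilbertSchmidt.toCLM (C q) φ x₁ ∂(volume.restrict M) := by
    intro s hs
    -- The L¹ bounds come from t ≤ 1 + t² for the first factor and st ≤ s² + t² for the second.
    have h2 := integral_superposition_kernel (μ₁ := (volume.restrict M).restrict s)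
      (μ₂ := volume.restrict M) (ν := ν) (G₁ := g) (G₂ := fun x y => starRingEnd ℂ (g x y) * φ x)
      (q := q) (S₁ := (volume.restrict M).real univ + S) (S₂ := S + ∫ x in M, ‖φ x‖ ^ 2)
      hg.stronglyMeasurable hm₂ (hS.mono fun y hy => (hy.1.integrable one_le_two).restrict)
      (hS.mono fun y hy => hi₂ y hy.1) ?_ ?_ (integrable_of_L2 q)
    · simp only [← mul_assoc, integral_mul_const] at h2
      refine ⟨h2.1, h2.2.trans ?_⟩
      rw [← L2.inner_indicatorConstLp_one (𝕜 := ℂ) hs (measure_ne_top _ s),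
        inner_toCLM_superposition hu hT hC]
      refine integral_congr_ae ?_
      filter_upwards [hS] with y hy
      rw [L2.inner_indicatorConstLp_one, inner_kernelL2 hy.1, mul_assoc]
      congr 2
      exact integral_congr_ae (ae_restrict_of_ae (coeFn_kernelL2 hy.1).symm)
    · filter_upwards [hS] with y hy
      have hi : Integrable (fun x => ‖g x y‖) (volume.restrict M) := (hy.1.integrable one_le_two).norm
      calc ∫ x in s, ‖g x y‖ ∂(volume.restrict M) ≤ ∫ x in M, ‖g x y‖ :=
            setIntegral_le_integral hi (ae_of_all _ fun _ => norm_nonneg _)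
        _ ≤ ∫ x in M, (1 + ‖g x y‖ ^ 2) :=
            integral_mono hi ((integrable_const 1).add (hg2 y hy.1)) fun x => by
              simp only
              nlinarith [sq_nonneg (‖g x y‖ - 1), norm_nonneg (g x y)]
        _ = (volume.restrict M).real univ + ∫ x in M, ‖g x y‖ ^ 2 := by
            rw [integral_add (integrable_const 1) (hg2 y hy.1)]
            simp
        _ ≤ _ := by gcongr; exact hy.2
    · filter_upwards [hS] with y hy
      calc ∫ x in M, ‖starRingEnd ℂ (g x y) * φ x‖ ≤ ∫ x in M, (‖g x y‖ ^ 2 + ‖φ x‖ ^ 2) :=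
            integral_mono (hi₂ y hy.1).norm ((hg2 y hy.1).add hφ2) fun x => by
              simp only [norm_mul, RCLike.norm_conj]
              nlinarith [sq_nonneg (‖g x y‖ - ‖φ x‖), sq_nonneg (‖g x y‖), sq_nonneg ‖φ x‖]
        _ = (∫ x in M, ‖g x y‖ ^ 2) + ∫ x in M, ‖φ x‖ ^ 2 := integral_add (hg2 y hy.1) hφ2
        _ ≤ _ := by gcongr; exact hy.2
  have huniv := (key univ MeasurableSet.univ).1
  rw [Measure.restrict_univ] at huniv
  have hae : (HilbertSchmidt.toCLM (C q) φ : EuclideanSpace ℝ (Fin d) → ℂ) =ᵐ[volume.restrict M]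
      fun x₁ => ∫ x₂ in M, (∫ y, g x₁ y * q y * starRingEnd ℂ (g x₂ y) ∂ν) * φ x₂ :=
    Integrable.ae_eq_of_forall_setIntegral_eq _ _ (integrable_of_L2 _) huniv.integral_prod_left
      fun s hs _ => (key s hs).2.symm
  filter_upwards [hae, huniv.prod_right_ae] with x h1 h2
  exact ⟨h2, h1⟩

end Operators

/-! ### Injectivity of the forward operator -/

/-- A density whose superposition of monopoles vanishes is zero. -/
theorem ae_eq_zero_of_convected_superposition {d : ℕ} {κ : ℝ} {m : EuclideanSpace ℝ (Fin d)}
    {Φ : ℂ → ℂ} {A : EuclideanSpace ℝ (Fin d) ≃L[ℝ] EuclideanSpace ℝ (Fin d)}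
    {M K : Set (EuclideanSpace ℝ (Fin d))} (hd : 2 ≤ d) (hκ : 0 < κ) (hΦ : IsRadialProfile d κ Φ)
    (hA : ∀ x y, ⟪A x, y⟫_ℝ = ⟪x, A y⟫_ℝ)
    {ν : Measure (EuclideanSpace ℝ (Fin d))} [IsFiniteMeasure ν] (hK : IsCompact K)
    (hKc : IsPreconnected Kᶜ) (hνK : ∀ᵐ y ∂ν, y ∈ K) (hM : IsOpen M)
    (hMb : Bornology.IsBounded M) (hMne : M.Nonempty) (hMK : M ⊆ Kᶜ) {S T : ℝ}
    (hS : ∀ᵐ y ∂ν, MemLp (fun x => convectedKernel κ m Φ A x y) 2 (volume.restrict M) ∧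
      ∫ x in M, ‖convectedKernel κ m Φ A x y‖ ≤ S)
    (hu : AEStronglyMeasurable (kernelL2 M (convectedKernel κ m Φ A)) ν)
    (hT : ∀ᵐ y ∂ν, ‖kernelL2 M (convectedKernel κ m Φ A) y‖ ≤ T)
    {q : EuclideanSpace ℝ (Fin d) → ℂ} (hq : Integrable q ν)
    (h : ∀ φ ψ : L2 M, ∫ y, q y * (⟪kernelL2 M (convectedKernel κ m Φ A) y, φ⟫_ℂ *
      ⟪ψ, kernelL2 M (convectedKernel κ m Φ A) y⟫_ℂ) ∂ν = 0) :
    q =ᵐ[ν] 0 := by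
  obtain ⟨σ, hσ, hfar⟩ := exists_sign_farField_convected hκ hΦ A m
  set u := kernelL2 M (convectedKernel κ m Φ A)
  have hfar' : ∀ {f : EuclideanSpace ℝ (Fin d) → ℂ}, Integrable f ν →
      (∀ φ : L2 M, ∫ y, f y * ⟪φ, u y⟫_ℂ ∂ν = 0) → ∀ ω : EuclideanSpace ℝ (Fin d), ‖ω‖ = 1 →
      ∫ y, Complex.exp (Complex.I * (σ * κ * ⟪ω, A y⟫_ℝ : ℝ)) *
        (Complex.exp (Complex.I * κ * (⟪y, m⟫_ℝ : ℂ)) * f y) ∂ν = 0 := fun hf h0 =>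
    hfar hK hKc hνK hf hM hMne hMK
      (integral_convectedKernel_eq_zero_of_inner hΦ hK hνK hM hMb hMK hS hf h0)
  have hconj : ∀ (f : EuclideanSpace ℝ (Fin d) → ℂ), ∫ y, f y ∂ν = 0 →
      ∫ y, starRingEnd ℂ (f y) ∂ν = 0 := fun f hf => by rw [integral_conj, hf, map_zero]
  have hconji : ∀ {f : EuclideanSpace ℝ (Fin d) → ℂ}, Integrable f ν →
      Integrable (fun y => starRingEnd ℂ (f y)) ν := fun hf =>
    (LinearIsometryEquiv.integrable_comp_iff Complex.conjLIE).2 hf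
  have hinner : ∀ φ : L2 M, Integrable (fun y => q y * ⟪u y, φ⟫_ℂ) ν := by
    intro φ
    refine hq.mul_bdd (c := T * ‖φ‖) (hu.inner aestronglyMeasurable_const) ?_
    filter_upwards [hT] with y hy
    exact (norm_inner_le_norm _ _).trans (by gcongr)
  let f : EuclideanSpace ℝ (Fin d) → EuclideanSpace ℝ (Fin d) → ℂ := fun ω y =>
    Complex.exp (Complex.I * (σ * κ * ⟪ω, A y⟫_ℝ : ℝ)) *
      (Complex.exp (Complex.I * κ * (⟪y, m⟫_ℝ : ℂ)) * q y)
  have hfi : ∀ ω, Integrable (f ω) ν := by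
    intro ω
    have h1 := integrable_exp_mul (κ := κ) (integrable_exp_mul (κ := κ) hq (fun y => ⟪y, m⟫_ℝ) (by fun_prop))
      (fun y => σ * ⟪ω, A y⟫_ℝ) (by fun_prop)
    refine h1.congr (ae_of_all _ fun y => ?_)
    simp only [f]
    congr 2
    push_cast
    ring
  -- First round: ψ is used up to remove one kernel factor. Conjugating puts the remaining pairing
  -- with φ into the form needed for the second round.
  have hstep : ∀ ω₁ : EuclideanSpace ℝ (Fin d), ‖ω₁‖ = 1 → ∀ φ : L2 M,
      ∫ y, starRingEnd ℂ (f ω₁ y) * ⟪φ, u y⟫_ℂ ∂ν = 0 := by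
    intro ω₁ hω₁ φ
    have h1 := hfar' (hinner φ) (fun ψ => by
      rw [← h φ ψ]
      refine integral_congr_ae (ae_of_all _ fun y => ?_)
      simp only
      ring) ω₁ hω₁
    rw [← hconj _ h1]
    refine integral_congr_ae (ae_of_all _ fun y => ?_)
    simp only [f, map_mul, inner_conj_symm]
    ring
  have hs : σ * κ ≠ 0 := mul_ne_zero (by rcases hσ with rfl | rfl <;> norm_num) hκ.ne'
  refine ae_eq_zero_of_sphere_differences (F := EuclideanSpace ℝ (Fin d)) (by simpa using hd) hq hK
    hνK (A : EuclideanSpace ℝ (Fin d) →L[ℝ] EuclideanSpace ℝ (Fin d))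
    (fun ξ => ⟨A.symm ξ, fun y => ?_⟩) hs fun ω₁ ω₂ h1 h2 => ?_
  · change ⟪A.symm ξ, A y⟫_ℝ = _
    rw [← hA, A.apply_symm_apply, real_inner_comm]
  -- Second round, with density conj (f ω₁). Its phase e^{-iκ y·m} cancels the phase of the new far
  -- field, leaving only ω₁ - ω₂ after another conjugation.
  · have h3 := hconj _ (hfar' (hconji (hfi ω₁)) (hstep ω₁ h1) ω₂ h2)
    rw [← h3]
    refine integral_congr_ae (ae_of_all _ fun y => ?_)
    simp only [f, map_mul, ← Complex.exp_conj, Complex.conj_I, Complex.conj_ofReal,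
      Complex.conj_conj, map_neg, neg_neg]
    rw [← mul_assoc, ← mul_assoc, ← mul_assoc, ← Complex.exp_add, ← Complex.exp_add, ← Complex.exp_add]
    congr 2
    change Complex.I * ((σ * κ * ⟪ω₁ - ω₂, A y⟫_ℝ : ℝ) : ℂ) = _
    rw [inner_sub_left]
    push_cast
    ring

/-! ### Uniqueness for the DAMAS equation -/

/-- Both normalisations reduce to the Gram kernel with a weight h in the integration variable. The
function h (q₁ - q₂) lies in L² and its Gram integral vanishes, so it is zero by injectivity, and h
≠ 0 can be cancelled. -/
theorem damas_unique {X : Type*} [MeasurableSpace X] {ν : Measure X} [IsFiniteMeasure ν]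
    {V : Type*} [NormedAddCommGroup V] [InnerProductSpace ℂ V] [CompleteSpace V] {P : X → V} {S B : ℝ}
    (hP : AEStronglyMeasurable P ν) (hS : ∀ᵐ y ∂ν, ‖P y‖ ≤ S)
    (hsymm : ∀ y y', ⟪P y', P y⟫_ℂ = ⟪P y, P y'⟫_ℂ)
    {C : Lp ℂ 2 ν →L[ℂ] V} (hC : ∀ q : Lp ℂ 2 ν, C q = ∫ y, q y • P y ∂ν)
    (hinj : ∀ w : Lp ℂ 2 ν, C w = 0 → w = 0) {h : X → ℂ} (hh : AEStronglyMeasurable h ν)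
    (hB : ∀ᵐ y ∂ν, ‖h y‖ ≤ B) (hne : ∀ᵐ y ∂ν, h y ≠ 0) {q₁ q₂ : Lp ℂ ∞ ν}
    (heq : ∀ᵐ y ∂ν, ∫ y', ⟪P y', P y⟫_ℂ * h y' * q₁ y' ∂ν = ∫ y', ⟪P y', P y⟫_ℂ * h y' * q₂ y' ∂ν) :
    q₁ = q₂ := by
  have hq : MemLp (fun y => h y * (q₁ y - q₂ y)) 2 ν := by
    have h1 : MemLp (fun y => q₁ y - q₂ y) ∞ ν := (Lp.memLp q₁).sub (Lp.memLp q₂)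
    have h2 : MemLp h ∞ ν := memLp_top_of_bound hh B hB
    exact (h1.mul (r := ∞) h2).mono_exponent le_top
  have hint : ∀ (q : Lp ℂ ∞ ν), ∀ y, Integrable (fun y' => ⟪P y', P y⟫_ℂ * h y' * q y') ν := by
    intro q y
    have h1 : Integrable q ν := (Lp.memLp q).integrable le_top
    refine h1.bdd_mul (c := S * ‖P y‖ * B) ((hP.inner aestronglyMeasurable_const).mul hh) ?_
    filter_upwards [hS, hB] with y' h2 h3
    rw [norm_mul]
    have h4 : ‖⟪P y', P y⟫_ℂ‖ ≤ S * ‖P y‖ := (norm_inner_le_norm _ _).trans (by gcongr)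
    exact mul_le_mul h4 h3 (norm_nonneg _) ((norm_nonneg _).trans h4)
  have hw : C hq.toLp = 0 := by
    refine superposition_eq_zero hP hS hC ?_
    filter_upwards [heq] with y hy
    rw [← sub_eq_zero, ← integral_sub (hint q₁ y) (hint q₂ y)] at hy
    rw [← hy]
    refine integral_congr_ae ?_
    filter_upwards [hq.coeFn_toLp] with y' hy'
    rw [hy', hsymm y y']
    ring
  have hzero := hinj _ hw
  refine Lp.ext ?_
  filter_upwards [hq.coeFn_toLp, hne, Lp.coeFn_zero ℂ 2 ν] with y h1 h2 h3
  rw [hzero, h3, Pi.zero_apply] at h1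
  exact sub_eq_zero.1 ((mul_eq_zero.1 h1.symm).resolve_left h2)

/-! ### Conclusion of the corollary -/

theorem covFun_eq_integral {d : ℕ} {Ω : Set (EuclideanSpace ℝ (Fin d))} (hΩ : MeasurableSet Ω)
    {k : ℝ} {m : EuclideanSpace ℝ (Fin d)}
    {g : EuclideanSpace ℝ (Fin d) → EuclideanSpace ℝ (Fin d) → ℂ}
    (q : EuclideanSpace ℝ (Fin d) → ℂ) {x₁ x₂ : EuclideanSpace ℝ (Fin d)}
    (h₁ : ∀ y ∈ Ω, green d k m x₁ y = g x₁ y) (h₂ : ∀ y ∈ Ω, green d k m x₂ y = g x₂ y) :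
    covFun Ω k m q x₁ x₂ = ∫ y in Ω, g x₁ y * q y * starRingEnd ℂ (g x₂ y) :=
  setIntegral_congr_fun hΩ fun y hy => by simp only [h₁ y hy, h₂ y hy]

/-- Reality of the Gram kernel makes the beamforming value of a real source linear in the source, as
existence for (b) requires. -/
theorem inner_hsRankOne_eq_ofReal {H : Type*} [NormedAddCommGroup H] [InnerProductSpace ℂ H]
    [CompleteSpace H] (f g : H) :
    ⟪hsRankOne f, hsRankOne g⟫_ℂ = ((‖⟪f, g⟫_ℂ‖ ^ 2 : ℝ) : ℂ) := by
  rw [inner_hsRankOne, ← inner_conj_symm, Complex.conj_mul']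
  push_cast
  rfl

theorem mainTheorem3 (d : ℕ) (hd : d = 2 ∨ d = 3)
    (Ω M : Set (EuclideanSpace ℝ (Fin d)))
    (hΩ_open : IsOpen Ω) (hΩ_bdd : Bornology.IsBounded Ω)
    (hΩ_zero : (0 : EuclideanSpace ℝ (Fin d)) ∈ Ω)
    (hΩ_conn : IsConnected (closure Ω)ᶜ)
    (hM_open : IsOpen M) (hM_bdd : Bornology.IsBounded M) (hM_nonempty : M.Nonempty)
    (hM_sub : M ⊆ (closure Ω)ᶜ)
    (k : ℝ) (hk : 0 < k) (m : EuclideanSpace ℝ (Fin d)) (hm : ‖m‖ < 1) :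
    (∃ C : L2 Ω →L[ℂ] HilbertSchmidt (L2 M), IsForwardOperator Ω M k m C) ∧
    (∃ P : EuclideanSpace ℝ (Fin d) → HilbertSchmidt (L2 M), IsMonopoleFamily Ω M k m P) ∧
    ∀ (C : L2 Ω →L[ℂ] HilbertSchmidt (L2 M))
      (P : EuclideanSpace ℝ (Fin d) → HilbertSchmidt (L2 M)),
      IsForwardOperator Ω M k m C → IsMonopoleFamily Ω M k m P →
      (∀ y ∈ Ω, P y ≠ 0) ∧
      {q : L2 Ω | ContinuousLinearMap.adjoint C (C q) = 0 ∧ MemLp q ∞ (volume.restrict Ω)} =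
        {q : L2 Ω | C q = 0 ∧ MemLp q ∞ (volume.restrict Ω)} ∧
      {q : L2 Ω | C q = 0 ∧ MemLp q ∞ (volume.restrict Ω)} = {0} ∧
      (∀ Cobs ∈ range C, ∀ q₁ q₂ : LInfty Ω,
        IsDamasSolution Ω (fun y => beamforming Cobs (P y)) (psf P) q₁ →
        IsDamasSolution Ω (fun y => beamforming Cobs (P y)) (psf P) q₂ → q₁ = q₂) ∧
      (∀ Cobs ∈ range C, ∀ q₁ q₂ : LInfty Ω,
        IsDamasSolution Ω (fun y => beamforming Cobs (P y)) (psfFocus P) q₁ →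
        IsDamasSolution Ω (fun y => beamforming Cobs (P y)) (psfFocus P) q₂ → q₁ = q₂) ∧
      (∀ (p : L2 Ω) (q : LInfty Ω), (p =ᵐ[volume.restrict Ω] q) →
        (∀ᵐ y ∂(volume.restrict Ω), (q y).im = 0) →
        IsDamasSolution Ω (fun y => beamforming (C p) (P y)) (psfFocus P) q) := by
  have hd2 : 2 ≤ d := by lia
  have hκ : 0 < k / betaSq m := div_pos hk (betaSq_pos hm)
  obtain ⟨Φ, hΦ, hgreen⟩ := exists_radialProfile_green hd hk hm
  obtain ⟨A, hAn, hAs⟩ := exists_machEquiv hm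
  set g := convectedKernel (k / betaSq m) m Φ A with hgdef
  have hgg : ∀ {x y}, x ≠ y → green d k m x y = g x y := fun {x y} hxy => by
    rw [hgreen x y hxy, hgdef, convectedKernel, hAn]
  set K := closure Ω with hKdef
  have hK : IsCompact K := hΩ_bdd.isCompact_closure
  have hΩK : Ω ⊆ K := subset_closure
  have hΩm := hΩ_open.measurableSet
  have hMm := hM_open.measurableSet
  have hne : ∀ x ∈ M, ∀ y ∈ Ω, x ≠ y := fun x hx y hy hxy => hM_sub hx (hΩK (hxy ▸ hy))
  have hΩfin : IsFiniteMeasure (volume.restrict Ω) := ⟨by simpa using hΩ_bdd.measure_lt_top⟩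
  have hMfin : IsFiniteMeasure (volume.restrict M) := ⟨by simpa using hM_bdd.measure_lt_top⟩
  have hνΩ : ∀ᵐ y ∂(volume.restrict Ω), y ∈ Ω := ae_restrict_mem hΩm
  obtain ⟨S, hS0, hS⟩ := exists_sq_integral_convectedKernel_le (m := m) (A := A) (by lia) hΦ hMm
    hM_bdd hK.isBounded
  obtain ⟨c, hc0, hc⟩ := exists_pos_le_sq_integral_convectedKernel (m := m) (A := A) (by lia) hκ hΦ
    hK hΩ_conn.isPreconnected hM_open hM_nonempty hM_sub fun y hy =>
      (memLp_two_iff_integrable_sq_norm (hS y hy).1.1).1 (hS y hy).1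
  have hgm : ∀ y, Measurable fun x => g x y := fun y =>
    (measurable_convectedKernel hΦ.measurable).of_uncurry_right
  set u := kernelL2 M g with hu
  have hun : ∀ y ∈ K, ‖u y‖ ^ 2 = ∫ x in M, ‖g x y‖ ^ 2 := fun y hy => norm_kernelL2_sq (hS y hy).1
  have hucont : ContinuousOn u Ω := by
    intro y₀ hy₀
    refine ContinuousAt.continuousWithinAt ?_
    obtain ⟨r, hr, hrΩ⟩ := Metric.nhds_basis_closedBall.mem_iff.1 (hΩ_open.mem_nhds hy₀)
    -- An open set disjoint from M misses its closure, so the kernel is bounded on M × a closed ball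
    -- inside Ω.
    have hdisj : Disjoint (closure M) (Metric.closedBall y₀ r) :=
      ((disjoint_left.2 fun x hx hy => hne x hx x hy rfl : Disjoint M Ω).closure_left
        hΩ_open).mono_right hrΩ
    obtain ⟨B, hB⟩ := exists_norm_convectedKernel_le (κ := k / betaSq m) (m := m) (A := A)
      hΦ.differentiableOn hM_bdd.isCompact_closure (isCompact_closedBall y₀ r) hdisj
    exact continuousAt_kernelL2 hM_bdd.measure_lt_top.ne hMm hgm (Metric.closedBall_mem_nhds y₀ hr)
      (fun x hx y hy => hB x (subset_closure hx) y hy)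
      fun x hx => continuousAt_convectedKernel_right hΦ.differentiableOn (hne x hx y₀ hy₀)
  have hum : AEStronglyMeasurable u (volume.restrict Ω) := hucont.aestronglyMeasurable hΩm
  set P₀ : EuclideanSpace ℝ (Fin d) → HilbertSchmidt (L2 M) := fun y => hsRankOne (u y) with hP₀
  have hP₀m : AEStronglyMeasurable P₀ (volume.restrict Ω) :=
    continuous_hsRankOne.comp_aestronglyMeasurable hum
  have hP₀n : ∀ y ∈ K, c ≤ ‖P₀ y‖ ∧ ‖P₀ y‖ ≤ S := fun y hy => by
    rw [hP₀, norm_hsRankOne, hun y hy]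
    exact ⟨hc y hy, (hS y hy).2⟩
  have hP₀S : ∀ᵐ y ∂(volume.restrict Ω), ‖P₀ y‖ ≤ S := hνΩ.mono fun y hy => (hP₀n y (hΩK hy)).2
  obtain ⟨C₀, hC₀⟩ := exists_superposition hP₀m hP₀S
  have hC₀fwd : IsForwardOperator Ω M k m C₀ := by
    intro q
    refine ⟨fun x₁ hx₁ x₂ hx₂ => ?_, ?_⟩
    · have hbd : ∀ x ∈ M, ∃ B, ∀ y ∈ Ω, ‖g x y‖ ≤ B := fun x hx => by
        obtain ⟨B, hB⟩ := exists_norm_convectedKernel_le (κ := k / betaSq m) (m := m) (A := A)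
          hΦ.differentiableOn (isCompact_singleton (x := x)) hK (disjoint_singleton_left.2 (hM_sub hx))
        exact ⟨B, fun y hy => hB x rfl y (hΩK hy)⟩
      obtain ⟨B₁, hB₁⟩ := hbd x₁ hx₁
      obtain ⟨B₂, hB₂⟩ := hbd x₂ hx₂
      have hgm' : ∀ x, Measurable fun y => g x y := fun x =>
        (measurable_convectedKernel hΦ.measurable).of_uncurry_left
      have h1 : Integrable (fun y => g x₁ y * q y * starRingEnd ℂ (g x₂ y)) (volume.restrict Ω) := by
        refine ((integrable_of_L2 q).bdd_mul (c := B₁) (hgm' x₁).aestronglyMeasurable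
          (hνΩ.mono fun y hy => hB₁ y hy)).mul_bdd (c := B₂)
          (Complex.continuous_conj.measurable.comp (hgm' x₂)).aestronglyMeasurable
          (hνΩ.mono fun y hy => ?_)
        simpa using hB₂ y hy
      refine h1.congr (hνΩ.mono fun y hy => ?_)
      simp only [hgg (hne x₁ hx₁ y hy), hgg (hne x₂ hx₂ y hy)]
    · refine (isIntegralOperator_superposition hM_bdd (measurable_convectedKernel hΦ.measurable)
        (hνΩ.mono fun y hy => hS y (hΩK hy)) hP₀m hP₀S hC₀ q).congr hMm fun x₁ hx₁ x₂ hx₂ => ?_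
      exact (covFun_eq_integral hΩm q (fun y hy => hgg (hne x₁ hx₁ y hy))
        fun y hy => hgg (hne x₂ hx₂ y hy)).symm
  have hP₀mono : IsMonopoleFamily Ω M k m P₀ := by
    intro y hy
    refine (isIntegralOperator_hsRankOne (hS y (hΩK hy)).1).congr hMm fun x₁ hx₁ x₂ hx₂ => ?_
    simp only [hgg (hne x₁ hx₁ y hy), hgg (hne x₂ hx₂ y hy), hgdef]
  refine ⟨⟨C₀, hC₀fwd⟩, ⟨P₀, hP₀mono⟩, fun C P hC hP => ?_⟩
  -- An integral operator is determined by its kernel, so any forward operator is the superposition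
  -- of the rank one monopoles.
  obtain rfl : C = C₀ := by
    ext1 q
    exact HilbertSchmidt.toCLM_injective ((hC q).2.unique (hC₀fwd q).2)
  have hPP : ∀ y ∈ Ω, P y = P₀ y := fun y hy =>
    HilbertSchmidt.toCLM_injective ((hP y hy).unique (hP₀mono y hy))
  have hinj : ∀ q : L2 Ω, C q = 0 → q = 0 := by
    intro q hq
    have h1 : q =ᵐ[volume.restrict Ω] (0 : EuclideanSpace ℝ (Fin d) → ℂ) := by
      refine ae_eq_zero_of_convected_superposition (m := m) (S := (volume.restrict M).real univ + S)
        (T := Real.sqrt S) hd2 hκ hΦ hAs hK hΩ_conn.isPreconnected (hνΩ.mono fun y hy => hΩK hy)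
        hM_open hM_bdd hM_nonempty hM_sub (hνΩ.mono fun y hy => ⟨(hS y (hΩK hy)).1, ?_⟩) hum
        (hνΩ.mono fun y hy => Real.le_sqrt_of_sq_le ?_) (integrable_of_L2 q) fun φ ψ => ?_
      · have hi2 := (memLp_two_iff_integrable_sq_norm (hS y (hΩK hy)).1.1).1 (hS y (hΩK hy)).1
        calc ∫ x in M, ‖g x y‖ ≤ ∫ x in M, (1 + ‖g x y‖ ^ 2) :=
              integral_mono ((hS y (hΩK hy)).1.integrable one_le_two).norm
                ((integrable_const 1).add hi2) fun x => by
                  simp only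
                  nlinarith [sq_nonneg (‖g x y‖ - 1), norm_nonneg (g x y)]
          _ = (volume.restrict M).real univ + ∫ x in M, ‖g x y‖ ^ 2 := by
              rw [integral_add (integrable_const 1) hi2]
              simp [hgdef]
          _ ≤ _ := by gcongr; exact (hS y (hΩK hy)).2
      · exact (hun y (hΩK hy)).trans_le (hS y (hΩK hy)).2
      · rw [← inner_toCLM_superposition hP₀m hP₀S hC₀, hq, map_zero,
          zero_apply, inner_zero_right]
    exact Lp.ext (h1.trans (Lp.coeFn_zero ℂ 2 _).symm)
  have hsymm : ∀ y y', ⟪P₀ y', P₀ y⟫_ℂ = ⟪P₀ y, P₀ y'⟫_ℂ := fun y y' => inner_hsRankOne_comm _ _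
  have hP₀ne : ∀ y ∈ Ω, P₀ y ≠ 0 := fun y hy =>
    norm_pos_iff.1 (hc0.trans_le (hP₀n y (hΩK hy)).1)
  refine ⟨fun y hy => (hPP y hy).symm ▸ hP₀ne y hy, ?_, ?_, ?_, ?_, ?_⟩
  · ext q
    -- ⟪q, C* C q⟫ = ‖C q‖², so C* C and C have the same kernel.
    refine and_congr_left fun _ => ⟨fun h => ?_, fun h => by rw [h, map_zero]⟩
    rw [← inner_self_eq_zero (𝕜 := ℂ), ← ContinuousLinearMap.adjoint_inner_right, h,
      inner_zero_right]
  · ext q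
    refine ⟨fun h => hinj q h.1, ?_⟩
    rintro rfl
    exact ⟨map_zero C, MemLp.ae_eq (Lp.coeFn_zero ℂ 2 _).symm MemLp.zero⟩
  · rintro Cobs - q₁ q₂ h₁ h₂
    -- For (a) the weight is ‖P y'‖⁻², bounded by c⁻². For (b), below, the weight is 1 after
    -- multiplying by ‖P y‖², which does not depend on y'.
    refine damas_unique hP₀m hP₀S hsymm hC₀ hinj (h := fun y => ((‖P₀ y‖ ^ 2 : ℝ) : ℂ)⁻¹)
      (B := (c ^ 2)⁻¹) ?_ (hνΩ.mono fun y hy => ?_) (hνΩ.mono fun y hy => ?_) ?_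
    · exact (Complex.measurable_ofReal.comp_aemeasurable
        (hP₀m.norm.aemeasurable.pow_const 2)).inv.aestronglyMeasurable
    · rw [norm_inv, Complex.norm_real, Real.norm_of_nonneg (by positivity)]
      have := (hP₀n y (hΩK hy)).1
      gcongr
    · have := norm_pos_iff.2 (hP₀ne y hy)
      exact inv_ne_zero (by exact_mod_cast (by positivity : ‖P₀ y‖ ^ 2 ≠ 0))
    · filter_upwards [h₁, h₂, hνΩ] with y e₁ e₂ hy
      have hcongr : ∀ q : LInfty Ω, ∫ y' in Ω, psf P y y' * q y' =
          ∫ y' in Ω, ⟪P₀ y', P₀ y⟫_ℂ * ((‖P₀ y'‖ ^ 2 : ℝ) : ℂ)⁻¹ * q y' := fun q =>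
        setIntegral_congr_fun hΩm fun y' hy' => by
          simp only [psf, hPP y hy, hPP y' hy', div_eq_mul_inv]
      rw [← hcongr, ← hcongr, ← e₁, ← e₂]
  · rintro Cobs - q₁ q₂ h₁ h₂
    refine damas_unique hP₀m hP₀S hsymm hC₀ hinj (h := fun _ => 1) (B := 1)
      aestronglyMeasurable_const (ae_of_all _ fun _ => by simp) (ae_of_all _ fun _ => one_ne_zero) ?_
    filter_upwards [h₁, h₂, hνΩ] with y e₁ e₂ hy
    have hpos : ((‖P₀ y‖ ^ 2 : ℝ) : ℂ) ≠ 0 := by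
      have := norm_pos_iff.2 (hP₀ne y hy)
      exact_mod_cast (by positivity : ‖P₀ y‖ ^ 2 ≠ 0)
    have hcongr : ∀ q : LInfty Ω, ∫ y' in Ω, ⟪P₀ y', P₀ y⟫_ℂ * 1 * q y' =
        ((‖P₀ y‖ ^ 2 : ℝ) : ℂ) * ∫ y' in Ω, psfFocus P y y' * q y' := fun q => by
      rw [← integral_const_mul]
      refine setIntegral_congr_fun hΩm fun y' hy' => ?_
      simp only [psfFocus, hPP y hy, hPP y' hy', mul_one]
      field_simp
    rw [hcongr, hcongr, ← e₁, ← e₂]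
  · intro p q hpq hq
    filter_upwards [hνΩ] with y hy
    -- Since q is real and the Gram kernel is |⟪u y, u y'⟫|², the pairing is real and the real part
    -- in the beamforming value can be dropped.
    have hIr : ⟪P₀ y, C p⟫_ℂ = ((∫ y' in Ω, (q y').re * ‖⟪u y, u y'⟫_ℂ‖ ^ 2 : ℝ) : ℂ) := by
      rw [inner_superposition hP₀m hP₀S hC₀, ← integral_complex_ofReal]
      refine integral_congr_ae ?_
      filter_upwards [hpq, hq] with y' e₁ e₂
      rw [e₁, hP₀, inner_hsRankOne_eq_ofReal, Complex.ofReal_mul]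
      congr 1
      exact Complex.ext rfl (by simp [e₂])
    have hI : ((⟪P₀ y, C p⟫_ℂ).re : ℂ) = ⟪P₀ y, C p⟫_ℂ := by rw [hIr, Complex.ofReal_re]
    rw [beamforming, hPP y hy, Complex.ofReal_div, hI, inner_superposition hP₀m hP₀S hC₀,
      ← integral_div]
    refine integral_congr_ae ?_
    filter_upwards [hpq, hνΩ] with y' e₁ hy'
    rw [psfFocus, hPP y hy, hPP y' hy', hsymm, e₁]
    ring
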